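/- Consider the one-dimensional complex Ginzburg–Landau equation $$\partial_t u=(1+i\beta)\partial_x^2u-(1+i\delta)u-uH(|u|^2)+\mu G(u),\qquad x\in\mathbb R,\ t\ge 0,\tag{GL}$$ for a complex-valued function $u=u(t,x)$, where $\beta,\delta,\mu$ are real, $H:\mathbb R\to\mathbb C$ is $C^\infty$ with $H(0)=0$, and $G:\mathbb C\to\mathbb C$ is $C^\infty$ in the real sense. Suppose that for some constant $C$ $$\operatorname{Re}H(z)\cdot z\ge -C,\qquad |H(z)|\le C(1+z^2)\qquad\text{for all } z\ge 0,$$ and that the perturbation $G$ is subordinate to the unperturbed terms: for some constant $K$ and all $u\in\mathbb C$ $$|G(u)|\le K(1+|u|^5),\qquad |\operatorname{Re}(G(u)\bar u)|\le K\bigl(1+|u|^2+|\operatorname{Re}H(|u|^2)|\,|u|^2\bigr)$$ (this holds, for instance, for $G\equiv 1$ and for every $G$ of at most linear growth). Then there is $\mu_0>0$, depending on $\beta,\delta,H,G$, such that for every real $\mu$ with $|\mu|<\mu_0$ the following hold. (a) Equation (GL) is well-posed in the space $C_b(\mathbb R)$ of bounded continuous complex-valued functions with the supremum norm. For every $u_0\in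 C_b(\mathbb R)$ there is a global solution $u$ with $u(0,\cdot)=u_0$: it is continuous on $[0,\infty)\times\mathbb R$ and bounded on $[0,T]\times\mathbb R$ for every $T>0$, it has continuous derivatives $\partial_tu,\partial_x^2u$ on $(0,\infty)\times\mathbb R$ and satisfies (GL) there, and $t\mapsto u(t,\cdot)\in C_b(\mathbb R)$ is continuous on $(0,\infty)$. On each $[0,T]$ the solution is unique among the functions that are continuous and bounded on $[0,T]\times\mathbb R$, have continuous $\partial_tu,\partial_x^2u$ on $(0,T)\times\mathbb R$, and satisfy (GL) there. It depends continuously in $C_b(\mathbb R)$ on $u_0\in C_b(\mathbb R)$, uniformly on bounded time intervals. (b) The maps $S(t):u_0\mapsto u(t,\cdot)$, $t\ge0$, form a semigroup on $C_b(\mathbb R)$ which is dissipative: there is a ball of $C_b(\mathbb R)$ such that for every bounded $B\subset C_b(\mathbb R)$ the set $S(t)B$ lies in this ball for all $t\ge T(B)$. (c) $S(t)$ has a (locally compact) global attractor, that is, a set $\mathcal A\subset C_b(\mathbb R)$ which is bounded in $C_b(\mathbb R)$ and compact in $C_{loc}(\mathbb R)$ (uniform convergence on compact sets), is strictly invariant,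 $S(t)\mathcal A=\mathcal A$ for all $t\ge0$, and attracts bounded sets locally: for every neighborhood $\mathcal O$ of $\mathcal A$ in the topology of $C_{loc}(\mathbb R)$ and every bounded $B\subset C_b(\mathbb R)$ there is $T$ such that $S(t)B\subset\mathcal O$ for all $t\ge T$. -/

import Mathlib

open Set Filter Topology
open scoped BoundedContinuousFunction ContDiff

/-- `u` (read as `u t x`, with `t` the time and `x` the position) is a classical solution on the
time interval `[0, T]` of the Ginzburg-Landau equation
`∂ₜ u = (1 + iβ) ∂ₓ² u - (1 + iδ) u - u H(|u|²) + μ G(u)`, `x ∈ ℝ`: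
it is continuous and bounded on `[0, T] × ℝ`, it has continuous derivatives `∂ₜ u` and `∂ₓ² u` on
`(0, T) × ℝ`, and it satisfies the equation there pointwise. -/
structure IsGLSolution (β δ μ : ℝ) (H : ℝ → ℂ) (G : ℂ → ℂ) (T : ℝ) (u : ℝ → ℝ → ℂ) : Prop where
  continuousOn : ContinuousOn (fun p : ℝ × ℝ => u p.1 p.2) (Icc 0 T ×ˢ univ)
  bounded : ∃ M : ℝ, ∀ t ∈ Icc 0 T, ∀ x : ℝ, ‖u t x‖ ≤ M
  differentiable_time : ∀ t ∈ Ioo 0 T, ∀ x : ℝ, DifferentiableAt ℝ (fun s => u s x) t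
  contDiff_space : ∀ t ∈ Ioo 0 T, ContDiff ℝ 2 (u t)
  continuousOn_deriv_time :
    ContinuousOn (fun p : ℝ × ℝ => deriv (fun s => u s p.2) p.1) (Ioo 0 T ×ˢ univ)
  continuousOn_deriv_space :
    ContinuousOn (fun p : ℝ × ℝ => iteratedDeriv 2 (u p.1) p.2) (Ioo 0 T ×ˢ univ)
  equation : ∀ t ∈ Ioo 0 T, ∀ x : ℝ,
    deriv (fun s => u s x) t =
      (1 + Complex.I * β) * iteratedDeriv 2 (u t) x - (1 + Complex.I * δ) * u t x
        - u t x * H (‖u t x‖ ^ 2) + μ * G (u t x)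

/-- The Ginzburg-Landau equation is well-posed in `C_b(ℝ)` (with the supremum norm), and `S t u₀`
(`t ≥ 0`) is the value at time `t` of the solution that starts from `u₀`: global existence,
uniqueness (on every time interval `[0, T]`), and continuous dependence on the initial data,
uniformly on bounded time intervals. Solutions are continuous in time with values in `C_b(ℝ)` for
`t > 0`; at `t = 0` the initial value is attained locally uniformly, by `IsGLSolution`. (Convergence
in the supremum norm as `t → 0` fails for data that are not uniformly continuous, already for the
heat equation.) -/
structure IsGLWellPosedWith (β δ μ : ℝ) (H : ℝ → ℂ) (G : ℂ → ℂ)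
    (S : ℝ → (ℝ →ᵇ ℂ) → (ℝ →ᵇ ℂ)) : Prop where
  initial : ∀ u₀ : ℝ →ᵇ ℂ, S 0 u₀ = u₀
  solution : ∀ u₀ : ℝ →ᵇ ℂ, ∀ T : ℝ, 0 < T → IsGLSolution β δ μ H G T (fun t x => S t u₀ x)
  unique : ∀ (u₀ : ℝ →ᵇ ℂ) (T : ℝ) (u : ℝ → ℝ → ℂ), IsGLSolution β δ μ H G T u →
    (∀ x : ℝ, u 0 x = u₀ x) → ∀ t ∈ Icc 0 T, ∀ x : ℝ, u t x = S t u₀ x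
  continuousOn_time : ∀ u₀ : ℝ →ᵇ ℂ, ContinuousOn (fun t => S t u₀) (Ioi 0)
  continuous_dependence : ∀ (u₀ : ℝ →ᵇ ℂ) (T : ℝ), ∀ ε > 0, ∃ η > 0, ∀ v₀ : ℝ →ᵇ ℂ,
    ‖v₀ - u₀‖ < η → ∀ t ∈ Icc 0 T, ‖S t v₀ - S t u₀‖ < ε

/-- `S t`, `t ≥ 0`, is a semigroup of maps of `C_b(ℝ)` into itself. -/
structure IsSemigroupOnCb (S : ℝ → (ℝ →ᵇ ℂ) → (ℝ →ᵇ ℂ)) : Prop where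
  zero : ∀ u : ℝ →ᵇ ℂ, S 0 u = u
  add : ∀ s t : ℝ, 0 ≤ s → 0 ≤ t → ∀ u : ℝ →ᵇ ℂ, S (s + t) u = S s (S t u)

/-- The semigroup is dissipative: some ball of `C_b(ℝ)` absorbs every bounded set. -/
def IsDissipativeOnCb (S : ℝ → (ℝ →ᵇ ℂ) → (ℝ →ᵇ ℂ)) : Prop :=
  ∃ R : ℝ, ∀ B : Set (ℝ →ᵇ ℂ), Bornology.IsBounded B →
    ∃ T : ℝ, 0 ≤ T ∧ ∀ t : ℝ, T ≤ t → ∀ u ∈ B, ‖S t u‖ ≤ R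

/-- The image in `C_loc(ℝ)` of a set of `C_b(ℝ)`. Mathlib's topology on `C(ℝ, ℂ)` is the
compact-open one, that is, uniform convergence on compact sets. -/
def toCloc (A : Set (ℝ →ᵇ ℂ)) : Set C(ℝ, ℂ) :=
  (fun u : ℝ →ᵇ ℂ => u.toContinuousMap) '' A

/-- `A` is a global (locally compact) attractor of the semigroup `S` in `C_b(ℝ)`. -/
structure IsLocallyCompactGlobalAttractor (S : ℝ → (ℝ →ᵇ ℂ) → (ℝ →ᵇ ℂ))
    (A : Set (ℝ →ᵇ ℂ)) : Prop where
  bounded : Bornology.IsBounded A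
  compact_loc : IsCompact (toCloc A)
  invariant : ∀ t : ℝ, 0 ≤ t → S t '' A = A
  attracts : ∀ O : Set C(ℝ, ℂ), IsOpen O → toCloc A ⊆ O →
    ∀ B : Set (ℝ →ᵇ ℂ), Bornology.IsBounded B →
      ∃ T : ℝ, 0 ≤ T ∧ ∀ t : ℝ, T ≤ t → toCloc (S t '' B) ⊆ O

/-! Write a = 1 + iβ and let F be the reaction term. If |μ| K ≤ 1/2, half of the unperturbed
dissipation absorbs G, so that Re(F(w) w̄) ≤ C - |w|²/2 and |F(w)| ≤ C (1 + |w|⁵)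
(`dissipativeForce_glForce`). The dynamics then use only these two bounds and the C¹ regularity of
F.

The heart is an a priori bound in the supremum norm. Since a is complex there is no maximum
principle, and quintic growth is critical for L² energies in dimension one. Testing the equation
with ū against the weight 1/(1 + ε²(x - x₀)²) shows, uniformly in x₀, that the local energy Y decays
into a fixed ball and that the local dissipation D has a bounded integral over unit time intervals
(`IsRegular.energy_le`, `IsRegular.integral_dissipation_le`). Interpolation gives |u|⁴ ≤ 9 (1 + Y)²
(1 + D) near x₀ (`norm_pow_four_le`), and the right side is integrable in time. In a localised
Duhamel formula the quintic term is therefore an integrable coefficient times |u|, and Gronwall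
closes the estimate (`exists_local_bound`). For t > 1 one may start from a time in [t - 1, t] where
D does not exceed its mean; the bound then forgets the initial data except through Y, which gives
the absorbing ball (`exists_global_bounds`).

Existence: outside a large ball F is replaced by the damping -w/2. The truncated force is globally
Lipschitz, so a contraction gives a mild solution, which the heat kernel makes classical. The
structural constants do not depend on the radius, so the a priori bound keeps the solution where the
truncation is invisible (`exists_isRegular`).

Uniqueness and stability: bounded classical solutions satisfy Duhamel's formula
(`SolvesOn.mild_formula`), and Gronwall applies in the supremum norm with a weight W. With W = 1 it
yields uniqueness and continuous dependence; with W = 1 + x² it yields continuity of S(t) on bounded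
sets for the topology of C_loc.

Attractor: within the absorbing ball, solutions are uniformly Lipschitz after a unit time, so
Arzelà-Ascoli provides an absorbing set that is compact in C_loc. The attractor consists of the
cluster points of the tails of trajectories (`exists_attractor`). -/

namespace GinzburgLandau

open MeasureTheory

/-! ### Convolution with a kernel at diffusive scale. -/

/-- Continuous kernels that decay like `(1 + y²)⁻²`. -/
structure Decays (φ : ℝ → ℂ) : Prop where
  cont : Continuous φ
  bound : ∃ C, 0 ≤ C ∧ ∀ y, ‖φ y‖ ≤ C * ((1 + y ^ 2) ^ 2)⁻¹

/-- The second moment norm of a kernel. -/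
noncomputable def mass (φ : ℝ → ℂ) : ℝ := ∫ y, ‖φ y‖ * (1 + y ^ 2)

/-- Convolution of `g` with the kernel `φ` rescaled to the diffusive length `√τ`. -/
noncomputable def gconv (φ : ℝ → ℂ) (τ : ℝ) (g : ℝ → ℂ) (x : ℝ) : ℂ :=
  ∫ y, φ y * g (x - √τ * y)

lemma Decays.integrable_weight {φ : ℝ → ℂ} (h : Decays φ) :
    Integrable (fun y => ‖φ y‖ * (1 + y ^ 2)) := by
  obtain ⟨C, hC, hb⟩ := h.bound
  refine (integrable_inv_one_add_sq.const_mul C).mono' ?_ (ae_of_all _ fun y => ?_)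
  · have := h.cont
    exact Continuous.aestronglyMeasurable (by fun_prop)
  · have hy : 0 < 1 + y ^ 2 := by positivity
    rw [Real.norm_of_nonneg (by positivity)]
    calc ‖φ y‖ * (1 + y ^ 2) ≤ C * ((1 + y ^ 2) ^ 2)⁻¹ * (1 + y ^ 2) := by gcongr; exact hb y
      _ = C * (1 + y ^ 2)⁻¹ := by field_simp

lemma Decays.integrable_norm {φ : ℝ → ℂ} (h : Decays φ) : Integrable (fun y => ‖φ y‖) := by
  refine h.integrable_weight.mono' h.cont.norm.aestronglyMeasurable (ae_of_all _ fun y => ?_)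
  rw [norm_norm]
  nlinarith [norm_nonneg (φ y), mul_nonneg (norm_nonneg (φ y)) (sq_nonneg y)]

lemma mass_nonneg (φ : ℝ → ℂ) : 0 ≤ mass φ :=
  integral_nonneg fun y => by positivity

lemma Decays.integral_norm_le {φ : ℝ → ℂ} (h : Decays φ) : ∫ y, ‖φ y‖ ≤ mass φ := by
  refine integral_mono h.integrable_norm h.integrable_weight fun y => ?_
  simp only
  nlinarith [norm_nonneg (φ y), mul_nonneg (norm_nonneg (φ y)) (sq_nonneg y)]

lemma norm_gconv_le {φ : ℝ → ℂ} (h : Decays φ) (τ : ℝ) {g : ℝ → ℂ} {M : ℝ}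
    (hg : ∀ z, ‖g z‖ ≤ M) (x : ℝ) : ‖gconv φ τ g x‖ ≤ mass φ * M := by
  have hM : 0 ≤ M := (norm_nonneg _).trans (hg 0)
  calc ‖gconv φ τ g x‖ ≤ ∫ y, ‖φ y‖ * M := by
        refine norm_integral_le_of_norm_le (h.integrable_norm.mul_const M) (ae_of_all _ fun y => ?_)
        rw [norm_mul]; gcongr; exact hg _
    _ = (∫ y, ‖φ y‖) * M := integral_mul_const _ _
    _ ≤ mass φ * M := by gcongr; exact h.integral_norm_le

lemma one_add_sub_sq_le (x p : ℝ) : 1 + (x - p) ^ 2 ≤ 2 * (1 + x ^ 2) * (1 + p ^ 2) := by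
  nlinarith [sq_nonneg (x + p), sq_nonneg (x * p), sq_nonneg x, sq_nonneg p]

/-- The polynomial weight is nearly translation invariant, 1 + (x - p)² ≤ 2 (1 + x²)(1 + p²), and
the factor 1 + p² is paid by the second moment inside `mass`. This is what later allows stability
estimates in the norm weighted by 1 + x². -/
lemma norm_gconv_le_weight {φ : ℝ → ℂ} (h : Decays φ) {τ : ℝ} (hτ : 0 ≤ τ) {g : ℝ → ℂ} {N : ℝ}
    (hg : ∀ z, ‖g z‖ ≤ N * (1 + z ^ 2)) (x : ℝ) :
    ‖gconv φ τ g x‖ ≤ mass φ * (2 * (1 + τ)) * (N * (1 + x ^ 2)) := by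
  have hN : 0 ≤ N := by simpa using (norm_nonneg _).trans (hg 0)
  calc ‖gconv φ τ g x‖ ≤ ∫ y, (‖φ y‖ * (1 + y ^ 2)) * (2 * (1 + τ) * (N * (1 + x ^ 2))) := by
        refine norm_integral_le_of_norm_le (h.integrable_weight.mul_const _)
          (ae_of_all _ fun y => ?_)
        rw [norm_mul, mul_assoc]
        gcongr
        refine (hg _).trans ?_
        have h1 := one_add_sub_sq_le x (√τ * y)
        rw [mul_pow, Real.sq_sqrt hτ] at h1
        have h2 : 1 + τ * y ^ 2 ≤ (1 + τ) * (1 + y ^ 2) := by nlinarith [sq_nonneg y]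
        calc N * (1 + (x - √τ * y) ^ 2) ≤ N * (2 * (1 + x ^ 2) * (1 + τ * y ^ 2)) := by gcongr
          _ ≤ N * (2 * (1 + x ^ 2) * ((1 + τ) * (1 + y ^ 2))) := by gcongr
          _ = _ := by ring
    _ = _ := by rw [integral_mul_const, mass]; ring

lemma Decays.integrable_mul {φ : ℝ → ℂ} (h : Decays φ) {g : ℝ → ℂ} (hg : Continuous g) {M : ℝ}
    (hM : ∀ z, ‖g z‖ ≤ M) : Integrable (fun y => φ y * g y) := by
  have := h.cont
  refine (h.integrable_norm.mul_const M).mono' (Continuous.aestronglyMeasurable (by fun_prop))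
    (ae_of_all _ fun y => ?_)
  rw [norm_mul]; gcongr; exact hM _

lemma gconv_sub {φ : ℝ → ℂ} (h : Decays φ) (τ : ℝ) {f g : ℝ → ℂ} (hf : Continuous f)
    (hg : Continuous g) {M N : ℝ} (hM : ∀ z, ‖f z‖ ≤ M) (hN : ∀ z, ‖g z‖ ≤ N) (x : ℝ) :
    gconv φ τ (fun z => f z - g z) x = gconv φ τ f x - gconv φ τ g x := by
  simp only [gconv, mul_sub]
  exact integral_sub (h.integrable_mul (by fun_prop) fun z => hM _)
    (h.integrable_mul (by fun_prop) fun z => hN _)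

lemma gconv_const_mul (φ : ℝ → ℂ) (τ : ℝ) (c : ℂ) (g : ℝ → ℂ) (x : ℝ) :
    gconv φ τ (fun z => c * g z) x = c * gconv φ τ g x := by
  simp only [gconv, ← integral_const_mul]
  congr 1; ext y; ring

/-- The scale sits in the argument of g and not in the kernel, so the integrand stays continuous
down to τ = 0, where √τ = 0. Dominated convergence then gives continuity up to the initial time,
jointly in all parameters. -/
lemma continuousAt_gconv {P : Type*} [TopologicalSpace P] [FirstCountableTopology P]
    {φ : ℝ → ℂ} (h : Decays φ) {p₀ : P} {τ ξ : P → ℝ} {g : P → ℝ → ℂ} {M : ℝ}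
    (hτ : ContinuousAt τ p₀) (hξ : ContinuousAt ξ p₀) (hc : ∀ᶠ p in 𝓝 p₀, Continuous (g p))
    (hg : ∀ z, ContinuousAt (Function.uncurry g) (p₀, z))
    (hM : ∀ᶠ p in 𝓝 p₀, ∀ z, ‖g p z‖ ≤ M) :
    ContinuousAt (fun p => gconv φ (τ p) (g p) (ξ p)) p₀ := by
  have hφ := h.cont
  refine continuousAt_of_dominated (bound := fun y => ‖φ y‖ * M) ?_ ?_
    (h.integrable_norm.mul_const M) (ae_of_all _ fun y => ?_)
  · filter_upwards [hc] with p hp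
    exact Continuous.aestronglyMeasurable (by fun_prop)
  · filter_upwards [hM] with p hp
    refine ae_of_all _ fun y => ?_
    rw [norm_mul]; gcongr; exact hp _
  · refine continuousAt_const.mul ?_
    have h1 : ContinuousAt (fun p => (p, ξ p - √(τ p) * y)) p₀ := by
      refine continuousAt_id.prodMk (hξ.sub ((Real.continuous_sqrt.continuousAt.comp hτ).mul
        continuousAt_const))
    exact ContinuousAt.comp (f := fun p => (p, ξ p - √(τ p) * y)) (hg _) h1

lemma continuous_gconv {P : Type*} [TopologicalSpace P] [FirstCountableTopology P]
    {φ : ℝ → ℂ} (h : Decays φ) {τ ξ : P → ℝ} {g : P → ℝ → ℂ} {M : ℝ}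
    (hτ : Continuous τ) (hξ : Continuous ξ) (hg : Continuous (Function.uncurry g))
    (hM : ∀ p z, ‖g p z‖ ≤ M) :
    Continuous (fun p => gconv φ (τ p) (g p) (ξ p)) :=
  continuous_iff_continuousAt.2 fun p => continuousAt_gconv h hτ.continuousAt hξ.continuousAt
    (Eventually.of_forall fun q => by
      exact hg.comp (Continuous.prodMk_right q)) (fun z => hg.continuousAt)
    (Eventually.of_forall fun q => hM q)

/-- For τ > 0 the substitution z = x - √τ y moves x and τ into the kernel. Derivatives then fall on
the kernel, and g need only be continuous and bounded. -/
lemma gconv_eq_integral_kernel {τ : ℝ} (hτ : 0 < τ) (φ : ℝ → ℂ) (g : ℝ → ℂ) (x : ℝ) :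
    gconv φ τ g x = ∫ z, ((√τ)⁻¹ : ℝ) * φ ((x - z) / √τ) * g z := by
  have hs : 0 < √τ := Real.sqrt_pos.2 hτ
  have h1 := integral_sub_left_eq_self
    (fun w => ((√τ)⁻¹ : ℝ) * φ (w / √τ) * g (x - w)) volume x
  simp only [sub_sub_cancel] at h1
  rw [h1]
  have h2 := Measure.integral_comp_mul_left
    (fun w => ((√τ)⁻¹ : ℝ) * φ (w / √τ) * g (x - w)) (√τ)
  rw [abs_of_pos (inv_pos.2 hs)] at h2
  have h3 : (∫ w, ((√τ)⁻¹ : ℝ) * φ (w / √τ) * g (x - w))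
      = √τ • ∫ y, ((√τ)⁻¹ : ℝ) * φ (√τ * y / √τ) * g (x - √τ * y) := by
    rw [h2, smul_smul, mul_inv_cancel₀ hs.ne', one_smul]
  rw [h3, ← integral_smul, gconv]
  congr 1; ext y
  rw [mul_div_cancel_left₀ _ hs.ne', Complex.real_smul, ← mul_assoc, ← mul_assoc,
    ← Complex.ofReal_mul, mul_inv_cancel₀ hs.ne']
  simp

/-- Supplies an integrable majorant in z that is locally uniform in x and τ: with q = (x - z)/√τ, 1
+ z² is at most 2 (1 + x²)(1 + τ)(1 + q²), which the decay in q pays for. -/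
lemma Decays.bound_rescaled {φ : ℝ → ℂ} (h : Decays φ) :
    ∃ C, 0 ≤ C ∧ ∀ τ, 0 < τ → ∀ x z,
      ‖φ ((x - z) / √τ)‖ ≤ C * ((1 + x ^ 2) * (1 + τ)) * (1 + z ^ 2)⁻¹ := by
  obtain ⟨C, hC, hb⟩ := h.bound
  refine ⟨2 * C, by positivity, fun τ hτ x z => (hb _).trans ?_⟩
  set q := (x - z) / √τ with hq
  have hxz : (x - z) ^ 2 = τ * q ^ 2 := by
    rw [hq, div_pow, Real.sq_sqrt hτ.le]; field_simp
  have h1 := one_add_sub_sq_le x (x - z)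
  rw [sub_sub_cancel, hxz] at h1
  have h2 : 1 + τ * q ^ 2 ≤ (1 + τ) * (1 + q ^ 2) := by nlinarith [sq_nonneg q]
  have h3 : (1 + z ^ 2) ≤ 2 * (1 + x ^ 2) * ((1 + τ) * (1 + q ^ 2) ^ 2) := by
    refine h1.trans ?_
    gcongr
    refine h2.trans ?_
    gcongr
    nlinarith [sq_nonneg q]
  rw [← div_eq_mul_inv, ← div_eq_mul_inv, div_le_div_iff₀ (by positivity) (by positivity)]
  calc C * (1 + z ^ 2) ≤ C * (2 * (1 + x ^ 2) * ((1 + τ) * (1 + q ^ 2) ^ 2)) := by gcongr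
    _ = _ := by ring

lemma hasDerivAt_gconv_kernel {φ φ' : ℝ → ℂ} (h : Decays φ) (h' : Decays φ')
    (hd : ∀ y, HasDerivAt φ (φ' y) y) {τ : ℝ} (hτ : 0 < τ) {g : ℝ → ℂ} (hg : Continuous g) {M : ℝ}
    (hM : ∀ z, ‖g z‖ ≤ M) (x : ℝ) :
    HasDerivAt (gconv φ τ g) (((√τ)⁻¹ : ℝ) * gconv φ' τ g x) x := by
  have hs : 0 < √τ := Real.sqrt_pos.2 hτ
  have hM0 : 0 ≤ M := (norm_nonneg _).trans (hM 0)
  have hφ := h.cont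
  have hφ' := h'.cont
  obtain ⟨C, hC, hb⟩ := h'.bound_rescaled
  have e : gconv φ τ g = fun x => ∫ z, ((√τ)⁻¹ : ℝ) * φ ((x - z) / √τ) * g z :=
    funext fun x => gconv_eq_integral_kernel hτ φ g x
  rw [e, gconv_eq_integral_kernel hτ, ← integral_const_mul]
  have hint : Integrable (fun z => ((√τ)⁻¹ : ℝ) * φ ((x - z) / √τ) * g z) := by
    obtain ⟨D, hD, hDb⟩ := h.bound_rescaled
    refine (integrable_inv_one_add_sq.const_mul
      ((√τ)⁻¹ * (D * ((1 + x ^ 2) * (1 + τ))) * M)).mono'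
      (Continuous.aestronglyMeasurable (by fun_prop)) (ae_of_all _ fun z => ?_)
    rw [norm_mul, norm_mul, Complex.norm_real, Real.norm_of_nonneg (by positivity)]
    calc (√τ)⁻¹ * ‖φ ((x - z) / √τ)‖ * ‖g z‖
        ≤ (√τ)⁻¹ * (D * ((1 + x ^ 2) * (1 + τ)) * (1 + z ^ 2)⁻¹) * M := by
          gcongr; exacts [hDb τ hτ x z, hM z]
      _ = _ := by ring
  refine (hasDerivAt_integral_of_dominated_loc_of_deriv_le
    (bound := fun z => ((√τ)⁻¹ * ((√τ)⁻¹ * (C * ((1 + (|x| + 1) ^ 2) * (1 + τ))) * M)) *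
      (1 + z ^ 2)⁻¹)
    (F := fun x z => ((√τ)⁻¹ : ℝ) * φ ((x - z) / √τ) * g z)
    (F' := fun x z => ((√τ)⁻¹ : ℝ) * (((√τ)⁻¹ : ℝ) * φ' ((x - z) / √τ) * g z))
    (Metric.ball_mem_nhds x one_pos) (Eventually.of_forall fun x' =>
      Continuous.aestronglyMeasurable (by fun_prop)) hint
    (Continuous.aestronglyMeasurable (by fun_prop)) (ae_of_all _ fun z x' hx' => ?_)
    (integrable_inv_one_add_sq.const_mul _) (ae_of_all _ fun z x' _ => ?_)).2
  · have hx1 : x' ^ 2 ≤ (|x| + 1) ^ 2 := by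
      rw [← sq_abs x']
      have : |x'| ≤ |x| + 1 := by
        have := Metric.mem_ball.1 hx'
        rw [Real.dist_eq] at this
        have := abs_sub_abs_le_abs_sub x' x
        linarith
      gcongr
    rw [norm_mul, norm_mul, norm_mul, Complex.norm_real, Real.norm_of_nonneg (by positivity)]
    calc (√τ)⁻¹ * ((√τ)⁻¹ * ‖φ' ((x' - z) / √τ)‖ * ‖g z‖)
        ≤ (√τ)⁻¹ * ((√τ)⁻¹ * (C * ((1 + x' ^ 2) * (1 + τ)) * (1 + z ^ 2)⁻¹) * M) := by
          gcongr; exacts [hb τ hτ x' z, hM z]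
      _ ≤ (√τ)⁻¹ * ((√τ)⁻¹ * (C * ((1 + (|x| + 1) ^ 2) * (1 + τ)) * (1 + z ^ 2)⁻¹) * M) := by
          gcongr
      _ = _ := by ring
  · have h1 : HasDerivAt (fun x : ℝ => (x - z) / √τ) ((√τ)⁻¹) x' := by
      simpa using ((hasDerivAt_id x').sub_const z).div_const (√τ)
    have h2 := (hd ((x' - z) / √τ)).scomp x' h1
    have h3 := (h2.const_mul (((√τ)⁻¹ : ℝ) : ℂ)).mul_const (g z)
    refine h3.congr_deriv ?_
    rw [Complex.real_smul]; ring

/-- When g is differentiable the derivative may fall on g and costs no factor τ^(-1/2), in contrast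
to `hasDerivAt_gconv_kernel`. Trading one form for the other keeps the time singularities
integrable. -/
lemma hasDerivAt_gconv_of_hasDerivAt {φ : ℝ → ℂ} (h : Decays φ) (τ : ℝ) {g g' : ℝ → ℂ}
    (hd : ∀ z, HasDerivAt g (g' z) z) (hg' : Continuous g') {M M' : ℝ}
    (hM : ∀ z, ‖g z‖ ≤ M) (hM' : ∀ z, ‖g' z‖ ≤ M') (x : ℝ) :
    HasDerivAt (gconv φ τ g) (gconv φ τ g' x) x := by
  have hφ := h.cont
  have hg : Continuous g := continuous_iff_continuousAt.2 fun z => (hd z).continuousAt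
  refine (hasDerivAt_integral_of_dominated_loc_of_deriv_le (bound := fun y => ‖φ y‖ * M')
    (F := fun x y => φ y * g (x - √τ * y)) (F' := fun x y => φ y * g' (x - √τ * y))
    univ_mem (Eventually.of_forall fun x' => Continuous.aestronglyMeasurable (by fun_prop))
    (h.integrable_mul (by fun_prop) fun z => hM _)
    (Continuous.aestronglyMeasurable (by fun_prop)) (ae_of_all _ fun y x' _ => ?_)
    (h.integrable_norm.mul_const _) (ae_of_all _ fun y x' _ => ?_)).2
  · rw [norm_mul]; gcongr; exact hM' _
  · have := (hd (x' - √τ * y)).comp_sub_const x' (√τ * y)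
    exact this.const_mul _

/-! ### The heat kernel with a complex diffusion coefficient. -/

/-- The Gaussian profile of the semigroup generated by `a ∂ₓ²`. -/
noncomputable def heatK (a : ℂ) (y : ℝ) : ℂ :=
  (∫ z : ℝ, Complex.exp (-(1 / (4 * a)) * (z : ℂ) ^ 2))⁻¹ *
    Complex.exp (-(1 / (4 * a)) * (y : ℂ) ^ 2)

/-- The first derivative of `heatK`. -/
noncomputable def heatK₁ (a : ℂ) (y : ℝ) : ℂ := -((y : ℂ) / (2 * a)) * heatK a y

/-- The second derivative of `heatK`. -/
noncomputable def heatK₂ (a : ℂ) (y : ℝ) : ℂ :=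
  -(1 / (2 * a)) * (heatK a y + y * heatK₁ a y)

lemma re_quarter_inv_pos {a : ℂ} (ha : 0 < a.re) : 0 < (1 / (4 * a)).re := by
  have h0 : a ≠ 0 := by rintro rfl; simp at ha
  have : (4 * a) = ((4 : ℝ) : ℂ) * a := by norm_num
  rw [this, one_div, Complex.inv_re, Complex.re_ofReal_mul]
  have : 0 < Complex.normSq (((4 : ℝ) : ℂ) * a) := Complex.normSq_pos.2 (by simp [h0])
  positivity

/-- The profile is normalised by its own integral, so no branch of √(4πa) has to be chosen; it is
enough that the Gaussian integral does not vanish. -/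
lemma integral_heatK {a : ℂ} (ha : 0 < a.re) : ∫ y, heatK a y = 1 := by
  simp only [heatK]
  rw [integral_const_mul]
  refine inv_mul_cancel₀ ?_
  have h0 : a ≠ 0 := by rintro rfl; simp at ha
  rw [integral_gaussian_complex (re_quarter_inv_pos ha)]
  have : (Real.pi : ℂ) / (1 / (4 * a)) ≠ 0 := by
    simp [h0, Real.pi_ne_zero]
  rw [Complex.cpow_def_of_ne_zero this]
  exact Complex.exp_ne_zero _

lemma hasDerivAt_heatK (a : ℂ) (y : ℝ) : HasDerivAt (heatK a) (heatK₁ a y) y := by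
  have h1 : HasDerivAt (fun y : ℝ => (y : ℂ)) 1 y := Complex.ofRealCLM.hasDerivAt
  have h2 := (((h1.pow 2).const_mul (-(1 / (4 * a)))).cexp).const_mul
    ((∫ z : ℝ, Complex.exp (-(1 / (4 * a)) * (z : ℂ) ^ 2))⁻¹)
  refine h2.congr_deriv ?_
  simp only [heatK₁, heatK]
  by_cases ha : a = 0
  · simp [ha]
  · simp; field_simp; ring

lemma hasDerivAt_heatK₁ (a : ℂ) (y : ℝ) : HasDerivAt (heatK₁ a) (heatK₂ a y) y := by
  have h1 : HasDerivAt (fun y : ℝ => (y : ℂ)) 1 y := Complex.ofRealCLM.hasDerivAt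
  have h2 := ((h1.div_const (2 * a)).neg).mul (hasDerivAt_heatK a y)
  refine h2.congr_deriv ?_
  simp only [heatK₂, Pi.neg_apply]; ring

/-- From p³/3! ≤ exp p at p = ρ (1 + y²). The third power leaves one factor 1 + y² to spare, which
the polynomial prefactors of the first two derivatives of the Gaussian consume. -/
lemma exp_neg_mul_sq_le {ρ : ℝ} (hρ : 0 < ρ) (y : ℝ) :
    Real.exp (-ρ * y ^ 2) ≤ 6 * Real.exp ρ / ρ ^ 3 * ((1 + y ^ 2) ^ 3)⁻¹ := by
  have h1 := Real.pow_div_factorial_le_exp (ρ * (1 + y ^ 2)) (by positivity) 3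
  have h2 : Real.exp (-ρ * y ^ 2) = Real.exp ρ * (Real.exp (ρ * (1 + y ^ 2)))⁻¹ := by
    rw [← Real.exp_neg, ← Real.exp_add]; ring_nf
  rw [h2]
  have h3 : (Real.exp (ρ * (1 + y ^ 2)))⁻¹ ≤ ((ρ * (1 + y ^ 2)) ^ 3 / (Nat.factorial 3 : ℝ))⁻¹ := by
    gcongr
  calc _ ≤ Real.exp ρ * ((ρ * (1 + y ^ 2)) ^ 3 / (Nat.factorial 3 : ℝ))⁻¹ := by gcongr
    _ = _ := by
      have : (Nat.factorial 3 : ℝ) = 6 := by norm_num [Nat.factorial]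
      rw [this]; field_simp

lemma norm_heatK_le {a : ℂ} (ha : 0 < a.re) :
    ∃ C, 0 ≤ C ∧ ∀ y, ‖heatK a y‖ ≤ C * ((1 + y ^ 2) ^ 3)⁻¹ := by
  have hρ := re_quarter_inv_pos ha
  set ρ := (1 / (4 * a)).re with hρd
  refine ⟨‖(∫ z : ℝ, Complex.exp (-(1 / (4 * a)) * (z : ℂ) ^ 2))⁻¹‖ * (6 * Real.exp ρ / ρ ^ 3),
    by positivity, fun y => ?_⟩
  rw [heatK, norm_mul, mul_assoc]
  gcongr
  rw [Complex.norm_exp]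
  have : (-(1 / (4 * a)) * (y : ℂ) ^ 2).re = -ρ * y ^ 2 := by
    rw [← Complex.ofReal_pow, Complex.re_mul_ofReal, Complex.neg_re]
  rw [this]
  exact exp_neg_mul_sq_le hρ y

lemma continuous_heatK (a : ℂ) : Continuous (heatK a) :=
  continuous_iff_continuousAt.2 fun y => (hasDerivAt_heatK a y).continuousAt

lemma continuous_heatK₁ (a : ℂ) : Continuous (heatK₁ a) :=
  continuous_iff_continuousAt.2 fun y => (hasDerivAt_heatK₁ a y).continuousAt

lemma decays_of_norm_le {φ ψ : ℝ → ℂ} (hc : Continuous φ) {B : ℝ} (hB : 0 ≤ B)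
    (h : ∀ y, ‖φ y‖ ≤ B * (1 + y ^ 2) * ‖ψ y‖)
    (hψ : ∃ C, 0 ≤ C ∧ ∀ y, ‖ψ y‖ ≤ C * ((1 + y ^ 2) ^ 3)⁻¹) : Decays φ := by
  obtain ⟨C, hC, hb⟩ := hψ
  refine ⟨hc, B * C, by positivity, fun y => (h y).trans ?_⟩
  calc B * (1 + y ^ 2) * ‖ψ y‖ ≤ B * (1 + y ^ 2) * (C * ((1 + y ^ 2) ^ 3)⁻¹) := by
        gcongr; exact hb y
    _ = _ := by field_simp

lemma decays_heatK {a : ℂ} (ha : 0 < a.re) : Decays (heatK a) :=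
  decays_of_norm_le (continuous_heatK a) zero_le_one (fun y => by
    nlinarith [norm_nonneg (heatK a y), mul_nonneg (norm_nonneg (heatK a y)) (sq_nonneg y)])
    (norm_heatK_le ha)

lemma decays_heatK₁ {a : ℂ} (ha : 0 < a.re) : Decays (heatK₁ a) := by
  refine decays_of_norm_le (continuous_heatK₁ a) (norm_nonneg (1 / (2 * a))) (fun y => ?_)
    (norm_heatK_le ha)
  have : heatK₁ a y = -(1 / (2 * a)) * y * heatK a y := by rw [heatK₁]; ring
  rw [this, norm_mul, norm_mul, norm_neg, Complex.norm_real]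
  gcongr
  rw [Real.norm_eq_abs]
  nlinarith [abs_nonneg y, sq_abs y, sq_nonneg (|y| - 1)]

lemma continuous_heatK₂ (a : ℂ) : Continuous (heatK₂ a) := by
  have h1 := continuous_heatK a
  have h2 := continuous_heatK₁ a
  have : Continuous fun y : ℝ => (y : ℂ) := Complex.continuous_ofReal
  unfold heatK₂
  fun_prop

lemma decays_heatK₂ {a : ℂ} (ha : 0 < a.re) : Decays (heatK₂ a) := by
  refine decays_of_norm_le (continuous_heatK₂ a)
    (B := ‖1 / (2 * a)‖ * (1 + ‖1 / (2 * a)‖)) (by positivity) (fun y => ?_)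
    (norm_heatK_le ha)
  have : heatK₂ a y = -(1 / (2 * a)) * (1 - (1 / (2 * a)) * y ^ 2) * heatK a y := by
    rw [heatK₂, heatK₁]; ring
  rw [this, norm_mul, norm_mul, norm_neg]
  refine mul_le_mul_of_nonneg_right ?_ (norm_nonneg _)
  rw [mul_assoc ‖1 / (2 * a)‖]
  refine mul_le_mul_of_nonneg_left ?_ (norm_nonneg _)
  refine (norm_sub_le (1 : ℂ) _).trans ?_
  rw [norm_one, norm_mul, norm_pow, Complex.norm_real, Real.norm_eq_abs, sq_abs]
  nlinarith [norm_nonneg (1 / (2 * a)), sq_nonneg y]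

/-- The self-similar form of the heat equation, a K'' = -(y K)'/2. It says exactly that τ^(-1/2)
K(q/√τ) solves ∂_τ k = a ∂_q² k. -/
lemma heatK_ode {a : ℂ} (ha : a ≠ 0) (y : ℝ) :
    a * heatK₂ a y = -(1 / 2) * (heatK a y + y * heatK₁ a y) := by
  rw [heatK₂]; field_simp

/-- At τ = 0 the scaled convolution degenerates to multiplication by the integral of K, which is 1,
so the semigroup starts from the identity with no limit to take. -/
lemma gconv_heatK_zero {a : ℂ} (ha : 0 < a.re) (g : ℝ → ℂ) (x : ℝ) :
    gconv (heatK a) 0 g x = g x := by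
  simp only [gconv, Real.sqrt_zero, zero_mul, sub_zero]
  rw [integral_mul_const, integral_heatK ha, one_mul]

/-- The heat kernel in the space variable `q`. -/
noncomputable def heatKernel (a : ℂ) (τ q : ℝ) : ℂ := ((√τ)⁻¹ : ℝ) * heatK a (q / √τ)

/-- The space derivative of the heat kernel. -/
noncomputable def heatKernel₁ (a : ℂ) (τ q : ℝ) : ℂ :=
  ((√τ)⁻¹ : ℝ) * (((√τ)⁻¹ : ℝ) * heatK₁ a (q / √τ))

/-- The second space derivative of the heat kernel. -/
noncomputable def heatKernel₂ (a : ℂ) (τ q : ℝ) : ℂ :=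
  ((√τ)⁻¹ : ℝ) * (((√τ)⁻¹ : ℝ) * (((√τ)⁻¹ : ℝ) * heatK₂ a (q / √τ)))

lemma hasDerivAt_comp_div {φ φ' : ℝ → ℂ} (hd : ∀ y, HasDerivAt φ (φ' y) y) (s q : ℝ) :
    HasDerivAt (fun q => φ (q / s)) ((s⁻¹ : ℝ) * φ' (q / s)) q := by
  have h1 : HasDerivAt (fun q : ℝ => q / s) (s⁻¹) q := by
    simpa using (hasDerivAt_id q).div_const s
  have h2 := (hd (q / s)).scomp q h1
  refine h2.congr_deriv ?_
  rw [Complex.real_smul]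

lemma hasDerivAt_heatKernel (a : ℂ) (τ q : ℝ) :
    HasDerivAt (heatKernel a τ) (heatKernel₁ a τ q) q :=
  (hasDerivAt_comp_div (hasDerivAt_heatK a) (√τ) q).const_mul _

lemma hasDerivAt_heatKernel₁ (a : ℂ) (τ q : ℝ) :
    HasDerivAt (heatKernel₁ a τ) (heatKernel₂ a τ q) q :=
  ((hasDerivAt_comp_div (hasDerivAt_heatK₁ a) (√τ) q).const_mul _).const_mul _

lemma hasDerivAt_heatKernel_time {a : ℂ} (ha : a ≠ 0) {τ : ℝ} (hτ : 0 < τ) (q : ℝ) :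
    HasDerivAt (fun τ => heatKernel a τ q) (a * heatKernel₂ a τ q) τ := by
  have hs : 0 < √τ := Real.sqrt_pos.2 hτ
  have h1 : HasDerivAt (fun τ : ℝ => (√τ)⁻¹) (-(1 / (2 * √τ)) / (√τ) ^ 2) τ :=
    (Real.hasDerivAt_sqrt hτ.ne').inv hs.ne'
  have h2 : HasDerivAt (fun τ : ℝ => q / √τ) (q * (-(1 / (2 * √τ)) / (√τ) ^ 2)) τ := by
    simpa [div_eq_mul_inv] using h1.const_mul q
  have h3 := (hasDerivAt_heatK a (q / √τ)).scomp τ h2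
  have h4 := h1.ofReal_comp.mul h3
  refine h4.congr_deriv ?_
  have hode := heatK_ode ha (q / √τ)
  have e : a * heatKernel₂ a τ q = ((√τ)⁻¹ : ℝ) * (((√τ)⁻¹ : ℝ) * (((√τ)⁻¹ : ℝ) *
      (a * heatK₂ a (q / √τ)))) := by rw [heatKernel₂]; ring
  rw [e, hode, Complex.real_smul]
  have hs' : ((√τ : ℝ) : ℂ) ≠ 0 := by exact_mod_cast hs.ne'
  simp only [Function.comp]
  push_cast
  field_simp
  ring

lemma hasDerivAt_gconv_time {a : ℂ} (ha : 0 < a.re) {τ : ℝ} (hτ : 0 < τ) {g : ℝ → ℂ}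
    (hg : Continuous g) {M : ℝ} (hM : ∀ z, ‖g z‖ ≤ M) (x : ℝ) :
    HasDerivAt (fun τ => gconv (heatK a) τ g x)
      (a * ((((√τ)⁻¹ : ℝ) * (((√τ)⁻¹ : ℝ)) * gconv (heatK₂ a) τ g x))) τ := by
  have h0 : a ≠ 0 := by rintro rfl; simp at ha
  have hM0 : 0 ≤ M := (norm_nonneg _).trans (hM 0)
  have hφ := continuous_heatK a
  have hφ' := continuous_heatK₂ a
  obtain ⟨C, hC, hb⟩ := (decays_heatK₂ ha).bound_rescaled
  have hint : Integrable (fun z => heatKernel a τ (x - z) * g z) := by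
    obtain ⟨D, hD, hDb⟩ := (decays_heatK ha).bound_rescaled
    refine (integrable_inv_one_add_sq.const_mul
      ((√τ)⁻¹ * (D * ((1 + x ^ 2) * (1 + τ))) * M)).mono' ?_ (ae_of_all _ fun z => ?_)
    · unfold heatKernel; exact Continuous.aestronglyMeasurable (by fun_prop)
    rw [heatKernel, norm_mul, norm_mul, Complex.norm_real, Real.norm_of_nonneg (by positivity)]
    calc (√τ)⁻¹ * ‖heatK a ((x - z) / √τ)‖ * ‖g z‖
        ≤ (√τ)⁻¹ * (D * ((1 + x ^ 2) * (1 + τ)) * (1 + z ^ 2)⁻¹) * M := by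
          gcongr; exacts [hDb τ hτ x z, hM z]
      _ = _ := by ring
  -- Restricting τ' to [τ/2, 2τ] keeps the inverse square roots and the decay bound uniform.
  have key := (hasDerivAt_integral_of_dominated_loc_of_deriv_le
    (F := fun τ z => heatKernel a τ (x - z) * g z)
    (F' := fun τ z => a * heatKernel₂ a τ (x - z) * g z) (μ := volume)
    (bound := fun z => ((√(τ / 2))⁻¹ * ((√(τ / 2))⁻¹ * ((√(τ / 2))⁻¹ * ‖a‖ *
      (C * ((1 + x ^ 2) * (1 + 2 * τ))) * M))) * (1 + z ^ 2)⁻¹)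
    (Icc_mem_nhds (by linarith : τ / 2 < τ) (by linarith : τ < 2 * τ))
    (Eventually.of_forall fun τ' => by
      unfold heatKernel; exact Continuous.aestronglyMeasurable (by fun_prop)) hint
    (by unfold heatKernel₂; exact Continuous.aestronglyMeasurable (by fun_prop))
    (ae_of_all _ fun z τ' hτ' => ?_)
    (integrable_inv_one_add_sq.const_mul _) (ae_of_all _ fun z τ' hτ' => ?_)).2
  · have e1 : (∫ z, a * heatKernel₂ a τ (x - z) * g z) =
        a * ((((√τ)⁻¹ : ℝ) * (((√τ)⁻¹ : ℝ)) * gconv (heatK₂ a) τ g x)) := by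
      rw [gconv_eq_integral_kernel hτ, ← integral_const_mul, ← integral_const_mul]
      congr 1; ext z; rw [heatKernel₂]; ring
    rw [← e1]
    refine key.congr_of_eventuallyEq ?_
    filter_upwards [lt_mem_nhds hτ] with τ' hτ'
    rw [gconv_eq_integral_kernel hτ']
    rfl
  · have hτ0 : 0 < τ' := by linarith [hτ'.1]
    have h1 : (√τ')⁻¹ ≤ (√(τ / 2))⁻¹ := by
      gcongr
      exact hτ'.1
    have h2 := hb τ' hτ0 x z
    have h3 : ‖heatK₂ a ((x - z) / √τ')‖ ≤
        C * ((1 + x ^ 2) * (1 + 2 * τ)) * (1 + z ^ 2)⁻¹ := by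
      refine h2.trans ?_
      gcongr
      exact hτ'.2
    simp only [heatKernel₂, norm_mul, Complex.norm_real]
    rw [Real.norm_of_nonneg (by positivity : 0 ≤ (√τ')⁻¹)]
    calc ‖a‖ * ((√τ')⁻¹ * ((√τ')⁻¹ * ((√τ')⁻¹ * ‖heatK₂ a ((x - z) / √τ')‖))) * ‖g z‖
        ≤ ‖a‖ * ((√(τ / 2))⁻¹ * ((√(τ / 2))⁻¹ * ((√(τ / 2))⁻¹ *
          (C * ((1 + x ^ 2) * (1 + 2 * τ)) * (1 + z ^ 2)⁻¹)))) * M := by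
          gcongr; exact hM z
      _ = _ := by ring
  · have hτ0 : 0 < τ' := by linarith [hτ'.1]
    exact (hasDerivAt_heatKernel_time h0 hτ0 (x - z)).mul_const _

/-- For differentiable g one of the two space derivatives is moved to g. The singularity drops from
τ^(-1) to τ^(-1/2), which is integrable at τ = 0. The proof identifies the two expressions by
uniqueness of derivatives. -/
lemma hasDerivAt_gconv_time_of_hasDerivAt {a : ℂ} (ha : 0 < a.re) {τ : ℝ} (hτ : 0 < τ)
    {g g' : ℝ → ℂ} (hd : ∀ z, HasDerivAt g (g' z) z) (hg' : Continuous g') {M M' : ℝ}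
    (hM : ∀ z, ‖g z‖ ≤ M) (hM' : ∀ z, ‖g' z‖ ≤ M') (x : ℝ) :
    HasDerivAt (fun τ => gconv (heatK a) τ g x)
      (a * (((√τ)⁻¹ : ℝ) * gconv (heatK₁ a) τ g' x)) τ := by
  have h0 : a ≠ 0 := by rintro rfl; simp at ha
  have hg : Continuous g := continuous_iff_continuousAt.2 fun z => (hd z).continuousAt
  refine (hasDerivAt_gconv_time ha hτ hg hM x).congr_deriv ?_
  have h1 := hasDerivAt_gconv_kernel (decays_heatK₁ ha) (decays_heatK₂ ha)
    (hasDerivAt_heatK₁ a) hτ hg hM x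
  have h2 : ∀ z, gconv (heatK₁ a) τ g z = (√τ : ℝ) * gconv (heatK a) τ g' z := by
    intro z
    have h3 := hasDerivAt_gconv_kernel (decays_heatK ha) (decays_heatK₁ ha)
      (hasDerivAt_heatK a) hτ hg hM z
    have h4 := hasDerivAt_gconv_of_hasDerivAt (decays_heatK ha) τ hd hg' hM hM' z
    have hs : ((√τ : ℝ) : ℂ) ≠ 0 := by
      exact_mod_cast (Real.sqrt_pos.2 hτ).ne'
    have := h3.unique h4
    rw [← this]; push_cast; field_simp
  have h5 : HasDerivAt (gconv (heatK₁ a) τ g) ((√τ : ℝ) * (((√τ)⁻¹ : ℝ) *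
      gconv (heatK₁ a) τ g' x)) x := by
    rw [show gconv (heatK₁ a) τ g = _ from funext h2]
    exact (hasDerivAt_gconv_kernel (decays_heatK ha) (decays_heatK₁ ha)
      (hasDerivAt_heatK a) hτ hg' hM' x).const_mul _
  rw [mul_assoc ((((√τ)⁻¹ : ℝ) : ℂ)), h1.unique h5]
  have hs : ((√τ : ℝ) : ℂ) ≠ 0 := by
    exact_mod_cast (Real.sqrt_pos.2 hτ).ne'
  push_cast; field_simp

/-! ### Global mild solutions for Lipschitz forces. -/

/-- `u` is a global mild solution of `∂ₜ u = a ∂ₓ² u + F(u)` with initial value `u₀`. -/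
structure IsMild (a : ℂ) (F : ℂ → ℂ) (u₀ : ℝ → ℂ) (u : ℝ → ℝ → ℂ) : Prop where
  cont : Continuous (Function.uncurry u)
  bdd : ∀ T, ∃ M, ∀ t ∈ Icc 0 T, ∀ x, ‖u t x‖ ≤ M
  eq : ∀ t, 0 ≤ t → ∀ x, u t x = gconv (heatK a) t u₀ x +
    ∫ s in 0..t, gconv (heatK a) (t - s) (fun z => F (u s z)) x

lemma integral_exp_neg_le {l : ℝ} (hl : 0 < l) (t : ℝ) :
    ∫ s in 0..t, Real.exp (-l * (t - s)) ≤ 1 / l := by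
  have h : ∀ s ∈ uIcc 0 t, HasDerivAt (fun s => Real.exp (-l * (t - s)) / l)
      (Real.exp (-l * (t - s))) s := by
    intro s _
    have h1 : HasDerivAt (fun s => -l * (t - s)) l s := by
      simpa using ((hasDerivAt_id s).const_sub t).const_mul (-l)
    refine (h1.exp.div_const l).congr_deriv ?_
    field_simp
  rw [intervalIntegral.integral_eq_sub_of_hasDerivAt h
    (Continuous.intervalIntegrable (by fun_prop) _ _), ← sub_div]
  gcongr
  simp [Real.exp_nonneg]

/-- The nonlinearity for the unknown `exp (-l t) u`. -/
noncomputable def dampedForce (F : ℂ → ℂ) (l : ℝ) (v : ℝ × ℝ → ℂ) (s z : ℝ) : ℂ :=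
  (Real.exp (-l * max s 0) : ℝ) * F ((Real.exp (l * max s 0) : ℝ) * v (s, z))

lemma continuous_dampedForce {F : ℂ → ℂ} (hF : Continuous F) (l : ℝ) {v : ℝ × ℝ → ℂ}
    (hv : Continuous v) : Continuous (Function.uncurry (dampedForce F l v)) := by
  unfold dampedForce Function.uncurry
  fun_prop

/-- The two exponentials cancel, so the damped force keeps the Lipschitz constant of F at all times.
-/
lemma norm_dampedForce_sub_le {F : ℂ → ℂ} {L : NNReal} (hF : LipschitzWith L F) (l : ℝ)
    (v w : ℝ × ℝ → ℂ) (s z : ℝ) :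
    ‖dampedForce F l v s z - dampedForce F l w s z‖ ≤ L * ‖v (s, z) - w (s, z)‖ := by
  rw [dampedForce, dampedForce, ← mul_sub, norm_mul, Complex.norm_real,
    Real.norm_of_nonneg (Real.exp_nonneg _)]
  have h := hF.norm_sub_le ((Real.exp (l * max s 0) : ℝ) * v (s, z))
    ((Real.exp (l * max s 0) : ℝ) * w (s, z))
  rw [← mul_sub, norm_mul, Complex.norm_real, Real.norm_of_nonneg (Real.exp_nonneg _)] at h
  calc _ ≤ Real.exp (-l * max s 0) *
        (L * (Real.exp (l * max s 0) * ‖v (s, z) - w (s, z)‖)) := by gcongr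
    _ = (Real.exp (-l * max s 0) * Real.exp (l * max s 0)) *
        (L * ‖v (s, z) - w (s, z)‖) := by ring
    _ = _ := by rw [← Real.exp_add]; simp

lemma norm_dampedForce_le {F : ℂ → ℂ} {L : NNReal} (hF : LipschitzWith L F) {l : ℝ} (hl : 0 ≤ l)
    (v : (ℝ × ℝ) →ᵇ ℂ) (s z : ℝ) : ‖dampedForce F l v s z‖ ≤ ‖F 0‖ + L * ‖v‖ := by
  have h1 := norm_dampedForce_sub_le hF l v 0 s z
  have h2 : ‖dampedForce F l 0 s z‖ ≤ ‖F 0‖ := by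
    simp only [dampedForce, Pi.zero_apply, mul_zero, norm_mul, Complex.norm_real]
    rw [Real.norm_of_nonneg (Real.exp_nonneg _)]
    refine mul_le_of_le_one_left (norm_nonneg _) (Real.exp_le_one_iff.2 ?_)
    have : 0 ≤ l * max s 0 := by positivity
    linarith
  have h3 : ‖v (s, z) - (0 : ℝ × ℝ → ℂ) (s, z)‖ ≤ ‖v‖ := by
    simpa using v.norm_coe_le_norm (s, z)
  calc _ = ‖(dampedForce F l v s z - dampedForce F l 0 s z) + dampedForce F l 0 s z‖ := by
        rw [sub_add_cancel]
    _ ≤ L * ‖v (s, z) - (0 : ℝ × ℝ → ℂ) (s, z)‖ + ‖F 0‖ := (norm_add_le _ _).trans (by gcongr)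
    _ ≤ _ := by rw [add_comm]; gcongr

/-- The Duhamel integral of the damped equation. -/
noncomputable def dampedDuhamel (a : ℂ) (l : ℝ) (h : ℝ → ℝ → ℂ) (p : ℝ × ℝ) : ℂ :=
  ∫ s in 0..max p.1 0, (Real.exp (-l * (max p.1 0 - s)) : ℝ) *
    gconv (heatK a) (max p.1 0 - s) (h s) p.2

lemma continuous_dampedDuhamel_integrand {a : ℂ} (ha : 0 < a.re) (l : ℝ) {h : ℝ → ℝ → ℂ}
    (hh : Continuous (Function.uncurry h)) {M : ℝ} (hM : ∀ s z, ‖h s z‖ ≤ M) :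
    Continuous (fun q : (ℝ × ℝ) × ℝ => ((Real.exp (-l * (max q.1.1 0 - q.2)) : ℝ) : ℂ) *
      gconv (heatK a) (max q.1.1 0 - q.2) (h q.2) q.1.2) := by
  refine Continuous.mul (by fun_prop) ?_
  exact continuous_gconv (decays_heatK ha) (g := fun (q : (ℝ × ℝ) × ℝ) => h q.2) (by fun_prop)
    (by fun_prop) (hh.comp (by fun_prop : Continuous fun q : ((ℝ × ℝ) × ℝ) × ℝ => (q.1.2, q.2)))
    fun q z => hM _ _

lemma continuous_dampedDuhamel {a : ℂ} (ha : 0 < a.re) (l : ℝ) {h : ℝ → ℝ → ℂ}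
    (hh : Continuous (Function.uncurry h)) {M : ℝ} (hM : ∀ s z, ‖h s z‖ ≤ M) :
    Continuous (dampedDuhamel a l h) := by
  refine intervalIntegral.continuous_parametric_intervalIntegral_of_continuous
    (f := fun (p : ℝ × ℝ) s => ((Real.exp (-l * (max p.1 0 - s)) : ℝ) : ℂ) *
      gconv (heatK a) (max p.1 0 - s) (h s) p.2) ?_ (by fun_prop)
  exact continuous_dampedDuhamel_integrand ha l hh hM

lemma norm_dampedDuhamel_le {a : ℂ} (ha : 0 < a.re) {l : ℝ} (hl : 0 < l) {h : ℝ → ℝ → ℂ}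
    {M : ℝ} (hM : ∀ s z, ‖h s z‖ ≤ M) (p : ℝ × ℝ) :
    ‖dampedDuhamel a l h p‖ ≤ mass (heatK a) * M / l := by
  have hM0 : 0 ≤ M := (norm_nonneg _).trans (hM 0 0)
  have hm := mass_nonneg (heatK a)
  calc ‖dampedDuhamel a l h p‖
      ≤ ∫ s in 0..max p.1 0, Real.exp (-l * (max p.1 0 - s)) * (mass (heatK a) * M) := by
        refine intervalIntegral.norm_integral_le_of_norm_le (le_max_right _ _)
          (Eventually.of_forall fun s _ => ?_) (Continuous.intervalIntegrable (by fun_prop) _ _)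
        rw [norm_mul, Complex.norm_real, Real.norm_of_nonneg (Real.exp_nonneg _)]
        gcongr
        exact norm_gconv_le (decays_heatK ha) _ (hM s) _
    _ ≤ 1 / l * (mass (heatK a) * M) := by
        rw [intervalIntegral.integral_mul_const]
        gcongr
        exact integral_exp_neg_le hl _
    _ = _ := by ring

lemma dampedDuhamel_sub {a : ℂ} (ha : 0 < a.re) (l : ℝ) {h k : ℝ → ℝ → ℂ}
    (hh : Continuous (Function.uncurry h)) (hk : Continuous (Function.uncurry k)) {M N : ℝ}
    (hM : ∀ s z, ‖h s z‖ ≤ M) (hN : ∀ s z, ‖k s z‖ ≤ N) (p : ℝ × ℝ) :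
    dampedDuhamel a l (fun s z => h s z - k s z) p =
      dampedDuhamel a l h p - dampedDuhamel a l k p := by
  rw [dampedDuhamel, dampedDuhamel, dampedDuhamel, ← intervalIntegral.integral_sub]
  · congr 1; ext s
    rw [gconv_sub (decays_heatK ha) _ (f := h s) (g := k s) (hh.comp (Continuous.prodMk_right s))
      (hk.comp (Continuous.prodMk_right s)) (hM s) (hN s), mul_sub]
  · exact ((continuous_dampedDuhamel_integrand ha l hh hM).comp
      (Continuous.prodMk_right p)).intervalIntegrable _ _
  · exact ((continuous_dampedDuhamel_integrand ha l hk hN).comp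
      (Continuous.prodMk_right p)).intervalIntegrable _ _

lemma norm_damped_gconv_le {a : ℂ} (ha : 0 < a.re) {l : ℝ} (hl : 0 ≤ l) (u₀ : ℝ →ᵇ ℂ)
    (p : ℝ × ℝ) : ‖((Real.exp (-l * max p.1 0) : ℝ) : ℂ) * gconv (heatK a) (max p.1 0) u₀ p.2‖
      ≤ mass (heatK a) * ‖u₀‖ := by
  rw [norm_mul, Complex.norm_real, Real.norm_of_nonneg (Real.exp_nonneg _)]
  have h1 := norm_gconv_le (decays_heatK ha) (max p.1 0) u₀.norm_coe_le_norm p.2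
  have h2 : Real.exp (-l * max p.1 0) ≤ 1 := Real.exp_le_one_iff.2 (by
    have : 0 ≤ l * max p.1 0 := by positivity
    linarith)
  exact (mul_le_of_le_one_left (norm_nonneg _) h2).trans h1

/-- A globally Lipschitz nonlinearity has a global mild solution for every initial value. -/
theorem exists_isMild {a : ℂ} (ha : 0 < a.re) {F : ℂ → ℂ} {L : NNReal} (hF : LipschitzWith L F)
    (u₀ : ℝ →ᵇ ℂ) : ∃ u, IsMild a F u₀ u := by
  set m := mass (heatK a) with hm
  have hm0 : 0 ≤ m := mass_nonneg _
  -- The damped Duhamel integral gains a factor 1/l, so this rate makes the Lipschitz constant m L /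
  -- l less than 1/2.
  set l : ℝ := 2 * (m * L) + 1 with hl
  have hl0 : 0 < l := by positivity
  have hcont : ∀ v : (ℝ × ℝ) →ᵇ ℂ, Continuous (Function.uncurry (dampedForce F l v)) :=
    fun v => continuous_dampedForce hF.continuous l v.continuous
  -- The unknown is exp(-l t) u. Clamping the time at 0 lets the contraction run on bounded
  -- continuous functions of the whole plane, so one fixed point covers all t ≥ 0.
  let Φ : ((ℝ × ℝ) →ᵇ ℂ) → ((ℝ × ℝ) →ᵇ ℂ) := fun v =>
    BoundedContinuousFunction.ofNormedAddCommGroup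
      (fun p : ℝ × ℝ => ((Real.exp (-l * max p.1 0) : ℝ) : ℂ) * gconv (heatK a) (max p.1 0) u₀ p.2
        + dampedDuhamel a l (dampedForce F l v) p)
      ((Continuous.mul (by fun_prop) (continuous_gconv (decays_heatK ha)
        (g := fun (_ : ℝ × ℝ) => u₀) (by fun_prop) (by fun_prop)
        (u₀.continuous.comp continuous_snd) fun _ => u₀.norm_coe_le_norm)).add
        (continuous_dampedDuhamel ha l (hcont v) (norm_dampedForce_le hF hl0.le v)))
      (m * ‖u₀‖ + m * (‖F 0‖ + L * ‖v‖) / l)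
      (fun p => (norm_add_le _ _).trans (add_le_add (norm_damped_gconv_le ha hl0.le u₀ p)
        (norm_dampedDuhamel_le ha hl0 (norm_dampedForce_le hF hl0.le v) p)))
  have hΦ : ContractingWith (1 / 2) Φ := by
    refine ⟨by norm_num, LipschitzWith.of_dist_le_mul fun v w => ?_⟩
    rw [BoundedContinuousFunction.dist_le (by positivity)]
    intro p
    rw [dist_eq_norm]
    have e : Φ v p - Φ w p = dampedDuhamel a l
        (fun s z => dampedForce F l v s z - dampedForce F l w s z) p := by
      rw [dampedDuhamel_sub ha l (hcont v) (hcont w) (norm_dampedForce_le hF hl0.le v)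
        (norm_dampedForce_le hF hl0.le w)]
      simp only [Φ, BoundedContinuousFunction.coe_ofNormedAddCommGroup]
      ring
    rw [e]
    have hb : ∀ s z, ‖dampedForce F l v s z - dampedForce F l w s z‖ ≤ L * dist v w := by
      intro s z
      refine (norm_dampedForce_sub_le hF l v w s z).trans ?_
      gcongr
      rw [← dist_eq_norm]
      exact BoundedContinuousFunction.dist_coe_le_dist _
    refine (norm_dampedDuhamel_le ha hl0 hb p).trans ?_
    rw [div_le_iff₀ hl0, ← hm]
    push_cast
    nlinarith [dist_nonneg (x := v) (y := w), mul_nonneg hm0 L.2]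
  obtain ⟨v, hv⟩ : ∃ v, Φ v = v := ⟨_, hΦ.fixedPoint_isFixedPt⟩
  refine ⟨fun t x => (Real.exp (l * max t 0) : ℝ) * v (t, x), ?_, fun T => ?_, ?_⟩
  · have := v.continuous
    unfold Function.uncurry
    fun_prop
  · refine ⟨Real.exp (l * T) * ‖v‖, fun t ht x => ?_⟩
    rw [norm_mul, Complex.norm_real, Real.norm_of_nonneg (Real.exp_nonneg _), max_eq_left ht.1]
    gcongr
    exacts [ht.2, v.norm_coe_le_norm _]
  · intro t ht x
    have h1 : v (t, x) = Φ v (t, x) := by rw [hv]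
    rw [h1]
    simp only [Φ, BoundedContinuousFunction.coe_ofNormedAddCommGroup, dampedDuhamel,
      max_eq_left ht]
    rw [mul_add, ← mul_assoc, ← Complex.ofReal_mul, ← Real.exp_add,
      ← intervalIntegral.integral_const_mul]
    congr 1
    · simp
    · refine intervalIntegral.integral_congr fun s hs => ?_
      rw [uIcc_of_le ht] at hs
      have e : dampedForce F l v s = fun z => ((Real.exp (-l * s) : ℝ) : ℂ) *
          F ((Real.exp (l * max s 0) : ℝ) * v (s, z)) := by
        ext z; rw [dampedForce, max_eq_left hs.1]
      rw [e, gconv_const_mul, ← mul_assoc, ← mul_assoc, ← Complex.ofReal_mul, ← Real.exp_add,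
        ← Complex.ofReal_mul, ← Real.exp_add]
      rw [show l * t + -l * (t - s) + -l * s = 0 by ring]
      simp

/-! ### Singular time integrals. -/

lemma inv_sqrt_eq_rpow (q : ℝ) : (√q)⁻¹ = q ^ (-(1 / 2) : ℝ) := by
  rcases le_or_gt 0 q with h | h
  · rw [Real.rpow_neg h, Real.sqrt_eq_rpow]
  · rw [Real.sqrt_eq_zero_of_nonpos h.le, Real.rpow_def_of_neg h, inv_zero,
      show -(1 / 2 : ℝ) * Real.pi = -(Real.pi / 2) by ring, Real.cos_neg, Real.cos_pi_div_two,
      mul_zero]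

lemma intervalIntegrable_inv_sqrt (b c : ℝ) :
    IntervalIntegrable (fun q : ℝ => (√q)⁻¹) volume b c := by
  simp only [inv_sqrt_eq_rpow]
  exact intervalIntegral.intervalIntegrable_rpow' (by norm_num)

lemma integral_inv_sqrt {t : ℝ} (ht : 0 ≤ t) : ∫ q in 0..t, (√q)⁻¹ = 2 * √t := by
  rw [intervalIntegral.integral_eq_sub_of_hasDerivAt_of_le (f := fun q => 2 * √q) ht
    (by fun_prop) (fun q hq => ?_) (intervalIntegrable_inv_sqrt _ _)]
  · simp
  · refine ((Real.hasDerivAt_sqrt hq.1.ne').const_mul 2).congr_deriv ?_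
    field_simp

/-- This is √t ≤ √s + √(t - s) divided by √t √s √(t - s). It separates the two end point
singularities and bounds the Beta integral by 4 for every t, without its exact value. -/
lemma inv_sqrt_mul_inv_sqrt_le {s t : ℝ} (h : s ∈ Ioo 0 t) :
    (√(t - s))⁻¹ * (√s)⁻¹ ≤ (√t)⁻¹ * ((√s)⁻¹ + (√(t - s))⁻¹) := by
  have hs : 0 < √s := Real.sqrt_pos.2 h.1
  have hts : 0 < √(t - s) := Real.sqrt_pos.2 (by linarith [h.2])
  have h0 : 0 < t := h.1.trans h.2
  have ht : 0 < √t := Real.sqrt_pos.2 h0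
  have h1 : √t ≤ √s + √(t - s) := by
    rw [Real.sqrt_le_left (by positivity)]
    have e1 := Real.sq_sqrt h.1.le
    have e2 := Real.sq_sqrt (show 0 ≤ t - s by linarith [h.2])
    nlinarith [mul_pos hs hts]
  have e : (√t)⁻¹ * ((√s)⁻¹ + (√(t - s))⁻¹) =
      (√(t - s))⁻¹ * (√s)⁻¹ * ((√s + √(t - s)) / √t) := by
    field_simp; ring
  rw [e]
  refine le_mul_of_one_le_right (by positivity) ?_
  rwa [one_le_div ht]

lemma intervalIntegrable_inv_sqrt_sub (t b c : ℝ) :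
    IntervalIntegrable (fun s : ℝ => (√(t - s))⁻¹) volume b c := by
  have := (intervalIntegrable_inv_sqrt (t - b) (t - c)).comp_sub_left t
  simpa using this

lemma integral_inv_sqrt_sub {t : ℝ} (ht : 0 ≤ t) : ∫ s in 0..t, (√(t - s))⁻¹ = 2 * √t := by
  rw [intervalIntegral.integral_comp_sub_left (fun q => (√q)⁻¹)]
  simpa using integral_inv_sqrt ht

lemma ae_Ioc_of_Ioo {a b : ℝ} {p : ℝ → Prop} (h : ∀ s ∈ Ioo a b, p s) :
    ∀ᵐ s, s ∈ Ioc a b → p s := by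
  have : ∀ᵐ s : ℝ, s ≠ b := by simp [ae_iff]
  filter_upwards [this] with s hs h'
  exact h s ⟨h'.1, lt_of_le_of_ne h'.2 hs⟩

lemma aestronglyMeasurable_Ioc {E : Type*} [NormedAddCommGroup E] {a b : ℝ} {f : ℝ → E}
    (hf : ContinuousOn f (Ioo a b)) : AEStronglyMeasurable f (volume.restrict (Ioc a b)) := by
  rw [← restrict_Ioo_eq_restrict_Ioc]
  exact hf.aestronglyMeasurable measurableSet_Ioo

lemma intervalIntegrable_of_norm_le {E : Type*} [NormedAddCommGroup E] {a b : ℝ} (hab : a ≤ b)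
    {f : ℝ → E} {g : ℝ → ℝ} (hf : ContinuousOn f (Ioo a b)) (hg : IntervalIntegrable g volume a b)
    (h : ∀ s ∈ Ioo a b, ‖f s‖ ≤ g s) : IntervalIntegrable f volume a b := by
  rw [intervalIntegrable_iff_integrableOn_Ioc_of_le hab] at hg ⊢
  refine hg.mono' (aestronglyMeasurable_Ioc hf) ?_
  rw [ae_restrict_iff' measurableSet_Ioc]
  exact ae_Ioc_of_Ioo h

lemma norm_intervalIntegral_le {E : Type*} [NormedAddCommGroup E] [NormedSpace ℝ E] {a b : ℝ}
    (hab : a ≤ b) {f : ℝ → E} {g : ℝ → ℝ} (hg : IntervalIntegrable g volume a b)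
    (h : ∀ s ∈ Ioo a b, ‖f s‖ ≤ g s) : ‖∫ s in a..b, f s‖ ≤ ∫ s in a..b, g s :=
  intervalIntegral.norm_integral_le_of_norm_le hab (ae_Ioc_of_Ioo h) hg

lemma intervalIntegral_mono_Ioo {a b : ℝ} (hab : a ≤ b) {f g : ℝ → ℝ}
    (hf : IntervalIntegrable f volume a b) (hg : IntervalIntegrable g volume a b)
    (h : ∀ s ∈ Ioo a b, f s ≤ g s) : ∫ s in a..b, f s ≤ ∫ s in a..b, g s := by
  refine intervalIntegral.integral_mono_ae_restrict hab hf hg ?_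
  rw [← restrict_Ioc_eq_restrict_Icc, Filter.EventuallyLE, ae_restrict_iff' measurableSet_Ioc]
  exact ae_Ioc_of_Ioo h

lemma intervalIntegrable_inv_sqrt_mul {t : ℝ} (ht : 0 ≤ t) :
    IntervalIntegrable (fun s : ℝ => (√(t - s))⁻¹ * (√s)⁻¹) volume 0 t := by
  refine intervalIntegrable_of_norm_le ht ?_
    (((intervalIntegrable_inv_sqrt 0 t).add (intervalIntegrable_inv_sqrt_sub t 0 t)).const_mul
      (√t)⁻¹) fun s hs => ?_
  · refine ContinuousOn.mul (ContinuousOn.inv₀ (by fun_prop) fun s hs => ?_)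
      (ContinuousOn.inv₀ (by fun_prop) fun s hs => ?_)
    · exact (Real.sqrt_pos.2 (by linarith [hs.2])).ne'
    · exact (Real.sqrt_pos.2 hs.1).ne'
  · rw [Real.norm_of_nonneg (by positivity)]
    exact inv_sqrt_mul_inv_sqrt_le hs

lemma integral_inv_sqrt_mul_le {t : ℝ} (ht : 0 ≤ t) :
    ∫ s in 0..t, (√(t - s))⁻¹ * (√s)⁻¹ ≤ 4 := by
  have h1 := intervalIntegrable_inv_sqrt 0 t
  have h2 := intervalIntegrable_inv_sqrt_sub t 0 t
  refine (intervalIntegral_mono_Ioo ht (intervalIntegrable_inv_sqrt_mul ht)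
    ((h1.add h2).const_mul (√t)⁻¹) fun s hs => inv_sqrt_mul_inv_sqrt_le hs).trans ?_
  rw [intervalIntegral.integral_const_mul]
  have := intervalIntegral.integral_add h1 h2
  rw [this, integral_inv_sqrt ht, integral_inv_sqrt_sub ht]
  rcases ht.eq_or_lt with rfl | ht
  · simp
  · have := Real.sqrt_pos.2 ht
    apply le_of_eq; field_simp; norm_num

/-! ### Duhamel integrals of forces with a t^(-1/2) singularity. -/

/-- Functions on `(0, ∞) × ℝ` that are continuous and `O(t^{-1/2})` as `t → 0`. -/
structure SingBdd (f : ℝ → ℝ → ℂ) : Prop where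
  cont : ContinuousOn (Function.uncurry f) (Ioi 0 ×ˢ univ)
  bdd : ∀ T, ∃ M, 0 ≤ M ∧ ∀ s ∈ Ioc 0 T, ∀ z, ‖f s z‖ ≤ M * (√s)⁻¹

lemma isOpen_Ioi_prod : IsOpen (Ioi (0 : ℝ) ×ˢ (univ : Set ℝ)) := isOpen_Ioi.prod isOpen_univ

lemma SingBdd.continuousAt {f : ℝ → ℝ → ℂ} (h : SingBdd f) {s : ℝ} (hs : 0 < s) (z : ℝ) :
    ContinuousAt (Function.uncurry f) (s, z) :=
  h.cont.continuousAt (isOpen_Ioi_prod.mem_nhds ⟨hs, trivial⟩)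

lemma SingBdd.continuous {f : ℝ → ℝ → ℂ} (h : SingBdd f) {s : ℝ} (hs : 0 < s) :
    Continuous (f s) :=
  continuous_iff_continuousAt.2 fun z => ContinuousAt.comp (f := fun z => (s, z))
    (h.continuousAt hs z) (Continuous.prodMk_right s).continuousAt

lemma singBdd_of_continuous {f : ℝ → ℝ → ℂ} (hf : Continuous (Function.uncurry f))
    (hb : ∀ T, ∃ M, ∀ t ∈ Icc 0 T, ∀ x, ‖f t x‖ ≤ M) : SingBdd f := by
  refine ⟨hf.continuousOn, fun T => ?_⟩
  obtain ⟨M, hM⟩ := hb T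
  refine ⟨|M| * √T, by positivity, fun s hs z => (hM s ⟨hs.1.le, hs.2⟩ z).trans ?_⟩
  have h1 : 0 < √s := Real.sqrt_pos.2 hs.1
  have h2 : √s ≤ √T := Real.sqrt_le_sqrt hs.2
  rw [mul_assoc, ← div_eq_mul_inv]
  exact (le_abs_self M).trans (le_mul_of_one_le_right (abs_nonneg _) ((one_le_div h1).2 h2))

/-- The Duhamel integral with the singular weight `(t - s)^{-1/2}`. -/
noncomputable def sDuh (φ : ℝ → ℂ) (f : ℝ → ℝ → ℂ) (t x : ℝ) : ℂ :=
  ∫ s in 0..t, ((√(t - s))⁻¹ : ℝ) * gconv φ (t - s) (f s) x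

lemma continuousAt_gconv_singBdd {φ : ℝ → ℂ} (hφ : Decays φ) {f : ℝ → ℝ → ℂ} (hf : SingBdd f)
    {P : Type*} [TopologicalSpace P] [FirstCountableTopology P] {p₀ : P} {τ σ ξ : P → ℝ}
    (hτ : ContinuousAt τ p₀) (hσ : ContinuousAt σ p₀) (hξ : ContinuousAt ξ p₀) (h0 : 0 < σ p₀) :
    ContinuousAt (fun p => gconv φ (τ p) (f (σ p)) (ξ p)) p₀ := by
  obtain ⟨M, hM0, hM⟩ := hf.bdd (2 * σ p₀)
  have hev : ∀ᶠ p in 𝓝 p₀, σ p ∈ Ioo (σ p₀ / 2) (2 * σ p₀) :=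
    hσ.eventually (Ioo_mem_nhds (by linarith) (by linarith))
  refine continuousAt_gconv hφ (M := M * (√(σ p₀ / 2))⁻¹) hτ hξ ?_ ?_ ?_
  · filter_upwards [hev] with p hp
    exact hf.continuous (by linarith [hp.1])
  · intro z
    exact ContinuousAt.comp (f := fun q : P × ℝ => (σ q.1, q.2)) (hf.continuousAt h0 z)
      ((ContinuousAt.comp (f := Prod.fst) (x := (p₀, z)) hσ continuousAt_fst).prodMk continuousAt_snd)
  · filter_upwards [hev] with p hp z
    refine (hM _ ⟨by linarith [hp.1], hp.2.le⟩ z).trans ?_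
    have := hp.1
    gcongr

lemma continuousOn_sDuh_integrand {φ : ℝ → ℂ} (hφ : Decays φ) {f : ℝ → ℝ → ℂ} (hf : SingBdd f)
    (t x : ℝ) : ContinuousOn (fun s => (((√(t - s))⁻¹ : ℝ) : ℂ) * gconv φ (t - s) (f s) x)
      (Ioo 0 t) := by
  intro s hs
  refine ContinuousAt.continuousWithinAt (ContinuousAt.mul ?_ ?_)
  · refine Complex.continuous_ofReal.continuousAt.comp (ContinuousAt.inv₀ (by fun_prop) ?_)
    exact (Real.sqrt_pos.2 (by linarith [hs.2])).ne'
  · exact continuousAt_gconv_singBdd hφ hf (τ := fun s => t - s)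
      (σ := fun s => s) (by fun_prop) continuousAt_id
      continuousAt_const hs.1

lemma norm_sDuh_integrand_le {φ : ℝ → ℂ} (hφ : Decays φ) {f : ℝ → ℝ → ℂ} {T M : ℝ}
    (hM : ∀ s ∈ Ioc 0 T, ∀ z, ‖f s z‖ ≤ M * (√s)⁻¹) {t : ℝ} (ht : t ≤ T) (x : ℝ) {s : ℝ}
    (hs : s ∈ Ioo 0 t) : ‖(((√(t - s))⁻¹ : ℝ) : ℂ) * gconv φ (t - s) (f s) x‖ ≤
      mass φ * M * ((√(t - s))⁻¹ * (√s)⁻¹) := by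
  rw [norm_mul, Complex.norm_real, Real.norm_of_nonneg (by positivity)]
  calc _ ≤ (√(t - s))⁻¹ * (mass φ * (M * (√s)⁻¹)) := by
        gcongr; exact norm_gconv_le hφ _ (hM s ⟨hs.1, hs.2.le.trans ht⟩) _
    _ = _ := by ring

lemma norm_sDuh_le {φ : ℝ → ℂ} (hφ : Decays φ) {f : ℝ → ℝ → ℂ} {T M : ℝ} (hM0 : 0 ≤ M)
    (hM : ∀ s ∈ Ioc 0 T, ∀ z, ‖f s z‖ ≤ M * (√s)⁻¹) {t : ℝ} (h0 : 0 ≤ t) (ht : t ≤ T) (x : ℝ) :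
    ‖sDuh φ f t x‖ ≤ mass φ * M * 4 := by
  refine (norm_intervalIntegral_le h0 ((intervalIntegrable_inv_sqrt_mul h0).const_mul
    (mass φ * M)) fun s hs => norm_sDuh_integrand_le hφ hM ht x hs).trans ?_
  rw [intervalIntegral.integral_const_mul]
  have := mass_nonneg φ
  gcongr
  exact integral_inv_sqrt_mul_le h0

/-- Rescaling to the fixed interval [0, 1] removes t from the limits of integration; continuity in t
then follows by dominated convergence, with a bound independent of t. -/
lemma sDuh_eq_integral_unit (φ : ℝ → ℂ) (f : ℝ → ℝ → ℂ) (t x : ℝ) :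
    sDuh φ f t x = ∫ σ in 0..1, t • ((((√(t - t * σ))⁻¹ : ℝ) : ℂ) *
      gconv φ (t - t * σ) (f (t * σ)) x) := by
  rw [intervalIntegral.integral_smul, intervalIntegral.smul_integral_comp_mul_left
    (fun s => (((√(t - s))⁻¹ : ℝ) : ℂ) * gconv φ (t - s) (f s) x), mul_zero, mul_one, sDuh]

lemma continuousOn_sDuh {φ : ℝ → ℂ} (hφ : Decays φ) {f : ℝ → ℝ → ℂ} (hf : SingBdd f) :
    ContinuousOn (Function.uncurry (sDuh φ f)) (Ioi 0 ×ˢ univ) := by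
  rintro ⟨t, x⟩ ⟨ht, -⟩
  have ht : 0 < t := ht
  refine ContinuousAt.continuousWithinAt ?_
  have e : Function.uncurry (sDuh φ f) = fun p : ℝ × ℝ => ∫ σ in 0..1, p.1 •
      ((((√(p.1 - p.1 * σ))⁻¹ : ℝ) : ℂ) * gconv φ (p.1 - p.1 * σ) (f (p.1 * σ)) p.2) :=
    funext fun p => sDuh_eq_integral_unit φ f p.1 p.2
  rw [e]
  obtain ⟨M, hM0, hM⟩ := hf.bdd (2 * t)
  have hev : ∀ᶠ p : ℝ × ℝ in 𝓝 (t, x), p.1 ∈ Ioo 0 (2 * t) :=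
    continuousAt_fst.eventually (Ioo_mem_nhds ht (by simp only; linarith))
  have hpos : ∀ t' σ : ℝ, 0 < t' → σ ∈ Ioo (0 : ℝ) 1 → 0 < t' - t' * σ := fun t' σ h1 h2 => by
    nlinarith [h2.2]
  have hcont : ∀ t' x' σ : ℝ, 0 < t' → σ ∈ Ioo (0 : ℝ) 1 → ContinuousAt
      (fun q : (ℝ × ℝ) × ℝ => q.1.1 • ((((√(q.1.1 - q.1.1 * q.2))⁻¹ : ℝ) : ℂ) *
        gconv φ (q.1.1 - q.1.1 * q.2) (f (q.1.1 * q.2)) q.1.2)) ((t', x'), σ) := by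
    intro t' x' σ h1 h2
    have h3 : ContinuousAt (fun q : (ℝ × ℝ) × ℝ => q.1.1) ((t', x'), σ) := by fun_prop
    refine h3.smul (ContinuousAt.mul ?_ ?_)
    · refine Complex.continuous_ofReal.continuousAt.comp (ContinuousAt.inv₀ (by fun_prop) ?_)
      exact (Real.sqrt_pos.2 (hpos t' σ h1 h2)).ne'
    · exact continuousAt_gconv_singBdd hφ hf (τ := fun q : (ℝ × ℝ) × ℝ => q.1.1 - q.1.1 * q.2)
        (σ := fun q => q.1.1 * q.2) (ξ := fun q => q.1.2)
        (by fun_prop) (by fun_prop) (by fun_prop) (mul_pos h1 h2.1)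
  refine intervalIntegral.continuousAt_of_dominated_interval
    (bound := fun σ => mass φ * M * ((√(1 - σ))⁻¹ * (√σ)⁻¹)) ?_ ?_
    ((intervalIntegrable_inv_sqrt_mul zero_le_one).const_mul _) ?_
  · filter_upwards [hev] with p hp
    rw [uIoc_of_le zero_le_one]
    refine aestronglyMeasurable_Ioc fun σ hσ => ContinuousAt.continuousWithinAt ?_
    exact ContinuousAt.comp (f := fun σ => (p, σ)) (hcont p.1 p.2 σ hp.1 hσ)
      (Continuous.prodMk_right p).continuousAt
  · filter_upwards [hev] with p hp
    rw [uIoc_of_le zero_le_one]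
    refine ae_Ioc_of_Ioo fun σ hσ => ?_
    have h1 : p.1 * σ ∈ Ioo 0 p.1 := ⟨mul_pos hp.1 hσ.1, by nlinarith [hσ.2, hp.1]⟩
    rw [norm_smul, Real.norm_of_nonneg hp.1.le]
    refine (mul_le_mul_of_nonneg_left (norm_sDuh_integrand_le hφ hM hp.2.le p.2 h1) hp.1.le).trans
      (le_of_eq ?_)
    rw [show p.1 - p.1 * σ = p.1 * (1 - σ) by ring, Real.sqrt_mul hp.1.le, Real.sqrt_mul hp.1.le]
    have h2 := Real.mul_self_sqrt hp.1.le
    have h3 : 0 < √p.1 := Real.sqrt_pos.2 hp.1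
    rw [mul_inv, mul_inv]
    calc _ = (p.1 * (√p.1)⁻¹ * (√p.1)⁻¹) * (mass φ * M * ((√(1 - σ))⁻¹ * (√σ)⁻¹)) := by ring
      _ = _ := by
        rw [mul_assoc p.1, ← mul_inv, h2, mul_inv_cancel₀ hp.1.ne', one_mul]
  · rw [uIoc_of_le zero_le_one]
    refine ae_Ioc_of_Ioo fun σ hσ => ?_
    exact ContinuousAt.comp (f := fun p => (p, σ)) (hcont t x σ ht hσ)
      (Continuous.prodMk_left σ).continuousAt

/-- The derivative goes to f, because a second derivative on the kernel would produce (t - s)^(-1),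
which is not integrable. -/
lemma hasDerivAt_sDuh {φ : ℝ → ℂ} (hφ : Decays φ) {f fx : ℝ → ℝ → ℂ} (hf : SingBdd f)
    (hfx : SingBdd fx) (hd : ∀ s, 0 < s → ∀ z, HasDerivAt (f s) (fx s z) z) {t : ℝ} (ht : 0 < t)
    (x : ℝ) : HasDerivAt (sDuh φ f t) (sDuh φ fx t x) x := by
  obtain ⟨M, hM0, hM⟩ := hf.bdd t
  obtain ⟨N, hN0, hN⟩ := hfx.bdd t
  refine (intervalIntegral.hasDerivAt_integral_of_dominated_loc_of_deriv_le
    (F := fun x s => ((√(t - s))⁻¹ : ℝ) * gconv φ (t - s) (f s) x)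
    (F' := fun x s => ((√(t - s))⁻¹ : ℝ) * gconv φ (t - s) (fx s) x)
    (bound := fun s => mass φ * N * ((√(t - s))⁻¹ * (√s)⁻¹)) (univ_mem (f := 𝓝 x))
    (Eventually.of_forall fun x' => ?_) ?_ ?_ ?_
    ((intervalIntegrable_inv_sqrt_mul ht.le).const_mul _) ?_).2
  · rw [uIoc_of_le ht.le]
    exact aestronglyMeasurable_Ioc (continuousOn_sDuh_integrand hφ hf t x')
  · exact intervalIntegrable_of_norm_le ht.le (continuousOn_sDuh_integrand hφ hf t x)
      ((intervalIntegrable_inv_sqrt_mul ht.le).const_mul _)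
      fun s hs => norm_sDuh_integrand_le hφ hM le_rfl x hs
  · rw [uIoc_of_le ht.le]
    exact aestronglyMeasurable_Ioc (continuousOn_sDuh_integrand hφ hfx t x)
  · rw [uIoc_of_le ht.le]
    exact ae_Ioc_of_Ioo fun s hs x' _ => norm_sDuh_integrand_le hφ hN le_rfl x' hs
  · rw [uIoc_of_le ht.le]
    refine ae_Ioc_of_Ioo fun s hs x' _ => ?_
    exact (hasDerivAt_gconv_of_hasDerivAt hφ _ (hd s hs.1) (hfx.continuous hs.1)
      (hM s ⟨hs.1, hs.2.le⟩) (hN s ⟨hs.1, hs.2.le⟩) x').const_mul _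

/-- The Duhamel integral of the heat semigroup. -/
noncomputable def duh (a : ℂ) (f : ℝ → ℝ → ℂ) (t x : ℝ) : ℂ :=
  ∫ s in 0..t, gconv (heatK a) (t - s) (f s) x

lemma continuousOn_duh_integrand {a : ℂ} (ha : 0 < a.re) {f : ℝ → ℝ → ℂ} (hf : SingBdd f)
    (t x : ℝ) : ContinuousOn (fun s => gconv (heatK a) (t - s) (f s) x) (Ioo 0 t) := by
  intro s hs
  exact ContinuousAt.continuousWithinAt (continuousAt_gconv_singBdd (decays_heatK ha) hf
    (τ := fun s => t - s) (σ := fun s => s) (by fun_prop) continuousAt_id continuousAt_const hs.1)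

lemma norm_duh_integrand_le {a : ℂ} (ha : 0 < a.re) {f : ℝ → ℝ → ℂ} {T M : ℝ}
    (hM : ∀ s ∈ Ioc 0 T, ∀ z, ‖f s z‖ ≤ M * (√s)⁻¹) {t : ℝ} (ht : t ≤ T) (x : ℝ) {s : ℝ}
    (hs : s ∈ Ioo 0 t) : ‖gconv (heatK a) (t - s) (f s) x‖ ≤ mass (heatK a) * M * (√s)⁻¹ :=
  (norm_gconv_le (decays_heatK ha) _ (hM s ⟨hs.1, hs.2.le.trans ht⟩) _).trans (by rw [mul_assoc])

lemma intervalIntegrable_duh_integrand {a : ℂ} (ha : 0 < a.re) {f : ℝ → ℝ → ℂ} (hf : SingBdd f)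
    {t : ℝ} (ht : 0 ≤ t) (x : ℝ) :
    IntervalIntegrable (fun s => gconv (heatK a) (t - s) (f s) x) volume 0 t := by
  obtain ⟨M, hM0, hM⟩ := hf.bdd t
  exact intervalIntegrable_of_norm_le ht (continuousOn_duh_integrand ha hf t x)
    ((intervalIntegrable_inv_sqrt 0 t).const_mul _)
    fun s hs => norm_duh_integrand_le ha hM le_rfl x hs

lemma hasDerivAt_duh {a : ℂ} (ha : 0 < a.re) {f : ℝ → ℝ → ℂ} (hf : SingBdd f) {t : ℝ}
    (ht : 0 < t) (x : ℝ) : HasDerivAt (duh a f t) (sDuh (heatK₁ a) f t x) x := by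
  obtain ⟨M, hM0, hM⟩ := hf.bdd t
  refine (intervalIntegral.hasDerivAt_integral_of_dominated_loc_of_deriv_le
    (F := fun x s => gconv (heatK a) (t - s) (f s) x)
    (F' := fun x s => ((√(t - s))⁻¹ : ℝ) * gconv (heatK₁ a) (t - s) (f s) x)
    (bound := fun s => mass (heatK₁ a) * M * ((√(t - s))⁻¹ * (√s)⁻¹)) (univ_mem (f := 𝓝 x))
    (Eventually.of_forall fun x' => ?_) ?_ ?_ ?_
    ((intervalIntegrable_inv_sqrt_mul ht.le).const_mul _) ?_).2
  · rw [uIoc_of_le ht.le]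
    exact aestronglyMeasurable_Ioc (continuousOn_duh_integrand ha hf t x')
  · exact intervalIntegrable_duh_integrand ha hf ht.le x
  · rw [uIoc_of_le ht.le]
    exact aestronglyMeasurable_Ioc (continuousOn_sDuh_integrand (decays_heatK₁ ha) hf t x)
  · rw [uIoc_of_le ht.le]
    exact ae_Ioc_of_Ioo fun s hs x' _ =>
      norm_sDuh_integrand_le (decays_heatK₁ ha) hM le_rfl x' hs
  · rw [uIoc_of_le ht.le]
    refine ae_Ioc_of_Ioo fun s hs x' _ => ?_
    exact hasDerivAt_gconv_kernel (decays_heatK ha) (decays_heatK₁ ha) (hasDerivAt_heatK a)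
      (by linarith [hs.2]) (hf.continuous hs.1) (hM s ⟨hs.1, hs.2.le⟩) x'

/-- The fundamental theorem of calculus along r ↦ K_(r-s) ⋆ g, with the time derivative written in
its integrable form. -/
lemma gconv_heatK_sub_self {a : ℂ} (ha : 0 < a.re) {g g' : ℝ → ℂ}
    (hd : ∀ z, HasDerivAt g (g' z) z) (hg' : Continuous g') {M M' : ℝ}
    (hM : ∀ z, ‖g z‖ ≤ M) (hM' : ∀ z, ‖g' z‖ ≤ M') {s t : ℝ} (hst : s ≤ t) (x : ℝ) :
    ∫ r in s..t, a * (((√(r - s))⁻¹ : ℝ) * gconv (heatK₁ a) (r - s) g' x) =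
      gconv (heatK a) (t - s) g x - g x := by
  have hg : Continuous g := continuous_iff_continuousAt.2 fun z => (hd z).continuousAt
  have h0 : g x = gconv (heatK a) (s - s) g x := by rw [sub_self, gconv_heatK_zero ha]
  have hc1 : Continuous fun r => gconv (heatK₁ a) (r - s) g' x :=
    continuous_gconv (decays_heatK₁ ha) (τ := fun r => r - s) (ξ := fun _ => x)
      (g := fun _ => g') (by fun_prop) (by fun_prop) (hg'.comp continuous_snd) fun _ => hM'
  rw [h0]
  refine intervalIntegral.integral_eq_sub_of_hasDerivAt_of_le
    (f := fun r => gconv (heatK a) (r - s) g x) hst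
    (continuous_gconv (decays_heatK ha) (τ := fun r => r - s) (ξ := fun _ => x)
      (g := fun _ => g) (by fun_prop) (by fun_prop) (hg.comp continuous_snd)
      fun _ => hM).continuousOn (fun r hr => ?_) ?_
  · have h1 := hasDerivAt_gconv_time_of_hasDerivAt ha (τ := r - s) (by linarith [hr.1]) hd hg'
      hM hM' x
    exact h1.comp_sub_const r s
  · refine intervalIntegrable_of_norm_le hst (g := fun r => ‖a‖ * ((√(r - s))⁻¹ *
      (mass (heatK₁ a) * M'))) ?_ ?_ fun r _ => ?_
    · intro r hr
      refine ContinuousAt.continuousWithinAt (continuousAt_const.mul (ContinuousAt.mul ?_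
        hc1.continuousAt))
      refine Complex.continuous_ofReal.continuousAt.comp (ContinuousAt.inv₀ (by fun_prop) ?_)
      exact (Real.sqrt_pos.2 (by linarith [hr.1])).ne'
    · refine IntervalIntegrable.const_mul (IntervalIntegrable.mul_const ?_ _) _
      simpa using (intervalIntegrable_inv_sqrt (s - s) (t - s)).comp_sub_right s
    · rw [norm_mul, norm_mul, Complex.norm_real, Real.norm_of_nonneg (by positivity)]
      gcongr
      exact norm_gconv_le (decays_heatK₁ ha) _ hM' x

lemma integrable_inv_sqrt_prod {t : ℝ} (ht : 0 ≤ t) :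
    Integrable (fun p : ℝ × ℝ => (√(p.2 - p.1))⁻¹ * (√p.1)⁻¹)
      ((volume.restrict (Ioc 0 t)).prod (volume.restrict (Ioc 0 t))) := by
  have hmeas : Measurable (fun p : ℝ × ℝ => (√(p.2 - p.1))⁻¹ * (√p.1)⁻¹) := by fun_prop
  rw [integrable_prod_iff hmeas.aestronglyMeasurable]
  have hint : ∀ s, IntegrableOn (fun r => (√(r - s))⁻¹) (Ioc 0 t) := fun s => by
    rw [← intervalIntegrable_iff_integrableOn_Ioc_of_le ht]
    simpa using (intervalIntegrable_inv_sqrt (0 - s) (t - s)).comp_sub_right s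
  refine ⟨ae_of_all _ fun s => Integrable.mul_const (hint s) (√s)⁻¹, ?_⟩
  have hI : Integrable (fun s => (∫ q in -t..t, (√q)⁻¹) * (√s)⁻¹)
      (volume.restrict (Ioc 0 t)) := by
    rw [← IntegrableOn, ← intervalIntegrable_iff_integrableOn_Ioc_of_le ht]
    exact (intervalIntegrable_inv_sqrt 0 t).const_mul _
  refine hI.mono' hmeas.aestronglyMeasurable.norm.integral_prod_right' ?_
  rw [ae_restrict_iff' measurableSet_Ioc]
  refine ae_of_all _ fun s hs => ?_
  have e : ∀ r, ‖(√(r - s))⁻¹ * (√s)⁻¹‖ = (√(r - s))⁻¹ * (√s)⁻¹ := fun r =>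
    Real.norm_of_nonneg (by positivity)
  simp only [e]
  rw [integral_mul_const, Real.norm_of_nonneg (mul_nonneg (integral_nonneg fun r => by positivity)
    (by positivity))]
  gcongr
  rw [← intervalIntegral.integral_of_le ht,
    intervalIntegral.integral_comp_sub_right (fun q => (√q)⁻¹)]
  exact intervalIntegral.integral_mono_interval (by linarith [hs.2]) (by linarith)
    (by linarith [hs.1]) (ae_of_all _ fun q => by positivity) (intervalIntegrable_inv_sqrt _ _)

/-- Fubini on the triangle 0 < s < r ≤ t, extended by zero to the square, where the product of
inverse square roots is an integrable majorant. -/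
lemma integral_triangle_swap {G : ℝ → ℝ → ℂ} {t C : ℝ} (ht : 0 ≤ t)
    (hc : ∀ s r, 0 < s → s < r → ContinuousAt (Function.uncurry G) (s, r))
    (hb : ∀ s r, 0 < s → s < r → r ≤ t → ‖G s r‖ ≤ C * ((√(r - s))⁻¹ * (√s)⁻¹)) :
    ∫ s in 0..t, ∫ r in s..t, G s r = ∫ r in 0..t, ∫ s in 0..r, G s r := by
  set S : Set (ℝ × ℝ) := {p | 0 < p.1 ∧ p.1 < p.2} with hS
  have hSo : IsOpen S := (isOpen_lt continuous_const continuous_fst).inter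
    (isOpen_lt continuous_fst continuous_snd)
  set H : ℝ × ℝ → ℂ := S.indicator (Function.uncurry G) with hH
  have hHi : Integrable H ((volume.restrict (Ioc 0 t)).prod (volume.restrict (Ioc 0 t))) := by
    refine ((integrable_inv_sqrt_prod ht).const_mul C).mono' ?_ ?_
    · rw [hH, aestronglyMeasurable_indicator_iff hSo.measurableSet, Measure.prod_restrict,
        Measure.restrict_restrict hSo.measurableSet]
      have h1 : AEStronglyMeasurable (Function.uncurry G)
          ((volume.prod volume).restrict S) :=
        ContinuousOn.aestronglyMeasurable (fun p hp => (hc p.1 p.2 hp.1 hp.2).continuousWithinAt)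
          hSo.measurableSet
      exact h1.mono_measure (Measure.restrict_mono inter_subset_left le_rfl)
    · rw [Measure.prod_restrict, ae_restrict_iff' (measurableSet_Ioc.prod measurableSet_Ioc)]
      refine ae_of_all _ fun p hp => ?_
      by_cases hpS : p ∈ S
      · rw [hH, indicator_of_mem hpS]
        exact hb p.1 p.2 hpS.1 hpS.2 hp.2.2
      · rw [hH, indicator_of_notMem hpS, norm_zero]
        -- Off the triangle the majorant must dominate 0, so C ≥ 0 is needed. The bound at the
        -- single interior point (t/3, t/2) forces it.
        have h2 := hb (t / 3) (t / 2)
        rcases ht.eq_or_lt with rfl | ht'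
        · have := hp.1.1.trans_le hp.1.2; exact absurd this (lt_irrefl _)
        · have h3 := (norm_nonneg _).trans (hb (t / 3) (t / 2) (by positivity) (by linarith)
            (by linarith))
          have h4 : 0 < (√(t / 2 - t / 3))⁻¹ * (√(t / 3))⁻¹ := by
            have : 0 < t / 2 - t / 3 := by linarith
            positivity
          have : 0 ≤ C := nonneg_of_mul_nonneg_left h3 h4
          positivity
  have hsw := integral_integral_swap (f := fun s r => H (s, r)) hHi
  rw [intervalIntegral.integral_of_le ht, intervalIntegral.integral_of_le ht]
  convert hsw using 1
  · refine setIntegral_congr_fun measurableSet_Ioc fun s hs => ?_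
    rw [intervalIntegral.integral_of_le hs.2]
    have e : ∀ r, H (s, r) = (Ioi s).indicator (G s) r := fun r => by
      by_cases hr : s < r
      · rw [hH, indicator_of_mem (show (s, r) ∈ S from ⟨hs.1, hr⟩), indicator_of_mem
          (show r ∈ Ioi s from hr)]; rfl
      · rw [hH, indicator_of_notMem (fun h : (s, r) ∈ S => hr h.2), indicator_of_notMem
          (fun h : r ∈ Ioi s => hr h)]
    simp only [e]
    rw [integral_indicator measurableSet_Ioi, Measure.restrict_restrict measurableSet_Ioi]
    congr 2
    ext r; constructor
    · intro h; exact ⟨h.1, hs.1.trans h.1, h.2⟩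
    · intro h; exact ⟨h.1, h.2.2⟩
  · refine setIntegral_congr_fun measurableSet_Ioc fun r hr => ?_
    rw [intervalIntegral.integral_of_le hr.1.le, ← restrict_Ioo_eq_restrict_Ioc]
    have e : ∀ s ∈ Ioc 0 t, H (s, r) = (Iio r).indicator (fun s => G s r) s := fun s hs => by
      by_cases hr : s < r
      · rw [hH, indicator_of_mem (show (s, r) ∈ S from ⟨hs.1, hr⟩), indicator_of_mem
          (show s ∈ Iio r from hr)]; rfl
      · rw [hH, indicator_of_notMem (fun h : (s, r) ∈ S => hr h.2), indicator_of_notMem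
          (fun h : s ∈ Iio r => hr h)]
    rw [setIntegral_congr_fun measurableSet_Ioc e,
      integral_indicator measurableSet_Iio, Measure.restrict_restrict measurableSet_Iio]
    congr 2
    ext s; constructor
    · intro h; exact ⟨h.2, h.1, h.2.le.trans hr.2⟩
    · intro h; exact ⟨h.2.1, h.1⟩

/-- Differentiating the Duhamel integral in t directly would meet the singular end point s = t.
Instead each K_(t-s) ⋆ f(s) - f(s) is written as an integral over r from s to t and the order of
integration is swapped; what results is a primitive of a function continuous for r > 0. -/
lemma duh_eq_integral {a : ℂ} (ha : 0 < a.re) {f fx : ℝ → ℝ → ℂ}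
    (hf : SingBdd f) (hfc : Continuous (Function.uncurry f)) (hfx : SingBdd fx)
    (hd : ∀ s, 0 < s → ∀ z, HasDerivAt (f s) (fx s z) z) {t : ℝ} (ht : 0 ≤ t) (x : ℝ) :
    duh a f t x = ∫ r in 0..t, (a * sDuh (heatK₁ a) fx r x + f r x) := by
  obtain ⟨M, hM0, hM⟩ := hf.bdd t
  obtain ⟨N, hN0, hN⟩ := hfx.bdd t
  have hfi : IntervalIntegrable (fun r => f r x) volume 0 t :=
    (hfc.comp (Continuous.prodMk_left x)).intervalIntegrable _ _
  have hsi : IntervalIntegrable (fun r => a * sDuh (heatK₁ a) fx r x) volume 0 t := by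
    refine IntervalIntegrable.const_mul (intervalIntegrable_of_norm_le ht
      (g := fun _ => mass (heatK₁ a) * N * 4) (fun r hr => ?_) (by simp) fun r hr =>
      norm_sDuh_le (decays_heatK₁ ha) hN0 hN hr.1.le hr.2.le x) a
    exact ContinuousAt.continuousWithinAt (ContinuousAt.comp (f := fun r => (r, x))
      ((continuousOn_sDuh (decays_heatK₁ ha) hfx).continuousAt
        (isOpen_Ioi_prod.mem_nhds ⟨hr.1, trivial⟩)) (Continuous.prodMk_left x).continuousAt)
  rw [intervalIntegral.integral_add hsi hfi, ← sub_eq_iff_eq_add, duh,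
    ← intervalIntegral.integral_sub (intervalIntegrable_duh_integrand ha hf ht x) hfi]
  have hsw := integral_triangle_swap (t := t) (C := ‖a‖ * (mass (heatK₁ a) * N)) (G := fun s r =>
    a * (((√(r - s))⁻¹ : ℝ) * gconv (heatK₁ a) (r - s) (fx s) x)) ht
    (fun s r hs hr => by
      refine continuousAt_const.mul (ContinuousAt.mul ?_ ?_)
      · refine Complex.continuous_ofReal.continuousAt.comp (ContinuousAt.inv₀ (by fun_prop) ?_)
        exact (Real.sqrt_pos.2 (by simp only; linarith)).ne'
      · exact continuousAt_gconv_singBdd (decays_heatK₁ ha) hfx (τ := fun p : ℝ × ℝ => p.2 - p.1)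
          (σ := fun p => p.1) (ξ := fun p => x) (by fun_prop) (by fun_prop) (by fun_prop) hs)
    (fun s r hs hr hrt => by
      rw [norm_mul, mul_assoc]
      refine mul_le_mul_of_nonneg_left ?_ (norm_nonneg _)
      exact norm_sDuh_integrand_le (decays_heatK₁ ha) hN hrt x ⟨hs, hr⟩)
  calc _ = ∫ s in 0..t, ∫ r in s..t,
        a * (((√(r - s))⁻¹ : ℝ) * gconv (heatK₁ a) (r - s) (fx s) x) := by
        rw [intervalIntegral.integral_of_le ht, intervalIntegral.integral_of_le ht]
        refine setIntegral_congr_fun measurableSet_Ioc fun s hs => ?_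
        exact (gconv_heatK_sub_self ha (hd s hs.1) (hfx.continuous hs.1) (hM s hs) (hN s hs)
          hs.2 x).symm
    _ = _ := by
        rw [hsw]
        refine intervalIntegral.integral_congr fun r _ => ?_
        simp only [intervalIntegral.integral_const_mul, sDuh]

lemma hasDerivAt_duh_time {a : ℂ} (ha : 0 < a.re) {f fx : ℝ → ℝ → ℂ}
    (hf : SingBdd f) (hfc : Continuous (Function.uncurry f)) (hfx : SingBdd fx)
    (hd : ∀ s, 0 < s → ∀ z, HasDerivAt (f s) (fx s z) z) {t : ℝ} (ht : 0 < t) (x : ℝ) :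
    HasDerivAt (fun t => duh a f t x) (a * sDuh (heatK₁ a) fx t x + f t x) t := by
  obtain ⟨N, hN0, hN⟩ := hfx.bdd t
  have hfx' : Continuous fun r => f r x := hfc.comp (Continuous.prodMk_left x)
  have hcont : ContinuousOn (fun r => a * sDuh (heatK₁ a) fx r x + f r x) (Ioi 0) := by
    intro r hr
    refine ContinuousAt.continuousWithinAt ((continuousAt_const.mul ?_).add hfx'.continuousAt)
    exact ContinuousAt.comp (f := fun r => (r, x))
      ((continuousOn_sDuh (decays_heatK₁ ha) hfx).continuousAt
        (isOpen_Ioi_prod.mem_nhds ⟨hr, trivial⟩)) (Continuous.prodMk_left x).continuousAt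
  have hint : IntervalIntegrable (fun r => a * sDuh (heatK₁ a) fx r x + f r x) volume 0 t := by
    refine intervalIntegrable_of_norm_le ht.le (g := fun r => ‖a‖ * (mass (heatK₁ a) * N * 4) +
      ‖f r x‖) (hcont.mono Ioo_subset_Ioi_self)
      (Continuous.intervalIntegrable (by fun_prop) _ _) fun r hr => ?_
    refine (norm_add_le _ _).trans ?_
    rw [norm_mul]
    gcongr
    exact norm_sDuh_le (decays_heatK₁ ha) hN0 hN hr.1.le hr.2.le x
  refine (intervalIntegral.integral_hasDerivAt_right hint
    (hcont.stronglyMeasurableAtFilter isOpen_Ioi t ht)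
    (hcont.continuousAt (Ioi_mem_nhds ht))).congr_of_eventuallyEq ?_
  filter_upwards [lt_mem_nhds ht] with r hr
  exact duh_eq_integral ha hf hfc hfx hd hr.le x

/-! ### Mild solutions are classical. -/

/-- `u` is a global solution of `∂ₜ u = a ∂ₓ² u + F(u)`, smooth for positive times, with bounded
space derivatives `ux` and `uxx` away from `t = 0`. -/
structure IsRegular (a : ℂ) (F : ℂ → ℂ) (u ux uxx : ℝ → ℝ → ℂ) : Prop where
  cont : Continuous (Function.uncurry u)
  bdd : ∀ T, ∃ M, ∀ t ∈ Icc 0 T, ∀ x, ‖u t x‖ ≤ M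
  dx : ∀ t, 0 < t → ∀ x, HasDerivAt (u t) (ux t x) x
  dxx : ∀ t, 0 < t → ∀ x, HasDerivAt (ux t) (uxx t x) x
  dt : ∀ t, 0 < t → ∀ x, HasDerivAt (fun s => u s x) (a * uxx t x + F (u t x)) t
  cont_ux : ContinuousOn (Function.uncurry ux) (Ioi 0 ×ˢ univ)
  cont_uxx : ContinuousOn (Function.uncurry uxx) (Ioi 0 ×ˢ univ)
  bdd_ux : ∀ t₀ T, 0 < t₀ → ∃ M, ∀ t ∈ Icc t₀ T, ∀ x, ‖ux t x‖ ≤ M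
  bdd_uxx : ∀ t₀ T, 0 < t₀ → ∃ M, ∀ t ∈ Icc t₀ T, ∀ x, ‖uxx t x‖ ≤ M

lemma continuousOn_gconv_const {φ : ℝ → ℂ} (hφ : Decays φ) (u₀ : ℝ →ᵇ ℂ) :
    Continuous (fun p : ℝ × ℝ => gconv φ p.1 u₀ p.2) :=
  continuous_gconv hφ (τ := fun p : ℝ × ℝ => p.1) (ξ := fun p => p.2) (g := fun _ => u₀)
    (by fun_prop) (by fun_prop) (u₀.continuous.comp continuous_snd) fun _ => u₀.norm_coe_le_norm

lemma continuousOn_inv_sqrt_fst :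
    ContinuousOn (fun p : ℝ × ℝ => (((√p.1)⁻¹ : ℝ) : ℂ)) (Ioi 0 ×ˢ univ) := by
  intro p hp
  refine ContinuousAt.continuousWithinAt
    (Complex.continuous_ofReal.continuousAt.comp (ContinuousAt.inv₀ (by fun_prop) ?_))
  exact (Real.sqrt_pos.2 hp.1).ne'

/-- A mild solution with a `C¹` Lipschitz nonlinearity is a classical one. -/
theorem IsMild.exists_isRegular {a : ℂ} (ha : 0 < a.re) {F : ℂ → ℂ} {L : NNReal}
    (hF : LipschitzWith L F) (hF1 : ContDiff ℝ 1 F) {u₀ : ℝ →ᵇ ℂ} {u : ℝ → ℝ → ℂ}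
    (hu : IsMild a F u₀ u) : ∃ ux uxx, IsRegular a F u ux uxx := by
  have dK := decays_heatK ha
  have dK₁ := decays_heatK₁ ha
  have dK₂ := decays_heatK₂ ha
  have m₁ := mass_nonneg (heatK₁ a)
  have m₂ := mass_nonneg (heatK₂ a)
  set f : ℝ → ℝ → ℂ := fun s z => F (u s z) with hf
  have hfc : Continuous (Function.uncurry f) := hF.continuous.comp hu.cont
  have hfb : ∀ T, ∃ M, ∀ t ∈ Icc 0 T, ∀ x, ‖f t x‖ ≤ M := fun T => by
    obtain ⟨M, hM⟩ := hu.bdd T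
    refine ⟨L * M + ‖F 0‖, fun t ht x => ?_⟩
    have h1 := hF.norm_sub_le (u t x) 0
    have h2 : ‖f t x‖ ≤ ‖F (u t x) - F 0‖ + ‖F 0‖ := norm_le_norm_sub_add _ _
    rw [sub_zero] at h1
    have h3 : (L : ℝ) * ‖u t x‖ ≤ L * M := by gcongr; exact hM t ht x
    linarith
  have hfS : SingBdd f := singBdd_of_continuous hfc hfb
  -- The bootstrap: the differentiated mild formula shows that u_x exists and is O(t^(-1/2)). Then
  -- ∂ₓF(u) = DF(u) u_x has the same singularity, because DF is bounded by L, and it may enter a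
  -- singular Duhamel integral that gives u_xx.
  set ux : ℝ → ℝ → ℂ := fun t x =>
    ((√t)⁻¹ : ℝ) * gconv (heatK₁ a) t u₀ x + sDuh (heatK₁ a) f t x with hux
  have huS : SingBdd ux := by
    refine ⟨(continuousOn_inv_sqrt_fst.mul (continuousOn_gconv_const dK₁ u₀).continuousOn).add
      (continuousOn_sDuh dK₁ hfS), fun T => ?_⟩
    obtain ⟨M, hM0, hM⟩ := hfS.bdd T
    refine ⟨mass (heatK₁ a) * ‖u₀‖ + mass (heatK₁ a) * M * 4 * √T, by positivity,
      fun s hs z => ?_⟩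
    have h1 : 0 < √s := Real.sqrt_pos.2 hs.1
    have h2 : √s ≤ √T := Real.sqrt_le_sqrt hs.2
    have h3 : 1 ≤ √T * (√s)⁻¹ := by
      rw [← div_eq_mul_inv]; exact (one_le_div h1).2 h2
    have h4 := norm_sDuh_le dK₁ hM0 hM hs.1.le hs.2 z
    have h5 := norm_gconv_le dK₁ s u₀.norm_coe_le_norm z
    refine (norm_add_le _ _).trans ?_
    rw [norm_mul, Complex.norm_real, Real.norm_of_nonneg (by positivity), add_mul, mul_comm]
    refine add_le_add (by gcongr) (h4.trans ?_)
    rw [mul_assoc _ (√T)]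
    exact le_mul_of_one_le_right (by positivity) h3
  have hdx : ∀ t, 0 < t → ∀ x, HasDerivAt (u t) (ux t x) x := fun t ht x => by
    have e : u t = fun x => gconv (heatK a) t u₀ x + duh a f t x := funext fun x => hu.eq t ht.le x
    rw [e]
    exact (hasDerivAt_gconv_kernel dK dK₁ (hasDerivAt_heatK a) ht u₀.continuous
      u₀.norm_coe_le_norm x).add (hasDerivAt_duh ha hfS ht x)
  set fx : ℝ → ℝ → ℂ := fun t x => fderiv ℝ F (u t x) (ux t x) with hfx
  have hdf : ∀ s, 0 < s → ∀ z, HasDerivAt (f s) (fx s z) z := fun s hs z =>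
    ((hF1.differentiable one_ne_zero) (u s z)).hasFDerivAt.comp_hasDerivAt z (hdx s hs z)
  have hfxS : SingBdd fx := by
    refine ⟨?_, fun T => ?_⟩
    · have h1 : ContinuousOn (fun p : ℝ × ℝ => fderiv ℝ F (u p.1 p.2)) (Ioi 0 ×ˢ univ) :=
        ((hF1.continuous_fderiv one_ne_zero).comp hu.cont).continuousOn
      exact h1.clm_apply huS.cont
    · obtain ⟨M, hM0, hM⟩ := huS.bdd T
      refine ⟨L * M, by positivity, fun s hs z => ?_⟩
      refine ((fderiv ℝ F (u s z)).le_opNorm _).trans ?_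
      rw [mul_assoc]
      gcongr
      · exact norm_fderiv_le_of_lipschitz ℝ hF
      · exact hM s hs z
  set uxx : ℝ → ℝ → ℂ := fun t x => ((√t)⁻¹ : ℝ) * (((√t)⁻¹ : ℝ) * gconv (heatK₂ a) t u₀ x) +
    sDuh (heatK₁ a) fx t x with huxx
  refine ⟨ux, uxx, hu.cont, hu.bdd, hdx, fun t ht x => ?_, fun t ht x => ?_, huS.cont, ?_,
    fun t₀ T h0 => ?_, fun t₀ T h0 => ?_⟩
  · exact ((hasDerivAt_gconv_kernel dK₁ dK₂ (hasDerivAt_heatK₁ a) ht u₀.continuous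
      u₀.norm_coe_le_norm x).const_mul _).add (hasDerivAt_sDuh dK₁ hfS hfxS hdf ht x)
  · have h1 := (hasDerivAt_gconv_time ha ht u₀.continuous u₀.norm_coe_le_norm x).add
      (hasDerivAt_duh_time ha hfS hfc hfxS hdf ht x)
    refine (h1.congr_of_eventuallyEq ?_).congr_deriv ?_
    · filter_upwards [lt_mem_nhds ht] with s hs
      exact hu.eq s hs.le x
    · simp only [huxx, hf]; ring
  · exact (continuousOn_inv_sqrt_fst.mul (continuousOn_inv_sqrt_fst.mul
      (continuousOn_gconv_const dK₂ u₀).continuousOn)).add (continuousOn_sDuh dK₁ hfxS)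
  · obtain ⟨M, hM0, hM⟩ := huS.bdd T
    refine ⟨M * (√t₀)⁻¹, fun t ht x => (hM t ⟨h0.trans_le ht.1, ht.2⟩ x).trans ?_⟩
    have := ht.1
    gcongr
  · obtain ⟨M, hM0, hM⟩ := hfxS.bdd T
    refine ⟨(√t₀)⁻¹ * ((√t₀)⁻¹ * (mass (heatK₂ a) * ‖u₀‖)) + mass (heatK₁ a) * M * 4,
      fun t ht x => ?_⟩
    have h1 := ht.1
    have ht0 : 0 < t := h0.trans_le ht.1
    have h4 := norm_sDuh_le dK₁ hM0 hM ht0.le ht.2 x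
    have h5 := norm_gconv_le dK₂ t u₀.norm_coe_le_norm x
    refine (norm_add_le _ _).trans (add_le_add ?_ h4)
    rw [norm_mul, norm_mul, Complex.norm_real, Real.norm_of_nonneg (by positivity)]
    gcongr

/-! ### Localised Duhamel formula; classical solutions are mild. -/

/-- `u` solves `∂ₜ u = a ∂ₓ² u + f` classically on the open time interval `(t₀, t₁)` and is
continuous up to its end points. -/
structure SolvesOn (a : ℂ) (t₀ t₁ : ℝ) (f u ux uxx : ℝ → ℝ → ℂ) : Prop where
  cont : Continuous (Function.uncurry u)
  cont_force : Continuous (Function.uncurry f)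
  dx : ∀ t ∈ Ioo t₀ t₁, ∀ x, HasDerivAt (u t) (ux t x) x
  dxx : ∀ t ∈ Ioo t₀ t₁, ∀ x, HasDerivAt (ux t) (uxx t x) x
  dt : ∀ t ∈ Ioo t₀ t₁, ∀ x, HasDerivAt (fun s => u s x) (a * uxx t x + f t x) t
  cont_uxx : ContinuousOn (Function.uncurry uxx) (Ioo t₀ t₁ ×ˢ univ)

/-- A `C²` cut-off function `ψ` supported in `[-ρ, ρ]`. -/
structure IsCutoff (ρ : ℝ) (ψ ψ₁ ψ₂ : ℝ → ℝ) : Prop where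
  pos : 0 < ρ
  d₁ : ∀ z, HasDerivAt ψ (ψ₁ z) z
  d₂ : ∀ z, HasDerivAt ψ₁ (ψ₂ z) z
  cont₂ : Continuous ψ₂
  supp : ∀ z, ρ ≤ |z| → ψ z = 0
  supp₁ : ∀ z, ρ ≤ |z| → ψ₁ z = 0
  supp₂ : ∀ z, ρ ≤ |z| → ψ₂ z = 0

lemma IsCutoff.cont {ρ : ℝ} {ψ ψ₁ ψ₂ : ℝ → ℝ} (h : IsCutoff ρ ψ ψ₁ ψ₂) : Continuous ψ :=
  continuous_iff_continuousAt.2 fun z => (h.d₁ z).continuousAt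

lemma IsCutoff.cont₁ {ρ : ℝ} {ψ ψ₁ ψ₂ : ℝ → ℝ} (h : IsCutoff ρ ψ ψ₁ ψ₂) : Continuous ψ₁ :=
  continuous_iff_continuousAt.2 fun z => (h.d₂ z).continuousAt

lemma hasDerivAt_intervalIntegral_param {G G' : ℝ → ℝ → ℂ} {c d α β : ℝ} (hαβ : α ≤ β)
    (hd : ∀ s ∈ Ioo c d, ∀ z, HasDerivAt (fun s => G s z) (G' s z) s)
    (hG : ContinuousOn (Function.uncurry G) (Ioo c d ×ˢ univ))
    (hG' : ContinuousOn (Function.uncurry G') (Ioo c d ×ˢ univ)) {s : ℝ} (hs : s ∈ Ioo c d) :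
    HasDerivAt (fun s => ∫ z in α..β, G s z) (∫ z in α..β, G' s z) s := by
  obtain ⟨c', hc, hcs⟩ := exists_between hs.1
  obtain ⟨d', hsd, hd'⟩ := exists_between hs.2
  have hsub : Icc c' d' ⊆ Ioo c d := fun r hr => ⟨hc.trans_le hr.1, hr.2.trans_lt hd'⟩
  obtain ⟨M, hM⟩ := (isCompact_Icc.prod (isCompact_Icc (a := α) (b := β))).exists_bound_of_continuousOn
    (hG'.mono (prod_mono hsub (subset_univ _)))
  have hsec : ∀ {H : ℝ → ℝ → ℂ}, ContinuousOn (Function.uncurry H) (Ioo c d ×ˢ univ) →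
      ∀ r ∈ Ioo c d, Continuous (H r) := fun hH r hr => by
    rw [← continuousOn_univ]
    exact hH.comp (Continuous.prodMk_right r).continuousOn fun z _ => ⟨hr, trivial⟩
  refine (intervalIntegral.hasDerivAt_integral_of_dominated_loc_of_deriv_le
    (bound := fun _ => M) (Icc_mem_nhds hcs hsd) ?_ ((hsec hG s hs).intervalIntegrable _ _)
    (hsec hG' s hs).aestronglyMeasurable ?_ (by simp) ?_).2
  · filter_upwards [Ioo_mem_nhds hs.1 hs.2] with r hr
    exact (hsec hG r hr).aestronglyMeasurable
  · refine ae_of_all _ fun z hz r hr => ?_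
    rw [uIoc_of_le hαβ] at hz
    exact hM (r, z) ⟨hr, Ioc_subset_Icc_self hz⟩
  · exact ae_of_all _ fun z _ r hr => hd r (hsub hr) z

lemma exists_bound_of_support {w : ℝ → ℝ → ℂ} (hw : Continuous (Function.uncurry w)) {ρ : ℝ}
    (hs : ∀ s z, ρ ≤ |z| → w s z = 0) (c d : ℝ) :
    ∃ M, 0 ≤ M ∧ ∀ s ∈ Icc c d, ∀ z, ‖w s z‖ ≤ M := by
  obtain ⟨M, hM⟩ := ((isCompact_Icc (a := c) (b := d)).prod
    (isCompact_Icc (a := -ρ) (b := ρ))).exists_bound_of_continuousOn hw.continuousOn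
  refine ⟨|M|, abs_nonneg _, fun s h z => ?_⟩
  by_cases hz : ρ ≤ |z|
  · rw [hs s z hz, norm_zero]; positivity
  · exact (hM (s, z) ⟨h, abs_le.1 (not_le.1 hz).le⟩).trans (le_abs_self M)

lemma continuous_gconv_of_support {φ : ℝ → ℂ} (hφ : Decays φ) {w : ℝ → ℝ → ℂ}
    (hw : Continuous (Function.uncurry w)) {ρ : ℝ} (hs : ∀ s z, ρ ≤ |z| → w s z = 0) (t x : ℝ) :
    Continuous fun s => gconv φ (t - s) (w s) x := by
  refine continuous_iff_continuousAt.2 fun s => ?_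
  obtain ⟨M, -, hM⟩ := exists_bound_of_support hw hs (s - 1) (s + 1)
  refine continuousAt_gconv hφ (τ := fun s => t - s) (ξ := fun _ => x) (M := M) (by fun_prop)
    (by fun_prop) (Eventually.of_forall fun r => hw.comp (Continuous.prodMk_right r))
    (fun z => hw.continuousAt) ?_
  filter_upwards [Icc_mem_nhds (by linarith : s - 1 < s) (by linarith : s < s + 1)] with r hr
  exact hM r hr

lemma integral_eq_of_support {h : ℝ → ℂ} {ρ : ℝ} (hs : ∀ z, ρ ≤ |z| → h z = 0) :
    ∫ z in -ρ..ρ, h z = ∫ z, h z := by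
  refine intervalIntegral.integral_eq_integral_of_support_subset fun z hz => ?_
  have : |z| < ρ := by
    by_contra hc
    exact hz (hs z (not_lt.1 hc))
  exact ⟨(abs_lt.1 this).1, (abs_lt.1 this).2.le⟩

/-- The forcing of the cut-off equation, propagated to time `t` and position `x`. -/
noncomputable def cutoffForce (a : ℂ) (ψ ψ₁ ψ₂ : ℝ → ℝ) (f u : ℝ → ℝ → ℂ) (t x s : ℝ) : ℂ :=
  gconv (heatK a) (t - s) (fun z => ψ z * f s z + a * (ψ₂ z * u s z)) x -
    2 * a * (((√(t - s))⁻¹ : ℝ) * gconv (heatK₁ a) (t - s) (fun z => ψ₁ z * u s z) x)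

/-- The product ψu solves the heat equation with force ψf + aψ''u - 2a(ψ'u)_x. Writing the
commutator in this form and moving its derivative to the kernel leaves only u itself, so no bound on
u_x is needed. -/
lemma SolvesOn.integral_cutoff_deriv {a : ℂ} {t₀ t₁ : ℝ} {f u ux uxx : ℝ → ℝ → ℂ}
    (h : SolvesOn a t₀ t₁ f u ux uxx) {ρ : ℝ} {ψ ψ₁ ψ₂ : ℝ → ℝ} (hψ : IsCutoff ρ ψ ψ₁ ψ₂)
    (x : ℝ) {s : ℝ} (hs : s ∈ Ioo t₀ t₁) :
    ∫ z in -ρ..ρ, (-(a * heatKernel₂ a (t₁ - s) (x - z)) * (ψ z * u s z) +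
      heatKernel a (t₁ - s) (x - z) * (ψ z * (a * uxx s z + f s z))) =
    cutoffForce a ψ ψ₁ ψ₂ f u t₁ x s := by
  have hτ : 0 < t₁ - s := by linarith [hs.2]
  set k : ℝ → ℂ := fun z => heatKernel a (t₁ - s) (x - z) with hk
  set k₁ : ℝ → ℂ := fun z => heatKernel₁ a (t₁ - s) (x - z) with hk₁
  set k₂ : ℝ → ℂ := fun z => heatKernel₂ a (t₁ - s) (x - z) with hk₂
  have dk : ∀ z, HasDerivAt k (-k₁ z) z := fun z =>
    (hasDerivAt_heatKernel a (t₁ - s) (x - z)).comp_const_sub x z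
  have dk₁ : ∀ z, HasDerivAt k₁ (-k₂ z) z := fun z =>
    (hasDerivAt_heatKernel₁ a (t₁ - s) (x - z)).comp_const_sub x z
  have cK := continuous_heatK a
  have cK₁ := continuous_heatK₁ a
  have cK₂ := continuous_heatK₂ a
  have ck : Continuous k := by unfold k heatKernel; fun_prop
  have ck₁ : Continuous k₁ := by unfold k₁ heatKernel₁; fun_prop
  have ck₂ : Continuous k₂ := by unfold k₂ heatKernel₂; fun_prop
  have cψ := hψ.cont
  have cψ₁ := hψ.cont₁
  have cψ₂ := hψ.cont₂
  have cu : Continuous (u s) := h.cont.comp (Continuous.prodMk_right s)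
  have cf : Continuous (f s) := h.cont_force.comp (Continuous.prodMk_right s)
  have cux : Continuous (ux s) :=
    continuous_iff_continuousAt.2 fun z => (h.dxx s hs z).continuousAt
  have cuxx : Continuous (uxx s) := by
    rw [← continuousOn_univ]
    exact h.cont_uxx.comp (Continuous.prodMk_right s).continuousOn fun z _ => ⟨hs, trivial⟩
  have cofReal := Complex.continuous_ofReal
  -- This function collects the boundary terms of both integrations by parts. Its derivative is the
  -- difference of the two integrands, and it vanishes at ±ρ because ψ and ψ' do.
  have dP : ∀ z, HasDerivAt (fun z => a * (ψ z * ux s z * k z - ψ₁ z * u s z * k z +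
      ψ z * u s z * k₁ z)) (a * (((ψ₁ z * ux s z + ψ z * uxx s z) * k z + ψ z * ux s z * -k₁ z) -
      ((ψ₂ z * u s z + ψ₁ z * ux s z) * k z + ψ₁ z * u s z * -k₁ z) +
      ((ψ₁ z * u s z + ψ z * ux s z) * k₁ z + ψ z * u s z * -k₂ z))) z := fun z => by
    have d0 := (hψ.d₁ z).ofReal_comp
    have d1 := (hψ.d₂ z).ofReal_comp
    have d2 := h.dx s hs z
    have d3 := h.dxx s hs z
    exact ((((d0.mul d3).mul (dk z)).sub ((d1.mul d2).mul (dk z))).add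
      ((d0.mul d2).mul (dk₁ z))).const_mul a
  have hFTC := intervalIntegral.integral_eq_sub_of_hasDerivAt (a := -ρ) (b := ρ)
    (fun z _ => dP z) (Continuous.intervalIntegrable (by fun_prop) _ _)
  have e1 : ρ ≤ |ρ| := le_abs_self ρ
  have e2 : ρ ≤ |(-ρ)| := by rw [abs_neg]; exact le_abs_self ρ
  simp only [hψ.supp _ e1, hψ.supp _ e2, hψ.supp₁ _ e1, hψ.supp₁ _ e2, Complex.ofReal_zero,
    zero_mul, mul_zero, sub_zero, add_zero] at hFTC
  have hR : cutoffForce a ψ ψ₁ ψ₂ f u t₁ x s = ∫ z in -ρ..ρ, (k z * (ψ z * f s z +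
      a * (ψ₂ z * u s z)) - 2 * a * (k₁ z * (ψ₁ z * u s z))) := by
    rw [cutoffForce, gconv_eq_integral_kernel hτ, gconv_eq_integral_kernel hτ,
      intervalIntegral.integral_sub (Continuous.intervalIntegrable (by fun_prop) _ _)
        (Continuous.intervalIntegrable (by fun_prop) _ _), intervalIntegral.integral_const_mul,
      integral_eq_of_support, integral_eq_of_support, ← integral_const_mul]
    · congr 3
      ext z
      simp only [hk₁, heatKernel₁]; ring
    · intro z hz
      simp [hψ.supp₁ z hz]
    · intro z hz
      simp [hψ.supp z hz, hψ.supp₂ z hz]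
  change ∫ z in -ρ..ρ, (-(a * k₂ z) * (ψ z * u s z) + k z * (ψ z * (a * uxx s z + f s z))) = _
  rw [hR, ← sub_eq_zero, ← intervalIntegral.integral_sub
    (Continuous.intervalIntegrable (by fun_prop) _ _)
    (Continuous.intervalIntegrable (by fun_prop) _ _)]
  rw [← hFTC]
  congr 1; ext z
  simp only [hk, hk₁, hk₂]
  ring

lemma SolvesOn.intervalIntegrable_cutoffForce {a : ℂ} (ha : 0 < a.re) {t₀ t₁ : ℝ} (h01 : t₀ ≤ t₁)
    {f u ux uxx : ℝ → ℝ → ℂ} (h : SolvesOn a t₀ t₁ f u ux uxx) {ρ : ℝ} {ψ ψ₁ ψ₂ : ℝ → ℝ}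
    (hψ : IsCutoff ρ ψ ψ₁ ψ₂) (x : ℝ) :
    IntervalIntegrable (cutoffForce a ψ ψ₁ ψ₂ f u t₁ x) volume t₀ t₁ := by
  have cψ := hψ.cont
  have cψ₁ := hψ.cont₁
  have cψ₂ := hψ.cont₂
  have cofReal := Complex.continuous_ofReal
  have cu := h.cont
  have cf := h.cont_force
  have cw₁ : Continuous (Function.uncurry fun s z => (ψ₁ z : ℂ) * u s z) :=
    (cofReal.comp (cψ₁.comp continuous_snd)).mul cu
  have sw₁ : ∀ s z, ρ ≤ |z| → (ψ₁ z : ℂ) * u s z = 0 := fun s z hz => by simp [hψ.supp₁ z hz]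
  have cw₂ : Continuous (Function.uncurry fun s z => (ψ z : ℂ) * f s z + a * (ψ₂ z * u s z)) :=
    ((cofReal.comp (cψ.comp continuous_snd)).mul cf).add
      (continuous_const.mul ((cofReal.comp (cψ₂.comp continuous_snd)).mul cu))
  have sw₂ : ∀ s z, ρ ≤ |z| → (ψ z : ℂ) * f s z + a * (ψ₂ z * u s z) = 0 := fun s z hz => by
    simp [hψ.supp z hz, hψ.supp₂ z hz]
  have hQ₁ := continuous_gconv_of_support (decays_heatK₁ ha) cw₁ sw₁ t₁ x
  have hQ₂ := continuous_gconv_of_support (decays_heatK ha) cw₂ sw₂ t₁ x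
  obtain ⟨M, hM0, hM⟩ := exists_bound_of_support cw₁ sw₁ t₀ t₁
  refine IntervalIntegrable.sub (hQ₂.intervalIntegrable _ _) (IntervalIntegrable.const_mul ?_ _)
  refine intervalIntegrable_of_norm_le h01 (g := fun s => (√(t₁ - s))⁻¹ *
    (mass (heatK₁ a) * M)) (fun s hs => ?_) ((intervalIntegrable_inv_sqrt_sub _ _ _).mul_const _)
    fun s hs => ?_
  · refine ContinuousAt.continuousWithinAt (ContinuousAt.mul ?_ hQ₁.continuousAt)
    refine cofReal.continuousAt.comp (ContinuousAt.inv₀ (by fun_prop) ?_)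
    exact (Real.sqrt_pos.2 (by linarith [hs.2])).ne'
  · rw [norm_mul, Complex.norm_real, Real.norm_of_nonneg (by positivity)]
    gcongr
    exact norm_gconv_le (decays_heatK₁ ha) _ (hM s (Ioo_subset_Icc_self hs)) _

/-- Integration in s of the derivative of K_(t₁-s) ⋆ (ψ u(s)), which equals ψ u at s = t₁. Compact
support replaces every decay or growth condition on the derivatives of u. -/
theorem SolvesOn.cutoff_formula {a : ℂ} (ha : 0 < a.re) {t₀ t₁ : ℝ} (h01 : t₀ ≤ t₁)
    {f u ux uxx : ℝ → ℝ → ℂ} (h : SolvesOn a t₀ t₁ f u ux uxx) {ρ : ℝ} {ψ ψ₁ ψ₂ : ℝ → ℝ}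
    (hψ : IsCutoff ρ ψ ψ₁ ψ₂) (x : ℝ) :
    ψ x * u t₁ x = gconv (heatK a) (t₁ - t₀) (fun z => ψ z * u t₀ z) x +
      ∫ s in t₀..t₁, cutoffForce a ψ ψ₁ ψ₂ f u t₁ x s := by
  have h0 : a ≠ 0 := by rintro rfl; simp at ha
  have cψ := hψ.cont
  have cofReal := Complex.continuous_ofReal
  have cu := h.cont
  have cf := h.cont_force
  have cK := continuous_heatK a
  have cK₂ := continuous_heatK₂ a
  have cw : Continuous (Function.uncurry fun s z => (ψ z : ℂ) * u s z) :=
    (cofReal.comp (cψ.comp continuous_snd)).mul cu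
  have sw : ∀ s z, ρ ≤ |z| → (ψ z : ℂ) * u s z = 0 := fun s z hz => by simp [hψ.supp z hz]
  have hQ : Continuous fun s => gconv (heatK a) (t₁ - s) (fun z => ψ z * u s z) x :=
    continuous_gconv_of_support (decays_heatK ha) cw sw t₁ x
  have hint := h.intervalIntegrable_cutoffForce ha h01 hψ x
  have hder : ∀ s ∈ Ioo t₀ t₁, HasDerivAt
      (fun s => gconv (heatK a) (t₁ - s) (fun z => ψ z * u s z) x)
      (cutoffForce a ψ ψ₁ ψ₂ f u t₁ x s) s := by
    intro s hs
    rw [← h.integral_cutoff_deriv hψ x hs]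
    have hd := hasDerivAt_intervalIntegral_param (α := -ρ) (β := ρ) (c := t₀) (d := t₁)
      (G := fun s z => heatKernel a (t₁ - s) (x - z) * (ψ z * u s z))
      (G' := fun s z => -(a * heatKernel₂ a (t₁ - s) (x - z)) * (ψ z * u s z) +
        heatKernel a (t₁ - s) (x - z) * (ψ z * (a * uxx s z + f s z)))
      (by linarith [hψ.pos]) (fun s hs z => ?_) ?_ ?_ hs
    · refine hd.congr_of_eventuallyEq ?_
      filter_upwards [Ioo_mem_nhds hs.1 hs.2] with r hr
      rw [gconv_eq_integral_kernel (by linarith [hr.2]), ← integral_eq_of_support (ρ := ρ)]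
      · rfl
      · intro z hz; rw [sw r z hz, mul_zero]
    · have d1 := (hasDerivAt_heatKernel_time h0 (τ := t₁ - s) (by linarith [hs.2])
        (x - z)).comp_const_sub t₁ s
      exact d1.mul ((h.dt s hs z).const_mul (ψ z : ℂ))
    all_goals
      have hsq : ContinuousOn (fun p : ℝ × ℝ => (√(t₁ - p.1))⁻¹) (Ioo t₀ t₁ ×ˢ univ) :=
        ContinuousOn.inv₀ (by fun_prop) fun p hp => (Real.sqrt_pos.2 (by linarith [hp.1.2])).ne'
      have hq : ContinuousOn (fun p : ℝ × ℝ => (x - p.2) / √(t₁ - p.1)) (Ioo t₀ t₁ ×ˢ univ) :=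
        ContinuousOn.mul (by fun_prop) hsq
      have hsq' := cofReal.comp_continuousOn hsq
      have hk : ContinuousOn (fun p : ℝ × ℝ => heatKernel a (t₁ - p.1) (x - p.2))
        (Ioo t₀ t₁ ×ˢ univ) := hsq'.mul (cK.comp_continuousOn hq)
    · exact hk.mul cw.continuousOn
    · have hk₂ : ContinuousOn (fun p : ℝ × ℝ => heatKernel₂ a (t₁ - p.1) (x - p.2))
        (Ioo t₀ t₁ ×ˢ univ) := hsq'.mul (hsq'.mul (hsq'.mul (cK₂.comp_continuousOn hq)))
      refine ((continuousOn_const.mul hk₂).neg.mul cw.continuousOn).add (hk.mul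
        (ContinuousOn.mul (by fun_prop) ((continuousOn_const.mul h.cont_uxx).add
          cf.continuousOn)))
  have := intervalIntegral.integral_eq_sub_of_hasDerivAt_of_le h01 hQ.continuousOn hder hint
  rw [this, sub_self, gconv_heatK_zero ha]
  ring

/-- A rescaled bump. As R ≥ 1, the factor R⁻² of the second derivative is also at most R⁻¹. The case
R = 1 localises the a priori estimate; R → ∞ removes the cut-off. -/
lemma exists_cutoffs : ∃ C : ℝ, 0 ≤ C ∧ ∀ x₀ R : ℝ, 1 ≤ R → ∃ (ρ : ℝ) (ψ ψ₁ ψ₂ : ℝ → ℝ),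
    IsCutoff ρ ψ ψ₁ ψ₂ ∧ (∀ z, 0 ≤ ψ z) ∧ (∀ z, ψ z ≤ 1) ∧ (∀ z, |z - x₀| ≤ R → ψ z = 1) ∧
    (∀ z, 2 * R ≤ |z - x₀| → ψ z = 0 ∧ ψ₁ z = 0 ∧ ψ₂ z = 0) ∧
    (∀ z, |ψ₁ z| ≤ C / R) ∧ (∀ z, |ψ₂ z| ≤ C / R) := by
  let χ : ContDiffBump (0 : ℝ) := ⟨1, 2, one_pos, one_lt_two⟩
  have hχ : ContDiff ℝ 2 χ := χ.contDiff
  have hχ₁ : ContDiff ℝ 1 (deriv χ) := ((contDiff_succ_iff_deriv (n := 1)).1 hχ).2.2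
  have hχ₂ : Continuous (deriv (deriv χ)) := hχ₁.continuous_deriv le_rfl
  have hs : HasCompactSupport χ := χ.hasCompactSupport
  have z₁ : ∀ y : ℝ, 2 ≤ |y| → χ y = 0 := fun y hy => χ.zero_of_le_dist (by simpa using hy)
  have zloc : ∀ {g : ℝ → ℝ}, Continuous (deriv g) → (∀ y : ℝ, 2 ≤ |y| → g y = 0) →
      ∀ y : ℝ, 2 ≤ |y| → deriv g y = 0 := by
    intro g hg h
    have hopen : ∀ y : ℝ, 2 < |y| → deriv g y = 0 := fun y hy => by
      have : g =ᶠ[𝓝 y] fun _ => 0 := by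
        filter_upwards [continuous_abs.continuousAt.eventually (lt_mem_nhds hy)] with w hw
        exact h w hw.le
      rw [this.deriv_eq]; simp
    -- At |y| = 2 itself g need not vanish near y; there the derivative vanishes by continuity, as a
    -- limit of points with |y| > 2.
    intro y hy
    have hcl : y ∈ closure {y : ℝ | 2 < |y|} := by
      rw [Metric.mem_closure_iff]
      intro ε hε
      rcases le_or_gt 0 y with h0 | h0
      · refine ⟨y + ε / 2, ?_, ?_⟩
        · rw [abs_of_nonneg h0] at hy
          rw [mem_ofPred_eq, abs_of_nonneg (by positivity)]; linarith
        · rw [Real.dist_eq, abs_lt]; constructor <;> linarith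
      · refine ⟨y - ε / 2, ?_, ?_⟩
        · rw [abs_of_neg h0] at hy
          rw [mem_ofPred_eq, abs_of_neg (by linarith)]; linarith
        · rw [Real.dist_eq, abs_lt]; constructor <;> linarith
    have hcl2 : IsClosed {y | deriv g y = 0} := isClosed_eq hg continuous_const
    exact closure_minimal (fun y hy => hopen y hy) hcl2 hcl
  have z₂ := zloc (hχ₁.continuous) z₁
  have z₃ := zloc hχ₂ z₂
  obtain ⟨C₁, hC₁⟩ := hs.deriv.exists_bound_of_continuous hχ₁.continuous
  obtain ⟨C₂, hC₂⟩ := hs.deriv.deriv.exists_bound_of_continuous hχ₂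
  have p₁ : 0 ≤ C₁ := (norm_nonneg _).trans (hC₁ 0)
  have p₂ : 0 ≤ C₂ := (norm_nonneg _).trans (hC₂ 0)
  refine ⟨C₁ + C₂, by positivity, fun x₀ R hR => ?_⟩
  have hR0 : 0 < R := by linarith
  have far : ∀ z, 2 * R ≤ |z - x₀| → 2 ≤ |(z - x₀) / R| := fun z hz => by
    rw [abs_div, abs_of_pos hR0, le_div_iff₀ hR0]; exact hz
  have far' : ∀ z, |x₀| + 2 * R ≤ |z| → 2 * R ≤ |z - x₀| := fun z hz => by
    have := abs_sub_abs_le_abs_sub z x₀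
    linarith
  refine ⟨|x₀| + 2 * R, fun z => χ ((z - x₀) / R), fun z => deriv χ ((z - x₀) / R) * R⁻¹,
    fun z => deriv (deriv χ) ((z - x₀) / R) * R⁻¹ * R⁻¹,
    ⟨by positivity, fun z => ?_, fun z => ?_, by fun_prop, fun z hz => z₁ _ (far z (far' z hz)),
      fun z hz => ?_, fun z hz => ?_⟩, fun z => χ.nonneg, fun z => χ.le_one, fun z hz => ?_,
    fun z hz => ⟨z₁ _ (far z hz), ?_, ?_⟩, fun z => ?_, fun z => ?_⟩
  · have h1 : HasDerivAt (fun z => (z - x₀) / R) R⁻¹ z := by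
      simpa using ((hasDerivAt_id z).sub_const x₀).div_const R
    exact HasDerivAt.comp (h₂ := χ) z ((hχ.differentiable two_ne_zero) ((z - x₀) / R)).hasDerivAt h1
  · have h1 : HasDerivAt (fun z => (z - x₀) / R) R⁻¹ z := by
      simpa using ((hasDerivAt_id z).sub_const x₀).div_const R
    exact (((hχ₁.differentiable one_ne_zero) ((z - x₀) / R)).hasDerivAt.comp z h1).mul_const _
  · simp only [z₂ _ (far z (far' z hz)), zero_mul]
  · simp only [z₃ _ (far z (far' z hz)), zero_mul]
  · refine χ.one_of_mem_closedBall ?_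
    rw [Metric.mem_closedBall, Real.dist_eq, sub_zero, abs_div, abs_of_pos hR0]
    exact (div_le_one hR0).2 hz
  · simp only [z₂ _ (far z hz), zero_mul]
  · simp only [z₃ _ (far z hz), zero_mul]
  · rw [abs_mul, abs_of_pos (inv_pos.2 hR0), ← div_eq_mul_inv]
    gcongr
    exact (hC₁ _).trans (by linarith)
  · rw [abs_mul, abs_mul, abs_of_pos (inv_pos.2 hR0), ← div_eq_mul_inv]
    gcongr
    have h1 : R⁻¹ ≤ 1 := inv_le_one_of_one_le₀ hR
    have h2 := hC₂ ((z - x₀) / R)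
    rw [Real.norm_eq_abs] at h2
    calc _ ≤ C₂ * 1 := by gcongr
      _ ≤ _ := by linarith

lemma tendsto_gconv {φ : ℝ → ℂ} (hφ : Decays φ) (τ x : ℝ) {g : ℕ → ℝ → ℂ} {g₀ : ℝ → ℂ} {M : ℝ}
    (hc : ∀ n, Continuous (g n)) (hM : ∀ n z, ‖g n z‖ ≤ M)
    (ht : ∀ z, Tendsto (fun n => g n z) atTop (𝓝 (g₀ z))) :
    Tendsto (fun n => gconv φ τ (g n) x) atTop (𝓝 (gconv φ τ g₀ x)) := by
  have := hφ.cont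
  refine tendsto_integral_of_dominated_convergence (fun y => ‖φ y‖ * M)
    (fun n => ?_) (hφ.integrable_norm.mul_const M) (fun n => ae_of_all _ fun y => ?_)
    (ae_of_all _ fun y => (ht _).const_mul _)
  · have := hc n
    exact Continuous.aestronglyMeasurable (by fun_prop)
  · rw [norm_mul]; gcongr; exact hM n _

lemma norm_cutoffForce_le {a : ℂ} (ha : 0 < a.re) {ψ ψ₁ ψ₂ : ℝ → ℝ} {f u : ℝ → ℝ → ℂ}
    {t x s A B : ℝ} (hA : ∀ z, ‖(ψ z : ℂ) * f s z + a * (ψ₂ z * u s z)‖ ≤ A)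
    (hB : ∀ z, ‖(ψ₁ z : ℂ) * u s z‖ ≤ B) : ‖cutoffForce a ψ ψ₁ ψ₂ f u t x s‖ ≤
      mass (heatK a) * A + 2 * ‖a‖ * ((√(t - s))⁻¹ * (mass (heatK₁ a) * B)) := by
  refine (norm_sub_le _ _).trans (add_le_add (norm_gconv_le (decays_heatK ha) _ hA x) ?_)
  rw [norm_mul, norm_mul, norm_mul, Complex.norm_real, Real.norm_of_nonneg (by positivity)]
  simp only [Complex.norm_ofNat]
  gcongr
  exact norm_gconv_le (decays_heatK₁ ha) _ hB x

/-- Bounded classical solutions are mild solutions. -/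
theorem SolvesOn.mild_formula {a : ℂ} (ha : 0 < a.re) {t₀ t₁ : ℝ} (h01 : t₀ ≤ t₁)
    {f u ux uxx : ℝ → ℝ → ℂ} (h : SolvesOn a t₀ t₁ f u ux uxx) {M N : ℝ}
    (hM : ∀ s ∈ Icc t₀ t₁, ∀ z, ‖u s z‖ ≤ M) (hN : ∀ s ∈ Icc t₀ t₁, ∀ z, ‖f s z‖ ≤ N) (x : ℝ) :
    u t₁ x = gconv (heatK a) (t₁ - t₀) (u t₀) x +
      ∫ s in t₀..t₁, gconv (heatK a) (t₁ - s) (f s) x := by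
  obtain ⟨C, hC0, hC⟩ := exists_cutoffs
  have hR : ∀ n : ℕ, (1 : ℝ) ≤ (n : ℝ) + 1 := fun n => by
    have : (0 : ℝ) ≤ n := Nat.cast_nonneg n
    linarith
  -- Cut-offs at radius n + 1: ψ tends to 1 pointwise, the commutators are O(1/n), and dominated
  -- convergence removes the cut-off from `SolvesOn.cutoff_formula`.
  choose ρ ψ ψ₁ ψ₂ hψ hψ0 hψ1 hψin hψout hψb₁ hψb₂ using fun n : ℕ => hC 0 ((n : ℝ) + 1) (hR n)
  have hM0 : 0 ≤ M := (norm_nonneg _).trans (hM t₀ ⟨le_rfl, h01⟩ 0)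
  have hN0 : 0 ≤ N := (norm_nonneg _).trans (hN t₀ ⟨le_rfl, h01⟩ 0)
  have habs : ∀ n z, |ψ n z| ≤ 1 := fun n z => by
    rw [abs_of_nonneg (hψ0 n z)]; exact hψ1 n z
  have hCR : ∀ n : ℕ, C / ((n : ℝ) + 1) ≤ C := fun n => div_le_self hC0 (hR n)
  have hlim : Tendsto (fun n : ℕ => C / ((n : ℝ) + 1)) atTop (𝓝 0) := by
    have := (tendsto_one_div_add_atTop_nhds_zero_nat (𝕜 := ℝ)).const_mul C
    simpa [mul_one_div, div_eq_mul_inv] using this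
  have l0 : ∀ z, Tendsto (fun n => (ψ n z : ℂ)) atTop (𝓝 1) := fun z => by
    refine tendsto_const_nhds.congr' ?_
    filter_upwards [eventually_ge_atTop ⌈|z|⌉₊] with n hn
    rw [hψin n z (by
      rw [sub_zero]
      have : |z| ≤ n := (Nat.le_ceil _).trans (by exact_mod_cast hn)
      linarith), Complex.ofReal_one]
  have l1 : ∀ z, Tendsto (fun n => (ψ₁ n z : ℂ)) atTop (𝓝 0) := fun z =>
    squeeze_zero_norm (fun n => by rw [Complex.norm_real]; exact hψb₁ n z) hlim
  have l2 : ∀ z, Tendsto (fun n => (ψ₂ n z : ℂ)) atTop (𝓝 0) := fun z =>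
    squeeze_zero_norm (fun n => by rw [Complex.norm_real]; exact hψb₂ n z) hlim
  have cofReal := Complex.continuous_ofReal
  have cus : ∀ s, Continuous (u s) := fun s => h.cont.comp (Continuous.prodMk_right s)
  have cfs : ∀ s, Continuous (f s) := fun s => h.cont_force.comp (Continuous.prodMk_right s)
  have cψ : ∀ n, Continuous (ψ n) := fun n => (hψ n).cont
  have cψ₁ : ∀ n, Continuous (ψ₁ n) := fun n => (hψ n).cont₁
  have cψ₂ : ∀ n, Continuous (ψ₂ n) := fun n => (hψ n).cont₂
  have b0 : ∀ n, ∀ s ∈ Icc t₀ t₁, ∀ z, ‖(ψ n z : ℂ) * u s z‖ ≤ M := fun n s hs z => by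
    rw [norm_mul, Complex.norm_real, Real.norm_eq_abs]
    calc _ ≤ 1 * M := by gcongr; exacts [habs n z, hM s hs z]
      _ = M := one_mul M
  have b1 : ∀ n, ∀ s ∈ Icc t₀ t₁, ∀ z, ‖(ψ₁ n z : ℂ) * u s z‖ ≤ C * M := fun n s hs z => by
    rw [norm_mul, Complex.norm_real, Real.norm_eq_abs]
    gcongr
    exacts [(hψb₁ n z).trans (hCR n), hM s hs z]
  have b2 : ∀ n, ∀ s ∈ Icc t₀ t₁, ∀ z, ‖(ψ n z : ℂ) * f s z + a * (ψ₂ n z * u s z)‖ ≤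
      N + ‖a‖ * (C * M) := fun n s hs z => by
    refine (norm_add_le _ _).trans ?_
    rw [norm_mul, norm_mul, norm_mul, Complex.norm_real, Complex.norm_real, Real.norm_eq_abs,
      Real.norm_eq_abs]
    refine add_le_add ?_ ?_
    · calc _ ≤ 1 * N := by gcongr; exacts [habs n z, hN s hs z]
        _ = N := one_mul N
    · gcongr
      exacts [(hψb₂ n z).trans (hCR n), hM s hs z]
  have lhs : Tendsto (fun n => (ψ n x : ℂ) * u t₁ x) atTop (𝓝 (u t₁ x)) := by
    simpa using (l0 x).mul_const (u t₁ x)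
  have rhs1 : Tendsto (fun n => gconv (heatK a) (t₁ - t₀) (fun z => ψ n z * u t₀ z) x) atTop
      (𝓝 (gconv (heatK a) (t₁ - t₀) (u t₀) x)) := by
    refine tendsto_gconv (decays_heatK ha) _ _ (fun n => ?_) (fun n => b0 n t₀ ⟨le_rfl, h01⟩)
      fun z => ?_
    · have := cus t₀; have := cψ n; fun_prop
    · simpa using (l0 z).mul_const (u t₀ z)
  have rhs2 : Tendsto (fun n => ∫ s in t₀..t₁, cutoffForce a (ψ n) (ψ₁ n) (ψ₂ n) f u t₁ x s) atTop
      (𝓝 (∫ s in t₀..t₁, gconv (heatK a) (t₁ - s) (f s) x)) := by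
    refine intervalIntegral.tendsto_integral_filter_of_dominated_convergence
      (fun s => mass (heatK a) * (N + ‖a‖ * (C * M)) +
        2 * ‖a‖ * ((√(t₁ - s))⁻¹ * (mass (heatK₁ a) * (C * M))))
      (Eventually.of_forall fun n => ?_) (Eventually.of_forall fun n => ?_) ?_ ?_
    · rw [uIoc_of_le h01]
      exact (h.intervalIntegrable_cutoffForce ha h01 (hψ n) x).1.aestronglyMeasurable
    · rw [uIoc_of_le h01]
      refine ae_of_all _ fun s hs => ?_
      exact norm_cutoffForce_le ha (b2 n s (Ioc_subset_Icc_self hs))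
        (b1 n s (Ioc_subset_Icc_self hs))
    · exact (intervalIntegrable_const).add
        (((intervalIntegrable_inv_sqrt_sub _ _ _).mul_const _).const_mul _)
    · rw [uIoc_of_le h01]
      refine ae_of_all _ fun s hs => ?_
      have hs' := Ioc_subset_Icc_self hs
      have r1 : Tendsto (fun n => gconv (heatK a) (t₁ - s)
          (fun z => (ψ n z : ℂ) * f s z + a * (ψ₂ n z * u s z)) x) atTop
          (𝓝 (gconv (heatK a) (t₁ - s) (f s) x)) := by
        refine tendsto_gconv (decays_heatK ha) _ _ (fun n => ?_) (fun n => b2 n s hs') fun z => ?_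
        · have := cus s; have := cfs s; have := cψ n; have := cψ₂ n; fun_prop
        · simpa using ((l0 z).mul_const (f s z)).add (((l2 z).mul_const (u s z)).const_mul a)
      have r2 : Tendsto (fun n => gconv (heatK₁ a) (t₁ - s) (fun z => (ψ₁ n z : ℂ) * u s z) x)
          atTop (𝓝 (gconv (heatK₁ a) (t₁ - s) (fun _ => 0) x)) := by
        refine tendsto_gconv (decays_heatK₁ ha) _ _ (fun n => ?_) (fun n => b1 n s hs') fun z => ?_
        · have := cus s; have := cψ₁ n; fun_prop
        · simpa using (l1 z).mul_const (u s z)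
      have r3 : gconv (heatK₁ a) (t₁ - s) (fun _ => 0) x = 0 := by simp [gconv]
      rw [r3] at r2
      simpa [cutoffForce] using r1.sub ((r2.const_mul (((√(t₁ - s))⁻¹ : ℝ) : ℂ)).const_mul (2 * a))
  refine tendsto_nhds_unique lhs ?_
  refine (rhs1.add rhs2).congr fun n => ?_
  exact (h.cutoff_formula ha h01 (hψ n) x).symm

/-! ### Weighted local energy estimates. -/

/-- The integrable weight used in the local energy estimates. -/
noncomputable def wt (ε x₀ x : ℝ) : ℝ := (1 + (ε * (x - x₀)) ^ 2)⁻¹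

/-- The derivative of `wt`. -/
noncomputable def wt₁ (ε x₀ x : ℝ) : ℝ := -(2 * (ε * (x - x₀)) * ε) * wt ε x₀ x ^ 2

lemma wt_pos (ε x₀ x : ℝ) : 0 < wt ε x₀ x := by unfold wt; positivity

lemma continuous_wt (ε x₀ : ℝ) : Continuous (wt ε x₀) := by
  unfold wt
  exact Continuous.inv₀ (by fun_prop) fun x => by positivity

lemma continuous_wt₁ (ε x₀ : ℝ) : Continuous (wt₁ ε x₀) := by
  have := continuous_wt ε x₀
  unfold wt₁
  fun_prop

lemma hasDerivAt_wt (ε x₀ x : ℝ) : HasDerivAt (wt ε x₀) (wt₁ ε x₀ x) x := by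
  have h1 : HasDerivAt (fun x => 1 + (ε * (x - x₀)) ^ 2) (2 * (ε * (x - x₀)) * ε) x := by
    have := ((((hasDerivAt_id x).sub_const x₀).const_mul ε).pow 2).const_add 1
    simpa using this
  refine (h1.inv (by positivity)).congr_deriv ?_
  unfold wt₁ wt
  field_simp

/-- Because 2|y| ≤ 1 + y². The weight varies slowly, at relative rate at most ε, so for small ε its
commutator with the diffusion is absorbed by dissipation and damping. -/
lemma abs_wt₁_le {ε : ℝ} (hε : 0 < ε) (x₀ x : ℝ) : |wt₁ ε x₀ x| ≤ ε * wt ε x₀ x := by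
  have hw := wt_pos ε x₀ x
  have h1 : |2 * (ε * (x - x₀))| * wt ε x₀ x ≤ 1 := by
    unfold wt
    rw [← div_eq_mul_inv, div_le_one (by positivity), abs_le]
    constructor <;> nlinarith [sq_nonneg (ε * (x - x₀) - 1), sq_nonneg (ε * (x - x₀) + 1)]
  rw [wt₁, abs_mul, abs_neg, abs_mul, abs_of_pos hε, abs_of_nonneg (sq_nonneg (wt ε x₀ x))]
  calc _ = (|2 * (ε * (x - x₀))| * wt ε x₀ x) * (ε * wt ε x₀ x) := by ring
    _ ≤ 1 * (ε * wt ε x₀ x) := by gcongr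
    _ = _ := one_mul _

lemma integrable_wt {ε : ℝ} (hε : 0 < ε) (x₀ : ℝ) : Integrable (wt ε x₀) := by
  have h1 := (integrable_inv_one_add_sq.comp_mul_left' hε.ne').comp_sub_right x₀
  exact h1

lemma integral_wt (ε x₀ : ℝ) : ∫ x, wt ε x₀ x = ∫ x, wt ε 0 x := by
  have := integral_sub_right_eq_self (μ := volume) (wt ε 0) x₀
  rw [← this]
  congr 1; ext x; simp [wt]

lemma tendsto_wt {ε : ℝ} (hε : 0 < ε) (x₀ : ℝ) : Tendsto (wt ε x₀) (cocompact ℝ) (𝓝 0) := by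
  have h1 : Tendsto (fun x : ℝ => ‖x‖) (cocompact ℝ) atTop := tendsto_norm_cocompact_atTop
  have h2 : Tendsto (fun x : ℝ => 1 + (ε * (x - x₀)) ^ 2) (cocompact ℝ) atTop := by
    have h3 : Tendsto (fun x : ℝ => ε * (‖x‖ + -‖x₀‖)) (cocompact ℝ) atTop :=
      (tendsto_atTop_add_const_right _ _ h1).const_mul_atTop hε
    refine tendsto_atTop_mono (fun x => ?_) h3
    have h4 := norm_sub_norm_le x x₀
    have h5 : ε * (‖x‖ + -‖x₀‖) ≤ |ε * (x - x₀)| := by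
      rw [abs_mul, abs_of_pos hε, ← Real.norm_eq_abs (x - x₀)]
      gcongr; linarith
    nlinarith [sq_abs (ε * (x - x₀)), abs_nonneg (ε * (x - x₀)),
      sq_nonneg (|ε * (x - x₀)| - 1)]
  exact h2.inv_tendsto_atTop

lemma integrable_wt_mul {ε : ℝ} (hε : 0 < ε) (x₀ : ℝ) {h : ℝ → ℝ} (hc : Continuous h) {M : ℝ}
    (hM : ∀ x, |h x| ≤ M) : Integrable (fun x => wt ε x₀ x * h x) := by
  have hw := continuous_wt ε x₀
  refine ((integrable_wt hε x₀).mul_const M).mono' (Continuous.aestronglyMeasurable (by fun_prop))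
    (ae_of_all _ fun x => ?_)
  rw [norm_mul, Real.norm_of_nonneg (wt_pos _ _ _).le]
  have := (wt_pos ε x₀ x).le
  gcongr
  exact hM x

lemma tendsto_wt_mul {ε : ℝ} (hε : 0 < ε) (x₀ : ℝ) {h : ℝ → ℝ} {M : ℝ} (hM : ∀ x, |h x| ≤ M) :
    Tendsto (fun x => wt ε x₀ x * h x) (cocompact ℝ) (𝓝 0) := by
  have h1 := (tendsto_wt hε x₀).mul_const M
  rw [zero_mul] at h1
  refine squeeze_zero_norm (fun x => ?_) h1
  rw [norm_mul, Real.norm_of_nonneg (wt_pos _ _ _).le]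
  have := (wt_pos ε x₀ x).le
  gcongr
  exact hM x

/-- Local energy of `v` around `x₀`. -/
noncomputable def locEnergy (ε x₀ : ℝ) (v : ℝ → ℂ) : ℝ := ∫ x, wt ε x₀ x * ‖v x‖ ^ 2

lemma locEnergy_nonneg (ε x₀ : ℝ) (v : ℝ → ℂ) : 0 ≤ locEnergy ε x₀ v :=
  integral_nonneg fun _ => mul_nonneg (wt_pos _ _ _).le (sq_nonneg _)

lemma locEnergy_le {ε : ℝ} (hε : 0 < ε) (x₀ : ℝ) {v : ℝ → ℂ} (hv : Continuous v) {M : ℝ}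
    (hM : ∀ x, ‖v x‖ ≤ M) : locEnergy ε x₀ v ≤ (∫ x, wt ε 0 x) * M ^ 2 := by
  rw [← integral_wt ε x₀, ← integral_mul_const]
  refine integral_mono (integrable_wt_mul hε x₀ (h := fun x => ‖v x‖ ^ 2) (by fun_prop)
    (M := M ^ 2) fun _ => ?_) ((integrable_wt hε x₀).mul_const _) fun x => ?_
  · rw [abs_of_nonneg (sq_nonneg _)]; gcongr; exact hM _
  · have := (wt_pos ε x₀ x).le
    simp only
    gcongr; exact hM x

/-- Local `H¹ ⊂ L^∞` interpolation. -/
lemma norm_pow_four_le {ε : ℝ} (hε : 0 < ε) (hε2 : ε ≤ 1 / 2) (x₀ : ℝ) {v v' : ℝ → ℂ}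
    (hd : ∀ x, HasDerivAt v (v' x) x) (hv' : Continuous v') {M M' : ℝ} (hM : ∀ x, ‖v x‖ ≤ M)
    (hM' : ∀ x, ‖v' x‖ ≤ M') {x : ℝ} (hx : |x - x₀| ≤ 2) :
    ‖v x‖ ^ 4 ≤ 9 * (1 + locEnergy ε x₀ v) ^ 2 * (1 + locEnergy ε x₀ v') := by
  set Y := locEnergy ε x₀ v with hY
  set D := locEnergy ε x₀ v' with hD
  have hY0 : 0 ≤ Y := locEnergy_nonneg _ _ _
  have hD0 : 0 ≤ D := locEnergy_nonneg _ _ _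
  have hv : Continuous v := continuous_iff_continuousAt.2 fun z => (hd z).continuousAt
  have hw := continuous_wt ε x₀
  have hw₁ := continuous_wt₁ ε x₀
  -- S is the Young parameter in 2|v||v'| ≤ S|v|² + S⁻¹|v'|². With this choice |v|² ≤ 3 (1 + Y) S,
  -- and squaring leaves D to the first power only, the one that the energy estimate controls in
  -- time.
  set S := √(1 + D) with hS
  have hS2 : S ^ 2 = 1 + D := Real.sq_sqrt (by linarith)
  have hS1 : 1 ≤ S := Real.one_le_sqrt.2 (by linarith)
  have i1 : Integrable (fun x => wt ε x₀ x * ‖v x‖ ^ 2) :=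
    integrable_wt_mul hε x₀ (h := fun x => ‖v x‖ ^ 2) (by fun_prop) (M := M ^ 2) fun x => by
      rw [abs_of_nonneg (sq_nonneg _)]; gcongr; exact hM x
  have i2 : Integrable (fun x => wt ε x₀ x * ‖v' x‖ ^ 2) :=
    integrable_wt_mul hε x₀ (h := fun x => ‖v' x‖ ^ 2) (by fun_prop) (M := M' ^ 2) fun x => by
      rw [abs_of_nonneg (sq_nonneg _)]; gcongr; exact hM' x
  set B : ℝ → ℝ := fun y => (1 / 2 + S) * (wt ε x₀ y * ‖v y‖ ^ 2) +
    S⁻¹ * (wt ε x₀ y * ‖v' y‖ ^ 2) with hB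
  have iB : Integrable B := (i1.const_mul _).add (i2.const_mul _)
  have dE : ∀ y, HasDerivAt (fun y => wt ε x₀ y * ‖v y‖ ^ 2)
      (wt₁ ε x₀ y * ‖v y‖ ^ 2 + wt ε x₀ y * (2 * inner ℝ (v y) (v' y))) y := fun y =>
    (hasDerivAt_wt ε x₀ y).mul (hd y).norm_sq
  have hbd : ∀ y, |wt₁ ε x₀ y * ‖v y‖ ^ 2 + wt ε x₀ y * (2 * inner ℝ (v y) (v' y))| ≤ B y := by
    intro y
    have hw0 := (wt_pos ε x₀ y).le
    have h1 := abs_wt₁_le hε x₀ y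
    have h2 : |(inner ℝ (v y) (v' y) : ℝ)| ≤ ‖v y‖ * ‖v' y‖ := abs_real_inner_le_norm _ _
    have h3 : 2 * (‖v y‖ * ‖v' y‖) ≤ S * ‖v y‖ ^ 2 + S⁻¹ * ‖v' y‖ ^ 2 := by
      have h4 : 0 ≤ S⁻¹ * (S * ‖v y‖ - ‖v' y‖) ^ 2 := by positivity
      have h5 : S⁻¹ * (S * ‖v y‖ - ‖v' y‖) ^ 2 =
          S * ‖v y‖ ^ 2 + S⁻¹ * ‖v' y‖ ^ 2 - 2 * (‖v y‖ * ‖v' y‖) := by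
        field_simp; ring
      linarith
    calc _ ≤ |wt₁ ε x₀ y| * ‖v y‖ ^ 2 + wt ε x₀ y * (2 * |(inner ℝ (v y) (v' y) : ℝ)|) := by
          refine (abs_add_le _ _).trans (le_of_eq ?_)
          rw [abs_mul, abs_mul, abs_mul, abs_of_nonneg hw0, abs_of_nonneg (sq_nonneg ‖v y‖), abs_two]
      _ ≤ (1 / 2 * wt ε x₀ y) * ‖v y‖ ^ 2 +
          wt ε x₀ y * (S * ‖v y‖ ^ 2 + S⁻¹ * ‖v' y‖ ^ 2) := by
          gcongr
          · exact h1.trans (by gcongr)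
          · linarith
      _ = B y := by simp only [hB]; ring
  have iE : Integrable (fun y => wt₁ ε x₀ y * ‖v y‖ ^ 2 +
      wt ε x₀ y * (2 * inner ℝ (v y) (v' y))) :=
    iB.mono' (Continuous.aestronglyMeasurable (by fun_prop)) (ae_of_all _ fun y => hbd y)
  have ht : Tendsto (fun y => wt ε x₀ y * ‖v y‖ ^ 2) atBot (𝓝 0) :=
    (tendsto_wt_mul hε x₀ (h := fun x => ‖v x‖ ^ 2) (M := M ^ 2) fun x => by
      rw [abs_of_nonneg (sq_nonneg _)]; gcongr; exact hM x).mono_left atBot_le_cocompact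
  -- The weighted square vanishes at -∞, so its value at x is the integral of its derivative over
  -- (-∞, x].
  have hF := integral_Iic_of_hasDerivAt_of_tendsto' (a := x) (fun y _ => dE y) iE.integrableOn ht
  rw [sub_zero] at hF
  have h1 : wt ε x₀ x * ‖v x‖ ^ 2 ≤ (1 / 2 + S) * Y + S⁻¹ * D := by
    rw [← hF]
    calc _ ≤ ∫ y in Iic x, B y :=
          integral_mono iE.integrableOn iB.integrableOn fun y => (le_abs_self _).trans (hbd y)
      _ ≤ ∫ y, B y := setIntegral_le_integral iB (ae_of_all _ fun y => (abs_nonneg _).trans (hbd y))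
      _ = _ := by
        simp only [hB]
        rw [integral_add (i1.const_mul _) (i2.const_mul _), integral_const_mul, integral_const_mul]
        rfl
  have h2 : S⁻¹ * D ≤ S := by
    rw [inv_mul_le_iff₀ (by linarith)]; nlinarith
  have h3 : (1 / 2 : ℝ) ≤ wt ε x₀ x := by
    unfold wt
    rw [one_div]
    have h4 : |ε * (x - x₀)| ≤ 1 := by
      rw [abs_mul, abs_of_pos hε]
      calc ε * |x - x₀| ≤ 1 / 2 * 2 := by gcongr
        _ = 1 := by norm_num
    have h5 : (ε * (x - x₀)) ^ 2 ≤ 1 := by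
      rw [← sq_abs]; exact pow_le_one₀ (abs_nonneg _) h4
    gcongr
    linarith
  have h6 : ‖v x‖ ^ 2 ≤ 3 * (1 + Y) * S := by
    have h7 : 1 / 2 * ‖v x‖ ^ 2 ≤ wt ε x₀ x * ‖v x‖ ^ 2 := by gcongr
    nlinarith
  calc ‖v x‖ ^ 4 = (‖v x‖ ^ 2) ^ 2 := by ring
    _ ≤ (3 * (1 + Y) * S) ^ 2 := by gcongr
    _ = 9 * (1 + Y) ^ 2 * S ^ 2 := by ring
    _ = _ := by rw [hS2]

/-- The structural hypotheses on the nonlinearity that the a priori estimates use. -/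
structure DissipativeForce (C : ℝ) (F : ℂ → ℂ) : Prop where
  cont : Continuous F
  re_le : ∀ w, inner ℝ w (F w) ≤ C - ‖w‖ ^ 2 / 2
  growth : ∀ w, ‖F w‖ ≤ C * (1 + ‖w‖ ^ 5)

lemma DissipativeForce.const_nonneg {C : ℝ} {F : ℂ → ℂ} (hF : DissipativeForce C F) : 0 ≤ C := by
  simpa using (norm_nonneg _).trans (hF.growth 0)

section Sections

variable {a : ℂ} {F : ℂ → ℂ} {u ux uxx : ℝ → ℝ → ℂ}

lemma IsRegular.continuous_sec (h : IsRegular a F u ux uxx) (t : ℝ) : Continuous (u t) :=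
  h.cont.comp (Continuous.prodMk_right t)

lemma IsRegular.continuous_ux (h : IsRegular a F u ux uxx) {t : ℝ} (ht : 0 < t) :
    Continuous (ux t) :=
  continuous_iff_continuousAt.2 fun z => (h.dxx t ht z).continuousAt

lemma IsRegular.continuous_uxx (h : IsRegular a F u ux uxx) {t : ℝ} (ht : 0 < t) :
    Continuous (uxx t) := by
  rw [← continuousOn_univ]
  exact h.cont_uxx.comp (Continuous.prodMk_right t).continuousOn fun z _ => ⟨ht, trivial⟩

end Sections

lemma continuousOn_locEnergy {ε : ℝ} (hε : 0 < ε) (x₀ : ℝ) {v : ℝ → ℝ → ℂ}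
    (hv : ContinuousOn (Function.uncurry v) (Ioi 0 ×ˢ univ))
    (hb : ∀ t₀ T, 0 < t₀ → ∃ M, ∀ t ∈ Icc t₀ T, ∀ x, ‖v t x‖ ≤ M) :
    ContinuousOn (fun t => locEnergy ε x₀ (v t)) (Ioi 0) := by
  intro t ht
  have ht : 0 < t := ht
  obtain ⟨M, hM⟩ := hb (t / 2) (2 * t) (by positivity)
  have hev : ∀ᶠ s in 𝓝 t, s ∈ Icc (t / 2) (2 * t) := Icc_mem_nhds (by linarith) (by linarith)
  have hw := continuous_wt ε x₀
  refine ContinuousAt.continuousWithinAt (continuousAt_of_dominated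
    (bound := fun x => wt ε x₀ x * M ^ 2) ?_ ?_ ((integrable_wt hε x₀).mul_const _)
    (ae_of_all _ fun x => ?_))
  · filter_upwards [hev] with s hs
    have : Continuous (v s) := by
      rw [← continuousOn_univ]
      exact hv.comp (Continuous.prodMk_right s).continuousOn
        fun z _ => ⟨(by linarith [hs.1] : 0 < s), trivial⟩
    exact Continuous.aestronglyMeasurable (by fun_prop)
  · filter_upwards [hev] with s hs
    refine ae_of_all _ fun x => ?_
    have := (wt_pos ε x₀ x).le
    rw [norm_mul, Real.norm_of_nonneg this, norm_pow, norm_norm]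
    gcongr
    exact hM s hs x
  · have h1 : ContinuousAt (fun s => v s x) t := ContinuousAt.comp (f := fun s => (s, x))
      (hv.continuousAt (isOpen_Ioi_prod.mem_nhds ⟨ht, trivial⟩))
      (Continuous.prodMk_left x).continuousAt
    exact continuousAt_const.mul (h1.norm.pow 2)

lemma IsRegular.continuousOn_energy {a : ℂ} {F : ℂ → ℂ} {u ux uxx : ℝ → ℝ → ℂ}
    (h : IsRegular a F u ux uxx) {ε : ℝ} (hε : 0 < ε) (x₀ : ℝ) :
    ContinuousOn (fun t => locEnergy ε x₀ (u t)) (Ici 0) := by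
  intro t ht
  obtain ⟨M, hM⟩ := h.bdd (t + 1)
  have hw := continuous_wt ε x₀
  have hev : ∀ᶠ s in 𝓝[Ici 0] t, s ∈ Icc 0 (t + 1) := by
    filter_upwards [self_mem_nhdsWithin, mem_nhdsWithin_of_mem_nhds
      (Iic_mem_nhds (by linarith : t < t + 1))] with s h1 h2 using ⟨h1, h2⟩
  refine continuousWithinAt_of_dominated (bound := fun x => wt ε x₀ x * M ^ 2) ?_ ?_
    ((integrable_wt hε x₀).mul_const _) (ae_of_all _ fun x => ?_)
  · filter_upwards with s
    have := h.continuous_sec s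
    exact Continuous.aestronglyMeasurable (by fun_prop)
  · filter_upwards [hev] with s hs
    refine ae_of_all _ fun x => ?_
    have := (wt_pos ε x₀ x).le
    rw [norm_mul, Real.norm_of_nonneg this, norm_pow, norm_norm]
    gcongr
    exact hM s hs x
  · have h1 : Continuous (fun s => u s x) := h.cont.comp (Continuous.prodMk_left x)
    exact Continuous.continuousWithinAt (by fun_prop)

lemma inner_mul_self_eq (a w : ℂ) : inner ℝ w (a * w) = a.re * ‖w‖ ^ 2 := by
  rw [Complex.inner, ← Complex.normSq_eq_norm_sq, Complex.normSq_apply]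
  simp only [Complex.mul_re, Complex.conj_re, Complex.conj_im, Complex.mul_im]
  ring

lemma abs_inner_mul_le (a w z : ℂ) : |inner ℝ w (a * z)| ≤ ‖a‖ * (‖w‖ * ‖z‖) := by
  refine (abs_real_inner_le_norm _ _).trans (le_of_eq ?_)
  rw [norm_mul]; ring

/-- The local energy inequality. -/
lemma IsRegular.energy_deriv {a : ℂ} (ha : a.re = 1) {C : ℝ} {F : ℂ → ℂ}
    (hF : DissipativeForce C F) {u ux uxx : ℝ → ℝ → ℂ} (h : IsRegular a F u ux uxx) {ε : ℝ}
    (hε : 0 < ε) (hεa : ε * ‖a‖ ≤ 1 / 2) (x₀ : ℝ) {t : ℝ} (ht : 0 < t) :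
    ∃ Y', HasDerivAt (fun t => locEnergy ε x₀ (u t)) Y' t ∧
      Y' ≤ -locEnergy ε x₀ (ux t) - locEnergy ε x₀ (u t) / 2 + 2 * C * ∫ x, wt ε 0 x := by
  have hFc := hF.cont
  have hC := hF.const_nonneg
  have hw := continuous_wt ε x₀
  have hw₁ := continuous_wt₁ ε x₀
  have cu := h.continuous_sec t
  have cux := h.continuous_ux ht
  have cuxx := h.continuous_uxx ht
  obtain ⟨M, hM⟩ := h.bdd (2 * t)
  obtain ⟨M₁, hM₁⟩ := h.bdd_ux (t / 2) (2 * t) (by positivity)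
  obtain ⟨M₂, hM₂⟩ := h.bdd_uxx (t / 2) (2 * t) (by positivity)
  have htm : t ∈ Icc (t / 2) (2 * t) := ⟨by linarith, by linarith⟩
  have hM' : ∀ s ∈ Icc (t / 2) (2 * t), ∀ x, ‖u s x‖ ≤ M := fun s hs =>
    hM s ⟨by linarith [hs.1], hs.2⟩
  have hM0 : 0 ≤ M := (norm_nonneg _).trans (hM' t htm 0)
  have hM₁0 : 0 ≤ M₁ := (norm_nonneg _).trans (hM₁ t htm 0)
  have hFM : ∀ s ∈ Icc (t / 2) (2 * t), ∀ x, ‖F (u s x)‖ ≤ C * (1 + M ^ 5) := fun s hs x => by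
    refine (hF.growth _).trans ?_
    gcongr
    exact hM' s hs x
  have sqb : ∀ x, |‖u t x‖ ^ 2| ≤ M ^ 2 := fun x => by
    rw [abs_of_nonneg (sq_nonneg _)]; gcongr; exact hM' t htm x
  have sqb₁ : ∀ x, |‖ux t x‖ ^ 2| ≤ M₁ ^ 2 := fun x => by
    rw [abs_of_nonneg (sq_nonneg _)]; gcongr; exact hM₁ t htm x
  have i0 : Integrable (fun x => wt ε x₀ x * ‖u t x‖ ^ 2) :=
    integrable_wt_mul hε x₀ (h := fun x => ‖u t x‖ ^ 2) (by fun_prop) sqb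
  have i1 : Integrable (fun x => wt ε x₀ x * ‖ux t x‖ ^ 2) :=
    integrable_wt_mul hε x₀ (h := fun x => ‖ux t x‖ ^ 2) (by fun_prop) sqb₁
  have hder := hasDerivAt_integral_of_dominated_loc_of_deriv_le (μ := volume)
    (F := fun s x => wt ε x₀ x * ‖u s x‖ ^ 2)
    (F' := fun s x => wt ε x₀ x * (2 * inner ℝ (u s x) (a * uxx s x + F (u s x))))
    (bound := fun x => wt ε x₀ x * (2 * (M * (‖a‖ * M₂ + C * (1 + M ^ 5)))))
    (Icc_mem_nhds (by linarith : t / 2 < t) (by linarith : t < 2 * t))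
    (Eventually.of_forall fun s => by
      have := h.continuous_sec s
      exact Continuous.aestronglyMeasurable (by fun_prop)) i0
    (Continuous.aestronglyMeasurable (by fun_prop))
    (ae_of_all _ fun x s hs => by
      have := (wt_pos ε x₀ x).le
      rw [norm_mul, Real.norm_of_nonneg this, norm_mul, Real.norm_ofNat]
      gcongr
      refine (norm_inner_le_norm _ _).trans ?_
      gcongr
      · exact hM' s hs x
      · refine (norm_add_le _ _).trans ?_
        rw [norm_mul]
        gcongr
        exacts [hM₂ s hs x, hFM s hs x])
    ((integrable_wt hε x₀).mul_const _)
    (ae_of_all _ fun x s hs =>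
      ((h.dt s (by linarith [hs.1]) x).norm_sq).const_mul _)
  refine ⟨_, hder.2, ?_⟩
  -- P' is the derivative of the flux wt · 2 Re(ū a u_x), which vanishes at ±∞; its zero integral is
  -- the integration by parts.
  set P' : ℝ → ℝ := fun x => wt₁ ε x₀ x * (2 * inner ℝ (u t x) (a * ux t x)) +
    wt ε x₀ x * (2 * (inner ℝ (u t x) (a * uxx t x) + inner ℝ (ux t x) (a * ux t x))) with hP'
  have dP : ∀ x, HasDerivAt (fun x => wt ε x₀ x * (2 * inner ℝ (u t x) (a * ux t x)))
      (P' x) x := fun x =>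
    (hasDerivAt_wt ε x₀ x).mul (((h.dx t ht x).inner ℝ ((h.dxx t ht x).const_mul a)).const_mul 2)
  have iP : Integrable P' := by
    refine ((integrable_wt hε x₀).mul_const (ε * (2 * (‖a‖ * (M * M₁))) +
      2 * (‖a‖ * (M * M₂) + ‖a‖ * (M₁ * M₁)))).mono'
      (Continuous.aestronglyMeasurable (by fun_prop)) (ae_of_all _ fun x => ?_)
    have hw0 := (wt_pos ε x₀ x).le
    have b1 := hM' t htm x
    have b2 := hM₁ t htm x
    have b3 := hM₂ t htm x
    have k1 : |inner ℝ (u t x) (a * ux t x)| ≤ ‖a‖ * (M * M₁) :=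
      (abs_inner_mul_le _ _ _).trans (by gcongr)
    have k2 : |inner ℝ (u t x) (a * uxx t x)| ≤ ‖a‖ * (M * M₂) :=
      (abs_inner_mul_le _ _ _).trans (by gcongr)
    have k3 : |inner ℝ (ux t x) (a * ux t x)| ≤ ‖a‖ * (M₁ * M₁) :=
      (abs_inner_mul_le _ _ _).trans (by gcongr)
    calc ‖P' x‖ ≤ |wt₁ ε x₀ x| * (2 * |inner ℝ (u t x) (a * ux t x)|) + wt ε x₀ x *
          (2 * (|inner ℝ (u t x) (a * uxx t x)| + |inner ℝ (ux t x) (a * ux t x)|)) := by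
          refine (norm_add_le _ _).trans ?_
          rw [norm_mul, norm_mul, norm_mul, norm_mul, Real.norm_of_nonneg hw0, Real.norm_ofNat]
          simp only [Real.norm_eq_abs]
          gcongr
          exact abs_add_le _ _
      _ ≤ (ε * wt ε x₀ x) * (2 * (‖a‖ * (M * M₁))) + wt ε x₀ x *
          (2 * (‖a‖ * (M * M₂) + ‖a‖ * (M₁ * M₁))) := by
          gcongr
          exact abs_wt₁_le hε x₀ x
      _ = _ := by ring
  have hbd : ∀ x, |2 * inner ℝ (u t x) (a * ux t x)| ≤ 2 * (‖a‖ * (M * M₁)) := fun x => by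
    rw [abs_mul, abs_two]
    gcongr
    refine (abs_inner_mul_le _ _ _).trans ?_
    have b1 := hM' t htm x
    have b2 := hM₁ t htm x
    gcongr
  have hlim := tendsto_wt_mul hε x₀ hbd
  have hzero : ∫ x, P' x = 0 := by
    rw [integral_of_hasDerivAt_of_tendsto dP iP (hlim.mono_left atBot_le_cocompact)
      (hlim.mono_left atTop_le_cocompact), sub_zero]
  -- Since Re a = 1, the diffusion contributes -2|u_x|². The commutator costs at most |u_x|² +
  -- |u|²/4 because ε‖a‖ ≤ 1/2, and the force contributes 2C - |u|², so -|u_x|² - |u|²/2 survives.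
  have key : ∀ x, wt ε x₀ x * (2 * inner ℝ (u t x) (a * uxx t x + F (u t x))) ≤
      P' x + (-(wt ε x₀ x * ‖ux t x‖ ^ 2) - (wt ε x₀ x * ‖u t x‖ ^ 2) / 2 +
        2 * C * wt ε x₀ x) := fun x => by
    have hw0 := (wt_pos ε x₀ x).le
    have e1 : inner ℝ (ux t x) (a * ux t x) = ‖ux t x‖ ^ 2 := by
      rw [inner_mul_self_eq, ha, one_mul]
    have e2 := hF.re_le (u t x)
    have e3 : -(wt₁ ε x₀ x * (2 * inner ℝ (u t x) (a * ux t x))) ≤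
        wt ε x₀ x * (‖ux t x‖ ^ 2 + ‖u t x‖ ^ 2 / 4) := by
      calc -(wt₁ ε x₀ x * (2 * inner ℝ (u t x) (a * ux t x))) ≤
            |wt₁ ε x₀ x| * (2 * |inner ℝ (u t x) (a * ux t x)|) := by
            refine (neg_le_abs _).trans (le_of_eq ?_)
            rw [abs_mul, abs_mul, abs_two]
        _ ≤ (ε * wt ε x₀ x) * (2 * (‖a‖ * (‖u t x‖ * ‖ux t x‖))) := by
            gcongr
            · exact abs_wt₁_le hε x₀ x
            · exact abs_inner_mul_le _ _ _
        _ = wt ε x₀ x * ((ε * ‖a‖) * (2 * (‖u t x‖ * ‖ux t x‖))) := by ring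
        _ ≤ wt ε x₀ x * ((1 / 2) * (2 * (‖u t x‖ * ‖ux t x‖))) := by gcongr
        _ ≤ wt ε x₀ x * (‖ux t x‖ ^ 2 + ‖u t x‖ ^ 2 / 4) := by
            gcongr
            nlinarith [sq_nonneg (‖ux t x‖ - ‖u t x‖ / 2)]
    have e4 : wt ε x₀ x * (2 * inner ℝ (u t x) (F (u t x))) ≤
        wt ε x₀ x * (2 * (C - ‖u t x‖ ^ 2 / 2)) := by gcongr
    have e5 : 0 ≤ wt ε x₀ x * ‖u t x‖ ^ 2 := by positivity
    simp only [hP', e1, inner_add_right]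
    nlinarith
  have i3 : Integrable (fun x => -(wt ε x₀ x * ‖ux t x‖ ^ 2) - (wt ε x₀ x * ‖u t x‖ ^ 2) / 2 +
        2 * C * wt ε x₀ x) :=
    (i1.neg.sub (i0.div_const 2)).add ((integrable_wt hε x₀).const_mul _)
  refine (integral_mono hder.1 (iP.add i3) key).trans (le_of_eq ?_)
  have s1 := integral_add iP i3
  have s2 := integral_add (i1.neg.sub (i0.div_const 2)) ((integrable_wt hε x₀).const_mul (2 * C))
  have s3 := integral_sub i1.neg (i0.div_const 2)
  simp only [Pi.add_apply, Pi.sub_apply, Pi.neg_apply] at s1 s2 s3 ⊢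
  rw [s1, hzero, s2, s3, integral_neg, integral_div, integral_const_mul, integral_wt ε x₀, zero_add]
  rfl

/-- The energy inequality makes exp(t/2)(Y - 4CA) nonincreasing, where A is the integral of the
weight. The constants do not see x₀. -/
lemma IsRegular.energy_le {a : ℂ} (ha : a.re = 1) {C : ℝ} {F : ℂ → ℂ}
    (hF : DissipativeForce C F) {u ux uxx : ℝ → ℝ → ℂ} (h : IsRegular a F u ux uxx) {ε : ℝ}
    (hε : 0 < ε) (hεa : ε * ‖a‖ ≤ 1 / 2) (x₀ : ℝ) {t : ℝ} (ht : 0 ≤ t) :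
    locEnergy ε x₀ (u t) ≤ Real.exp (-t / 2) * locEnergy ε x₀ (u 0) +
      4 * C * ∫ x, wt ε 0 x := by
  set A := ∫ x, wt ε 0 x with hA
  have hA0 : 0 ≤ A := integral_nonneg fun x => (wt_pos _ _ _).le
  have hC := hF.const_nonneg
  have hanti : AntitoneOn (fun t => Real.exp (t / 2) * (locEnergy ε x₀ (u t) - 4 * C * A))
      (Ici 0) := by
    have hd : ∀ t ∈ Ioi (0 : ℝ), ∃ Z', HasDerivAt
        (fun t => Real.exp (t / 2) * (locEnergy ε x₀ (u t) - 4 * C * A)) Z' t ∧ Z' ≤ 0 := by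
      intro t ht
      obtain ⟨Y', h1, h2⟩ := h.energy_deriv ha hF hε hεa x₀ ht
      have h3 : HasDerivAt (fun t : ℝ => Real.exp (t / 2)) (Real.exp (t / 2) * (1 / 2)) t :=
        ((hasDerivAt_id t).div_const 2).exp
      refine ⟨_, h3.mul (h1.sub_const (4 * C * A)), ?_⟩
      have h4 := locEnergy_nonneg ε x₀ (ux t)
      have h5 := Real.exp_pos (t / 2)
      have h6 : Y' + (locEnergy ε x₀ (u t) - 4 * C * A) / 2 ≤ 0 := by linarith
      nlinarith
    refine antitoneOn_of_deriv_nonpos (convex_Ici 0) ?_ ?_ ?_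
    · exact ContinuousOn.mul (by fun_prop) ((h.continuousOn_energy hε x₀).sub continuousOn_const)
    · rw [interior_Ici]
      intro t ht
      obtain ⟨Z', h1, -⟩ := hd t ht
      exact h1.differentiableAt.differentiableWithinAt
    · rw [interior_Ici]
      intro t ht
      obtain ⟨Z', h1, h2⟩ := hd t ht
      rw [h1.deriv]; exact h2
  have h1 := hanti (mem_Ici.2 le_rfl) (mem_Ici.2 ht) ht
  simp only [zero_div, Real.exp_zero, one_mul] at h1
  have h2 : Real.exp (-t / 2) * Real.exp (t / 2) = 1 := by
    rw [← Real.exp_add]; simp [neg_div]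
  have h3 := Real.exp_pos (-t / 2)
  have h4 : locEnergy ε x₀ (u t) - 4 * C * A ≤
      Real.exp (-t / 2) * (locEnergy ε x₀ (u 0) - 4 * C * A) := by
    calc _ = Real.exp (-t / 2) * (Real.exp (t / 2) * (locEnergy ε x₀ (u t) - 4 * C * A)) := by
          rw [← mul_assoc, h2, one_mul]
      _ ≤ _ := by gcongr
  have h5 : 0 ≤ Real.exp (-t / 2) * (4 * C * A) := by positivity
  linarith

/-- The energy inequality integrated in time, with the damping and the final energy dropped. -/
lemma IsRegular.integral_dissipation_le {a : ℂ} (ha : a.re = 1) {C : ℝ} {F : ℂ → ℂ}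
    (hF : DissipativeForce C F) {u ux uxx : ℝ → ℝ → ℂ} (h : IsRegular a F u ux uxx) {ε : ℝ}
    (hε : 0 < ε) (hεa : ε * ‖a‖ ≤ 1 / 2) (x₀ : ℝ) {s t : ℝ} (hs : 0 < s) (hst : s ≤ t) :
    ∫ r in s..t, locEnergy ε x₀ (ux r) ≤
      locEnergy ε x₀ (u s) + 2 * C * (∫ x, wt ε 0 x) * (t - s) := by
  set A := ∫ x, wt ε 0 x with hA
  have hD := continuousOn_locEnergy hε x₀ h.cont_ux h.bdd_ux
  have hsub : Icc s t ⊆ Ioi 0 := fun r hr => hs.trans_le hr.1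
  have hDi : IntervalIntegrable (fun r => locEnergy ε x₀ (ux r)) volume s t :=
    ContinuousOn.intervalIntegrable (by rw [uIcc_of_le hst]; exact hD.mono hsub)
  have hφi : IntervalIntegrable (fun r => 2 * C * A - locEnergy ε x₀ (ux r)) volume s t :=
    intervalIntegrable_const.sub hDi
  choose! Y' hY' using fun r (hr : 0 < r) => h.energy_deriv ha hF hε hεa x₀ hr
  have := intervalIntegral.sub_le_integral_of_hasDeriv_right_of_le hst
    ((h.continuousOn_energy hε x₀).mono (hsub.trans Ioi_subset_Ici_self))
    (fun r hr => (hY' r (hs.trans hr.1)).1.hasDerivWithinAt)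
    ((intervalIntegrable_iff_integrableOn_Icc_of_le hst).1 hφi)
    (fun r hr => by
      have h1 := (hY' r (hs.trans hr.1)).2
      have h2 := locEnergy_nonneg ε x₀ (u r)
      linarith)
  rw [intervalIntegral.integral_sub intervalIntegrable_const hDi,
    intervalIntegral.integral_const, smul_eq_mul] at this
  have h2 := locEnergy_nonneg ε x₀ (u t)
  linarith

/-! ### A Gronwall lemma by iteration. -/

/-- The integrating factor of the Gronwall lemma. -/
noncomputable def gronwallFactor (g : ℝ → ℝ) (t₀ t : ℝ) : ℝ := Real.exp (2 * ∫ s in t₀..t, g s)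

lemma continuousOn_primitive_Icc {g : ℝ → ℝ} {t₀ t₁ : ℝ} (hg : ContinuousOn g (Icc t₀ t₁)) :
    ContinuousOn (fun t => ∫ s in t₀..t, g s) (Icc t₀ t₁) :=
  intervalIntegral.continuousOn_primitive hg.integrableOn_Icc |>.congr fun t ht => by
    rw [intervalIntegral.integral_of_le ht.1]

lemma continuousOn_gronwallFactor {g : ℝ → ℝ} {t₀ t₁ : ℝ} (hg : ContinuousOn g (Icc t₀ t₁)) :
    ContinuousOn (gronwallFactor g t₀) (Icc t₀ t₁) :=
  Real.continuous_exp.comp_continuousOn (continuousOn_const.mul (continuousOn_primitive_Icc hg))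

/-- The 2 in the exponent gives θ' = 2gθ, hence the factor 1/2 here; it makes the iteration in
`gronwall_family` a contraction. -/
lemma integral_mul_gronwallFactor {g : ℝ → ℝ} {t₀ t : ℝ} (ht : t₀ ≤ t)
    (hg : ContinuousOn g (Icc t₀ t)) :
    ∫ s in t₀..t, g s * gronwallFactor g t₀ s = (gronwallFactor g t₀ t - 1) / 2 := by
  have hθ := continuousOn_gronwallFactor hg
  rw [intervalIntegral.integral_eq_sub_of_hasDerivAt_of_le
    (f := fun s => gronwallFactor g t₀ s / 2) ht (hθ.div_const 2) (f' := fun s => g s * gronwallFactor g t₀ s)]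
  · simp [gronwallFactor, sub_div]
  · intro s hs
    have h1 : HasDerivAt (fun t => ∫ s in t₀..t, g s) (g s) s := by
      refine intervalIntegral.integral_hasDerivAt_right ?_ ?_ ?_
      · exact ContinuousOn.intervalIntegrable (by
          rw [uIcc_of_le hs.1.le]; exact hg.mono (Icc_subset_Icc_right hs.2.le))
      · exact (hg.mono Ioo_subset_Icc_self).stronglyMeasurableAtFilter isOpen_Ioo s hs
      · exact hg.continuousAt (Icc_mem_nhds hs.1 hs.2)
    refine ((h1.const_mul 2).exp.div_const 2).congr_deriv ?_
    simp only [gronwallFactor]; ring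
  · exact ContinuousOn.intervalIntegrable (by rw [uIcc_of_le ht]; exact hg.mul hθ)

lemma one_le_gronwallFactor {g : ℝ → ℝ} {t₀ t : ℝ} (ht : t₀ ≤ t)
    (hg : ∀ s ∈ Icc t₀ t, 0 ≤ g s) : 1 ≤ gronwallFactor g t₀ t := by
  rw [gronwallFactor, Real.one_le_exp_iff]
  have := intervalIntegral.integral_nonneg (μ := volume) ht hg
  linarith

/-- A Gronwall lemma for families that requires no measurability of suprema. -/
lemma gronwall_family {X : Type*} {q : ℝ → X → ℝ} {t₀ t₁ A M : ℝ} {g : ℝ → ℝ} (hA : 0 ≤ A)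
    (hg : ContinuousOn g (Icc t₀ t₁)) (hg0 : ∀ s ∈ Icc t₀ t₁, 0 ≤ g s)
    (hM0 : 0 ≤ M) (hM : ∀ t ∈ Icc t₀ t₁, ∀ x, q t x ≤ M)
    (h : ∀ N, 0 ≤ N → ∀ t ∈ Icc t₀ t₁,
      (∀ s ∈ Icc t₀ t, ∀ x, q s x ≤ N * gronwallFactor g t₀ s) →
      ∀ x, q t x ≤ A + ∫ s in t₀..t, g s * (N * gronwallFactor g t₀ s)) :
    ∀ t ∈ Icc t₀ t₁, ∀ x, q t x ≤ 2 * A * gronwallFactor g t₀ t := by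
  have hθ1 : ∀ t ∈ Icc t₀ t₁, 1 ≤ gronwallFactor g t₀ t := fun t ht =>
    one_le_gronwallFactor ht.1 fun s hs => hg0 s ⟨hs.1, hs.2.trans ht.2⟩
  -- A bound N θ improves to (A + N/2) θ. Starting from N = 2A + M, the excess over the fixed point
  -- 2A is halved at each step.
  have key : ∀ n : ℕ, ∀ t ∈ Icc t₀ t₁, ∀ x,
      q t x ≤ (2 * A + M * (1 / 2) ^ n) * gronwallFactor g t₀ t := by
    intro n
    induction n with
    | zero =>
      intro t ht x
      rw [pow_zero, mul_one]
      exact (hM t ht x).trans ((by linarith : M ≤ 2 * A + M).trans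
        (le_mul_of_one_le_right (by positivity) (hθ1 t ht)))
    | succ n ih =>
      intro t ht x
      have h1 := h (2 * A + M * (1 / 2) ^ n) (by positivity) t ht
        (fun s hs => ih s ⟨hs.1, hs.2.trans ht.2⟩) x
      have e : ∀ s, g s * ((2 * A + M * (1 / 2) ^ n) * gronwallFactor g t₀ s) =
          (2 * A + M * (1 / 2) ^ n) * (g s * gronwallFactor g t₀ s) := fun s => by ring
      simp only [e] at h1
      rw [intervalIntegral.integral_const_mul, integral_mul_gronwallFactor ht.1
        (hg.mono (Icc_subset_Icc_right ht.2))] at h1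
      have h2 := hθ1 t ht
      have h3 : 0 ≤ M * (1 / 2) ^ n := by positivity
      rw [pow_succ]
      nlinarith
  intro t ht x
  have hlim : Tendsto (fun n : ℕ => (2 * A + M * (1 / 2) ^ n) * gronwallFactor g t₀ t) atTop
      (𝓝 ((2 * A + M * 0) * gronwallFactor g t₀ t)) :=
    ((tendsto_const_nhds.add ((tendsto_pow_atTop_nhds_zero_of_lt_one (by norm_num)
      (by norm_num)).const_mul M)).mul_const _)
  rw [mul_zero, add_zero] at hlim
  exact ge_of_tendsto' hlim fun n => key n t ht x

lemma IsRegular.solvesOn {a : ℂ} {F : ℂ → ℂ} (hF : Continuous F) {u ux uxx : ℝ → ℝ → ℂ}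
    (h : IsRegular a F u ux uxx) {t₀ : ℝ} (h0 : 0 ≤ t₀) (t₁ : ℝ) :
    SolvesOn a t₀ t₁ (fun t x => F (u t x)) u ux uxx where
  cont := h.cont
  cont_force := hF.comp h.cont
  dx t ht := h.dx t (h0.trans_lt ht.1)
  dxx t ht := h.dxx t (h0.trans_lt ht.1)
  dt t ht := h.dt t (h0.trans_lt ht.1)
  cont_uxx := h.cont_uxx.mono (prod_mono (fun _ ht => h0.trans_lt ht.1) subset_rfl)

/-! ### From local energy to pointwise bounds. -/

/-- With p = r^(-1/4) the left side is p²y: at most p³ if y ≤ p, and otherwise at most y³ ≤ 1 + y⁴ ≤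
2g. It splits the commutator term, a singular kernel times |u| with |u|⁴ ≤ g, into two parts that
are integrable in time. -/
lemma inv_sqrt_mul_le_of_pow_four {r y g : ℝ} (hr : 0 < r) (hy : 0 ≤ y) (hg : 1 ≤ g)
    (hyg : y ^ 4 ≤ g) : (√r)⁻¹ * y ≤ r ^ (-(3 / 4) : ℝ) + 2 * g := by
  set p := r ^ (-(1 / 4) : ℝ) with hp
  have hp0 : 0 < p := Real.rpow_pos_of_pos hr _
  have h2 : (√r)⁻¹ = p ^ 2 := by
    rw [inv_sqrt_eq_rpow, hp, ← Real.rpow_natCast, ← Real.rpow_mul hr.le]; norm_num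
  have h3 : r ^ (-(3 / 4) : ℝ) = p ^ 3 := by
    rw [hp, ← Real.rpow_natCast, ← Real.rpow_mul hr.le]; norm_num
  rw [h2, h3]
  rcases le_total y p with hyp | hyp
  · nlinarith [mul_le_mul_of_nonneg_left hyp (sq_nonneg p)]
  · have h4 : p ^ 2 ≤ y ^ 2 := by gcongr
    have h5 : p ^ 2 * y ≤ y ^ 2 * y := by gcongr
    have h6 : y ^ 2 * y ≤ 1 + y ^ 4 := by nlinarith [sq_nonneg (y - 1), sq_nonneg (y * (y - 1)), sq_nonneg y]
    have : 0 ≤ p ^ 3 := by positivity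
    linarith

lemma intervalIntegrable_rpow_sub (t b c : ℝ) :
    IntervalIntegrable (fun s : ℝ => (t - s) ^ (-(3 / 4) : ℝ)) volume b c := by
  have := (intervalIntegral.intervalIntegrable_rpow' (a := t - b) (b := t - c)
    (by norm_num : (-1 : ℝ) < -(3 / 4))).comp_sub_left t
  simpa using this

lemma integral_rpow_sub_le {t₀ t : ℝ} (h : t₀ ≤ t) (h1 : t ≤ t₀ + 1) :
    ∫ s in t₀..t, (t - s) ^ (-(3 / 4) : ℝ) ≤ 4 := by
  rw [intervalIntegral.integral_comp_sub_left (fun q => q ^ (-(3 / 4) : ℝ)),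
    integral_rpow (Or.inl (by norm_num)), sub_self, Real.zero_rpow (by norm_num)]
  have h2 : (t - t₀) ^ (-(3 / 4) + 1 : ℝ) ≤ 1 :=
    Real.rpow_le_one (by linarith) (by linarith) (by norm_num)
  norm_num at h2 ⊢
  linarith

/-- Local smoothing for the critical quintic nonlinearity: bounds on the local energy yield a
pointwise bound. -/
lemma exists_local_bound (a : ℂ) (ha : a.re = 1) (C : ℝ) : ∃ K, 0 ≤ K ∧ ∀ (F : ℂ → ℂ) (u ux uxx : ℝ → ℝ → ℂ),
    DissipativeForce C F → IsRegular a F u ux uxx → ∀ x₀ t₀ t₁ m₀ Γ : ℝ, ∀ g : ℝ → ℝ, 0 < t₀ →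
    t₀ ≤ t₁ → t₁ ≤ t₀ + 1 → 0 ≤ m₀ → ContinuousOn g (Icc t₀ t₁) → (∀ s ∈ Icc t₀ t₁, 1 ≤ g s) →
    (∀ s ∈ Icc t₀ t₁, ∀ x, |x - x₀| ≤ 2 → ‖u s x‖ ^ 4 ≤ g s) → ∫ s in t₀..t₁, g s ≤ Γ →
    (∀ x, |x - x₀| ≤ 2 → ‖u t₀ x‖ ≤ m₀) →
    ‖u t₁ x₀‖ ≤ 2 * (K * (m₀ + 1 + Γ)) * Real.exp (K * Γ) := by
  have hare : 0 < a.re := by rw [ha]; exact one_pos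
  obtain ⟨c, hc0, hc⟩ := exists_cutoffs
  set k := mass (heatK a) with hk
  set k₁ := mass (heatK₁ a) with hk₁
  have hk0 : 0 ≤ k := mass_nonneg _
  have hk₁0 : 0 ≤ k₁ := mass_nonneg _
  -- One constant for all uses: the first term also covers the Gronwall exponent, k the initial
  -- value, and the rest the two commutators. C ≥ 0 follows from `DissipativeForce`, which is only
  -- introduced afterwards, hence the absolute value.
  refine ⟨2 * (k * |C|) + k + 2 * (k * ‖a‖ * c) + 8 * (‖a‖ * k₁ * c), by positivity, ?_⟩
  intro F u ux uxx hF h x₀ t₀ t₁ m₀ Γ g h0 h01 h011 hm0 hg hg1 hug hΓ hm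
  have hC := hF.const_nonneg
  rw [abs_of_nonneg hC]
  set K := 2 * (k * C) + k + 2 * (k * ‖a‖ * c) + 8 * (‖a‖ * k₁ * c) with hK
  have hg0 : ∀ s ∈ Icc t₀ t₁, 0 ≤ g s := fun s hs => zero_le_one.trans (hg1 s hs)
  have hgi : ∀ t ∈ Icc t₀ t₁, IntervalIntegrable g volume t₀ t := fun t ht =>
    ContinuousOn.intervalIntegrable (by
      rw [uIcc_of_le ht.1]; exact hg.mono (Icc_subset_Icc_right ht.2))
  have hgΓ : ∀ t ∈ Icc t₀ t₁, ∫ s in t₀..t, g s ≤ Γ := fun t ht => by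
    refine le_trans ?_ hΓ
    refine intervalIntegral.integral_mono_interval le_rfl ht.1 ht.2 ?_ (hgi t₁ ⟨h01, le_rfl⟩)
    rw [Filter.EventuallyLE, ae_restrict_iff' measurableSet_Ioc]
    exact ae_of_all _ fun s hs => hg0 s (Ioc_subset_Icc_self hs)
  have hΓ0 : 0 ≤ Γ := by
    refine le_trans ?_ (hgΓ t₀ ⟨le_rfl, h01⟩); simp
  obtain ⟨ρ, ψ, ψ₁, ψ₂, hψ, hψ0, hψ1, hψin, hψout, hb₁, hb₂⟩ := hc x₀ 1 le_rfl
  simp only [mul_one, div_one] at hψout hb₁ hb₂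
  obtain ⟨M, hM⟩ := h.bdd t₁
  have hM' : ∀ s ∈ Icc t₀ t₁, ∀ x, ‖u s x‖ ≤ M := fun s hs => hM s ⟨h0.le.trans hs.1, hs.2⟩
  have hM0 : 0 ≤ M := (norm_nonneg _).trans (hM' t₀ ⟨le_rfl, h01⟩ 0)
  set G : ℝ → ℝ := fun s => k * C * g s with hG
  have hGc : ContinuousOn G (Icc t₀ t₁) := continuousOn_const.mul hg
  have hG0 : ∀ s ∈ Icc t₀ t₁, 0 ≤ G s := fun s hs => mul_nonneg (by positivity) (hg0 s hs)
  have habs : ∀ z, |ψ z| = ψ z := fun z => abs_of_nonneg (hψ0 z)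
  -- Gronwall is applied to ψ|u| rather than |u|, since |u|⁴ ≤ g is known only within distance 2 of
  -- x₀, where ψ lives.
  have main := gronwall_family (q := fun t x => ψ x * ‖u t x‖) (A := K * (m₀ + 1 + Γ)) (M := M)
    (by positivity) hGc hG0 hM0 (fun t ht x => by
      calc ψ x * ‖u t x‖ ≤ 1 * M := by gcongr; exacts [hψ1 x, hM' t ht x]
        _ = M := one_mul M) ?_ t₁ ⟨h01, le_rfl⟩ x₀
  · have h1 : ψ x₀ = 1 := hψin x₀ (by simp)
    simp only [h1, one_mul] at main
    refine main.trans ?_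
    have h2 : gronwallFactor G t₀ t₁ ≤ Real.exp (K * Γ) := by
      rw [gronwallFactor, Real.exp_le_exp, hG, intervalIntegral.integral_const_mul]
      calc 2 * (k * C * ∫ s in t₀..t₁, g s) ≤ 2 * (k * C * Γ) := by gcongr
        _ = (2 * (k * C)) * Γ := by ring
        _ ≤ K * Γ := by
          gcongr
          have e1 : 0 ≤ 2 * (k * ‖a‖ * c) := by positivity
          have e2 : 0 ≤ 8 * (‖a‖ * k₁ * c) := by positivity
          linarith
    have h3 : 0 ≤ 2 * (K * (m₀ + 1 + Γ)) := by positivity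
    gcongr
  · intro N hN t ht hq x
    set θ := gronwallFactor G t₀ with hθ
    have hsub : Icc t₀ t ⊆ Icc t₀ t₁ := Icc_subset_Icc_right ht.2
    have hform := (h.solvesOn hF.cont h0.le t).cutoff_formula hare ht.1 hψ x
    have e1 : ψ x * ‖u t x‖ = ‖(ψ x : ℂ) * u t x‖ := by
      rw [norm_mul, Complex.norm_real, Real.norm_eq_abs, habs]
    have cut : ∀ s ∈ Icc t₀ t₁, ∀ z, ∀ w : ℝ, (2 ≤ |z - x₀| → w = 0) → ∀ B : ℝ, 0 ≤ B →
        (|z - x₀| ≤ 2 → |w| * ‖u s z‖ ≤ B) → |w| * ‖u s z‖ ≤ B := by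
      intro s _ z w hw B hB hin
      rcases le_total (|z - x₀|) 2 with hz | hz
      · exact hin hz
      · rw [hw hz, abs_zero, zero_mul]; exact hB
    have b0 : ∀ z, ‖(ψ z : ℂ) * u t₀ z‖ ≤ m₀ := fun z => by
      rw [norm_mul, Complex.norm_real, Real.norm_eq_abs]
      refine cut t₀ ⟨le_rfl, h01⟩ z _ (fun hz => (hψout z hz).1) _ hm0 fun hz => ?_
      rw [habs]
      calc ψ z * ‖u t₀ z‖ ≤ 1 * m₀ := by gcongr; exacts [hψ1 z, hm z hz]
        _ = m₀ := one_mul _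
    have hy : ∀ s ∈ Icc t₀ t₁, (√√(g s)) ^ 4 = g s := fun s hs => by
      rw [show 4 = 2 * 2 by norm_num, pow_mul, Real.sq_sqrt (Real.sqrt_nonneg _),
        Real.sq_sqrt (hg0 s hs)]
    have huy : ∀ s ∈ Icc t₀ t₁, ∀ z, |z - x₀| ≤ 2 → ‖u s z‖ ≤ √√(g s) := fun s hs z hz => by
      refine le_of_pow_le_pow_left₀ four_ne_zero (by positivity) ?_
      rw [hy s hs]
      exact hug s hs z hz
    have hy2 : ∀ s ∈ Icc t₀ t₁, √√(g s) ≤ g s := fun s hs => by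
      have h1 := hg1 s hs
      have h2 : √(g s) ≤ g s := by
        rw [Real.sqrt_le_left (hg0 s hs)]; nlinarith
      refine le_trans ?_ h2
      rw [Real.sqrt_le_left (Real.sqrt_nonneg _)]
      have := Real.one_le_sqrt.2 h1
      nlinarith
    have b1 : ∀ s ∈ Icc t₀ t₁, ∀ z, ‖(ψ₁ z : ℂ) * u s z‖ ≤ c * √√(g s) := fun s hs z => by
      rw [norm_mul, Complex.norm_real, Real.norm_eq_abs]
      refine cut s hs z _ (fun hz => (hψout z hz).2.1) _ (by positivity) fun hz => ?_
      gcongr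
      exacts [hb₁ z, huy s hs z hz]
    have b2 : ∀ s ∈ Icc t₀ t, ∀ z, ‖(ψ z : ℂ) * F (u s z) + a * (ψ₂ z * u s z)‖ ≤
        C + C * (g s * (N * θ s)) + ‖a‖ * (c * g s) := fun s hs z => by
      have hs' := hsub hs
      have hgs := hg0 s hs'
      have hNθ : 0 ≤ N * θ s := mul_nonneg hN (Real.exp_nonneg _)
      refine (norm_add_le _ _).trans (add_le_add ?_ ?_)
      · rw [norm_mul, Complex.norm_real, Real.norm_eq_abs, habs]
        rcases le_total (|z - x₀|) 2 with hz | hz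
        · have f1 := hF.growth (u s z)
          have f2 := hψ1 z
          have f3 := hq s hs z
          -- The critical term: of the five powers, four are spent on the integrable g, and the
          -- fifth, together with ψ, is the Gronwall unknown.
          calc ψ z * ‖F (u s z)‖ ≤ ψ z * (C * (1 + ‖u s z‖ ^ 5)) := by
                gcongr; exact hψ0 z
            _ = C * ψ z + C * (‖u s z‖ ^ 4 * (ψ z * ‖u s z‖)) := by ring
            _ ≤ C * 1 + C * (g s * (N * θ s)) := by
                gcongr
                exacts [mul_nonneg (hψ0 z) (norm_nonneg _), hug s hs' z hz]
            _ = _ := by rw [mul_one]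
        · rw [(hψout z hz).1, zero_mul]; positivity
      · rw [norm_mul, norm_mul, Complex.norm_real, Real.norm_eq_abs]
        refine mul_le_mul_of_nonneg_left ?_ (norm_nonneg _)
        refine cut s hs' z _ (fun hz => (hψout z hz).2.2) _ (mul_nonneg hc0 hgs) fun hz => ?_
        gcongr
        exacts [hb₂ z, (huy s hs' z hz).trans (hy2 s hs')]
    have iG : IntervalIntegrable (fun s => G s * (N * θ s)) volume t₀ t :=
      ContinuousOn.intervalIntegrable (by
        rw [uIcc_of_le ht.1]
        exact (hGc.mono hsub).mul (continuousOn_const.mul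
          ((continuousOn_gronwallFactor hGc).mono hsub)))
    have i1 : IntervalIntegrable (fun s => k * C + (k * ‖a‖ * c + 4 * (‖a‖ * k₁ * c)) * g s +
        2 * (‖a‖ * k₁ * c) * (t - s) ^ (-(3 / 4) : ℝ)) volume t₀ t :=
      (intervalIntegrable_const.add ((hgi t ht).const_mul _)).add
        ((intervalIntegrable_rpow_sub t t₀ t).const_mul _)
    have hI : ‖∫ s in t₀..t, cutoffForce a ψ ψ₁ ψ₂ (fun t x => F (u t x)) u t x s‖ ≤
        ∫ s in t₀..t, ((k * C + (k * ‖a‖ * c + 4 * (‖a‖ * k₁ * c)) * g s +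
        2 * (‖a‖ * k₁ * c) * (t - s) ^ (-(3 / 4) : ℝ)) + G s * (N * θ s)) := by
      refine norm_intervalIntegral_le ht.1 (i1.add iG) fun s hs => ?_
      have hs' := Ioo_subset_Icc_self hs
      refine (norm_cutoffForce_le hare (b2 s hs') (b1 s (hsub hs'))).trans ?_
      have f1 := inv_sqrt_mul_le_of_pow_four (r := t - s) (by linarith [hs.2])
        (Real.sqrt_nonneg √(g s)) (hg1 s (hsub hs')) (hy s (hsub hs')).le
      calc _ = k * C + k * C * g s * (N * θ s) + k * ‖a‖ * c * g s +
            2 * (‖a‖ * k₁ * c) * ((√(t - s))⁻¹ * √√(g s)) := by ring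
        _ ≤ k * C + k * C * g s * (N * θ s) + k * ‖a‖ * c * g s +
            2 * (‖a‖ * k₁ * c) * ((t - s) ^ (-(3 / 4) : ℝ) + 2 * g s) := by gcongr
        _ = _ := by simp only [hG]; ring
    have hI2 : ∫ s in t₀..t, (k * C + (k * ‖a‖ * c + 4 * (‖a‖ * k₁ * c)) * g s +
        2 * (‖a‖ * k₁ * c) * (t - s) ^ (-(3 / 4) : ℝ)) ≤
        k * C + (k * ‖a‖ * c + 4 * (‖a‖ * k₁ * c)) * Γ + 8 * (‖a‖ * k₁ * c) := by
      rw [intervalIntegral.integral_add (intervalIntegrable_const.add ((hgi t ht).const_mul _))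
        ((intervalIntegrable_rpow_sub t t₀ t).const_mul _),
        intervalIntegral.integral_add intervalIntegrable_const ((hgi t ht).const_mul _),
        intervalIntegral.integral_const, intervalIntegral.integral_const_mul,
        intervalIntegral.integral_const_mul, smul_eq_mul]
      have f1 := hgΓ t ht
      have f2 := integral_rpow_sub_le ht.1 (by linarith [ht.2] : t ≤ t₀ + 1)
      have f3 : t - t₀ ≤ 1 := by linarith [ht.2]
      calc _ ≤ 1 * (k * C) + (k * ‖a‖ * c + 4 * (‖a‖ * k₁ * c)) * Γ +
            2 * (‖a‖ * k₁ * c) * 4 := by gcongr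
        _ = _ := by ring
    rw [e1, hform]
    refine (norm_add_le _ _).trans ?_
    have hI3 := hI
    rw [intervalIntegral.integral_add i1 iG] at hI3
    have h3 := norm_gconv_le (decays_heatK hare) (t - t₀) b0 x
    rw [← hk] at h3
    have h4 : k * m₀ + (k * C + (k * ‖a‖ * c + 4 * (‖a‖ * k₁ * c)) * Γ + 8 * (‖a‖ * k₁ * c)) ≤
        K * (m₀ + 1 + Γ) := by
      have p1 : 0 ≤ k * C := by positivity
      have p2 : 0 ≤ k * ‖a‖ * c := by positivity
      have p3 : 0 ≤ ‖a‖ * k₁ * c := by positivity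
      rw [hK]
      nlinarith [mul_nonneg p1 hm0, mul_nonneg p2 hm0, mul_nonneg p3 hm0, mul_nonneg p1 hΓ0,
        mul_nonneg p2 hΓ0, mul_nonneg p3 hΓ0, mul_nonneg hk0 hΓ0]
    linarith

/-- A bounded initial value yields a global bound, and all solutions eventually enter a fixed ball;
the constants depend on the nonlinearity only through its structural constant. -/
theorem exists_global_bounds (a : ℂ) (ha : a.re = 1) (C : ℝ) :
    ∃ (Φ : ℝ → ℝ) (R₀ : ℝ) (T₀ : ℝ → ℝ), (∀ m, 0 ≤ T₀ m) ∧ ∀ (F : ℂ → ℂ) (u ux uxx : ℝ → ℝ → ℂ),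
      DissipativeForce C F → IsRegular a F u ux uxx → ∀ m, (∀ x, ‖u 0 x‖ ≤ m) →
      (∀ t, 0 ≤ t → ∀ x, ‖u t x‖ ≤ Φ m) ∧ (∀ t, T₀ m ≤ t → ∀ x, ‖u t x‖ ≤ R₀) := by
  have ha1 : 1 ≤ ‖a‖ := by
    have := Complex.abs_re_le_norm a
    rwa [ha, abs_one] at this
  -- As ‖a‖ ≥ Re a = 1, this gives both ε‖a‖ ≤ 1/2, for the energy inequality, and ε ≤ 1/2, for the
  -- interpolation.
  set ε : ℝ := 1 / (2 * ‖a‖) with hεd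
  have hε : 0 < ε := by positivity
  have hεa : ε * ‖a‖ ≤ 1 / 2 := by rw [hεd]; apply le_of_eq; field_simp
  have hε2 : ε ≤ 1 / 2 := (le_mul_of_one_le_right hε.le ha1).trans hεa
  obtain ⟨K, hK0, hK⟩ := exists_local_bound a ha C
  set A := ∫ x, wt ε 0 x with hA
  have hA0 : 0 ≤ A := integral_nonneg fun x => (wt_pos _ _ _).le
  -- If the energy is at most y, Γ y bounds the time integral of g over a window of length at most
  -- 1. B is the bound of `exists_local_bound`, and E m bounds the energy for all times when the
  -- data are bounded by m.
  set Γ : ℝ → ℝ := fun y => 9 * (1 + y) ^ 2 * (1 + y + 2 * C * A) with hΓ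
  set B : ℝ → ℝ → ℝ := fun m G => 2 * (K * (m + 1 + G)) * Real.exp (K * G) with hB
  set E : ℝ → ℝ := fun m => A * m ^ 2 + 4 * C * A with hE
  -- The three summands serve t = 0, 0 < t ≤ 1 and t > 1. The absorbing radius uses energy at most 1
  -- + 4CA, which holds once the transient exp(-s/2) A m² is below 1; by exp(s/2) ≥ 1 + s/2 this
  -- holds on [t - 1, t] for t ≥ 2Am² + 2.
  refine ⟨fun m => |m| + |B (m + 1) (Γ (E m))| + |B (Γ (E m)) (Γ (E m))|,
    B (Γ (1 + 4 * C * A)) (Γ (1 + 4 * C * A)), fun m => 2 * (A * m ^ 2) + 2,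
    fun m => by positivity, ?_⟩
  intro F u ux uxx hF h m hm
  have hC := hF.const_nonneg
  have hm0 : 0 ≤ m := (norm_nonneg _).trans (hm 0)
  have hgint : ∀ x₀ y t₀ t₁ : ℝ, 0 < t₀ → t₀ ≤ t₁ → t₁ ≤ t₀ + 1 →
      (∀ s ∈ Icc t₀ t₁, locEnergy ε x₀ (u s) ≤ y) →
      ContinuousOn (fun s => 9 * (1 + y) ^ 2 * (1 + locEnergy ε x₀ (ux s))) (Icc t₀ t₁) ∧
      (∀ s ∈ Icc t₀ t₁, 1 ≤ 9 * (1 + y) ^ 2 * (1 + locEnergy ε x₀ (ux s))) ∧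
      (∀ s ∈ Icc t₀ t₁, ∀ x, |x - x₀| ≤ 2 →
        ‖u s x‖ ^ 4 ≤ 9 * (1 + y) ^ 2 * (1 + locEnergy ε x₀ (ux s))) ∧
      ∫ s in t₀..t₁, 9 * (1 + y) ^ 2 * (1 + locEnergy ε x₀ (ux s)) ≤ Γ y := by
    intro x₀ y t₀ t₁ h0 h01 h011 hy
    have hy0 : 0 ≤ y := (locEnergy_nonneg _ _ _).trans (hy t₀ ⟨le_rfl, h01⟩)
    have hD : ContinuousOn (fun s => locEnergy ε x₀ (ux s)) (Icc t₀ t₁) :=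
      (continuousOn_locEnergy hε x₀ h.cont_ux h.bdd_ux).mono fun s hs => h0.trans_le hs.1
    have hDi : IntervalIntegrable (fun s => locEnergy ε x₀ (ux s)) volume t₀ t₁ :=
      ContinuousOn.intervalIntegrable (by rwa [uIcc_of_le h01])
    refine ⟨continuousOn_const.mul (continuousOn_const.add hD), fun s _ => ?_, fun s hs x hx => ?_,
      ?_⟩
    · have h1 := locEnergy_nonneg ε x₀ (ux s)
      have h2 : 1 ≤ (1 + y) ^ 2 := one_le_pow₀ (by linarith)
      nlinarith
    · have hs0 : 0 < s := h0.trans_le hs.1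
      obtain ⟨M, hM⟩ := h.bdd s
      obtain ⟨M₁, hM₁⟩ := h.bdd_ux s s hs0
      have h1 := norm_pow_four_le hε hε2 x₀ (h.dx s hs0) (h.continuous_ux hs0)
        (hM s ⟨hs0.le, le_rfl⟩) (hM₁ s ⟨le_rfl, le_rfl⟩) hx
      have h2 := hy s hs
      have h3 := locEnergy_nonneg ε x₀ (u s)
      have h4 := locEnergy_nonneg ε x₀ (ux s)
      refine h1.trans ?_
      gcongr
    · rw [intervalIntegral.integral_const_mul, intervalIntegral.integral_add
        intervalIntegrable_const hDi, intervalIntegral.integral_const, smul_eq_mul, mul_one]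
      have h1 := h.integral_dissipation_le ha hF hε hεa x₀ h0 h01
      have h2 := hy t₀ ⟨le_rfl, h01⟩
      have h3 : 2 * C * A * (t₁ - t₀) ≤ 2 * C * A :=
        mul_le_of_le_one_right (by positivity) (by linarith)
      exact mul_le_mul_of_nonneg_left (by linarith) (by positivity)
  have bound₁ : ∀ x₀ y t₀ t₁ m₀ : ℝ, 0 < t₀ → t₀ ≤ t₁ → t₁ ≤ t₀ + 1 →
      (∀ s ∈ Icc t₀ t₁, locEnergy ε x₀ (u s) ≤ y) → (∀ x, |x - x₀| ≤ 2 → ‖u t₀ x‖ ≤ m₀) →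
      ‖u t₁ x₀‖ ≤ B m₀ (Γ y) := by
    intro x₀ y t₀ t₁ m₀ h0 h01 h011 hy hm₀
    obtain ⟨p1, p2, p3, p4⟩ := hgint x₀ y t₀ t₁ h0 h01 h011 hy
    exact hK F u ux uxx hF h x₀ t₀ t₁ m₀ (Γ y) _ h0 h01 h011
      ((norm_nonneg _).trans (hm₀ x₀ (by simp))) p1 p2 p3 p4 hm₀
  have bound₂ : ∀ x₀ y t : ℝ, 1 < t → (∀ s ∈ Icc (t - 1) t, locEnergy ε x₀ (u s) ≤ y) →
      ‖u t x₀‖ ≤ B (Γ y) (Γ y) := by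
    intro x₀ y t ht hy
    obtain ⟨p1, p2, p3, p4⟩ := hgint x₀ y (t - 1) t (by linarith) (by linarith) (by linarith) hy
    have hy0 : 0 ≤ y := (locEnergy_nonneg _ _ _).trans (hy t ⟨by linarith, le_rfl⟩)
    have hΓ1 : 1 ≤ Γ y := by
      have h2 : 1 ≤ (1 + y) ^ 2 := one_le_pow₀ (by linarith)
      have h3 : 0 ≤ 2 * C * A := by positivity
      simp only [hΓ]
      nlinarith
    -- Some time in the unit window has g(s) ≤ Γ y, or the integral would exceed Γ y. There u is
    -- bounded near x₀ in terms of the energy alone; s may depend on x₀, the bound does not.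
    obtain ⟨s, hs, hsg⟩ : ∃ s ∈ Icc (t - 1) t,
        9 * (1 + y) ^ 2 * (1 + locEnergy ε x₀ (ux s)) ≤ Γ y := by
      by_contra! hcon
      have h1 := intervalIntegral.integral_lt_integral_of_continuousOn_of_le_of_exists_lt
        (a := t - 1) (b := t) (f := fun _ => Γ y) (by linarith) continuousOn_const p1
        (fun s hs => (hcon s (Ioc_subset_Icc_self hs)).le)
        ⟨t, ⟨by linarith, le_rfl⟩, hcon t ⟨by linarith, le_rfl⟩⟩
      rw [intervalIntegral.integral_const] at h1
      simp only [sub_sub_cancel, one_smul] at h1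
      linarith
    refine bound₁ x₀ y s t (Γ y) (by linarith [hs.1]) hs.2 (by linarith [hs.1])
      (fun r hr => hy r ⟨hs.1.trans hr.1, hr.2⟩) fun x hx => ?_
    have h1 := (p3 s hs x hx).trans hsg
    by_contra! hlt
    have h2 : Γ y ^ 4 < ‖u s x‖ ^ 4 := by gcongr
    have h3 : Γ y ≤ Γ y ^ 4 := le_self_pow₀ hΓ1 four_ne_zero
    linarith
  have hY0 : ∀ x₀, locEnergy ε x₀ (u 0) ≤ A * m ^ 2 := fun x₀ =>
    locEnergy_le hε x₀ (h.continuous_sec 0) hm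
  have hYt : ∀ x₀ t, 0 ≤ t → locEnergy ε x₀ (u t) ≤ E m := fun x₀ t ht => by
    have h1 := h.energy_le ha hF hε hεa x₀ ht
    have h2 : Real.exp (-t / 2) ≤ 1 := Real.exp_le_one_iff.2 (by linarith)
    have h3 := locEnergy_nonneg ε x₀ (u 0)
    have h4 : Real.exp (-t / 2) * locEnergy ε x₀ (u 0) ≤ A * m ^ 2 :=
      (mul_le_of_le_one_left h3 h2).trans (hY0 x₀)
    simp only [hE]
    linarith
  refine ⟨fun t ht x₀ => ?_, fun t ht x₀ => ?_⟩
  · rcases ht.eq_or_lt with rfl | ht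
    · exact (hm x₀).trans ((le_abs_self m).trans (by
        have := abs_nonneg (B (m + 1) (Γ (E m)))
        have := abs_nonneg (B (Γ (E m)) (Γ (E m)))
        linarith))
    · rcases le_or_gt t 1 with ht1 | ht1
      -- The estimates need a positive starting time. By joint continuity |u| is below m + 1 on [x₀
      -- - 2, x₀ + 2] at some small η > 0, which may depend on x₀.
      · have hev : ∀ᶠ s in 𝓝 (0 : ℝ), ∀ x ∈ Icc (x₀ - 2) (x₀ + 2), ‖u s x‖ < m + 1 := by
          refine isCompact_Icc.eventually_forall_of_forall_eventually fun x _ => ?_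
          have hc : ContinuousAt (fun p : ℝ × ℝ => ‖u p.1 p.2‖) (0, x) :=
            h.cont.norm.continuousAt
          exact hc.eventually (gt_mem_nhds (by
            have := hm x
            simp only
            linarith))
        obtain ⟨η, hη, hη0⟩ := ((hev.filter_mono nhdsWithin_le_nhds).and
          (Ioo_mem_nhdsGT ht)).exists
        refine (bound₁ x₀ (E m) η t (m + 1) hη0.1 hη0.2.le (by linarith [hη0.1])
          (fun s hs => hYt x₀ s (hη0.1.le.trans hs.1)) fun x hx => (hη x ?_).le).trans ?_
        · have := abs_le.1 hx
          constructor <;> linarith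
        · have h1 := le_abs_self (B (m + 1) (Γ (E m)))
          have h2 := abs_nonneg (B (Γ (E m)) (Γ (E m)))
          have h3 := abs_nonneg m
          linarith
      · refine (bound₂ x₀ (E m) t ht1 fun s hs => hYt x₀ s (by linarith [hs.1])).trans ?_
        have h1 := le_abs_self (B (Γ (E m)) (Γ (E m)))
        have h2 := abs_nonneg (B (m + 1) (Γ (E m)))
        have h3 := abs_nonneg m
        linarith
  · have hAm : 0 ≤ A * m ^ 2 := by positivity
    refine bound₂ x₀ _ t (by linarith) fun s hs => ?_
    have h1 := h.energy_le ha hF hε hεa x₀ (by linarith [hs.1] : 0 ≤ s)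
    have h2 : Real.exp (-s / 2) * (A * m ^ 2) ≤ 1 := by
      have h3 := Real.add_one_le_exp (s / 2)
      have h4 : Real.exp (-s / 2) * Real.exp (s / 2) = 1 := by
        rw [← Real.exp_add]; simp [neg_div]
      rw [← h4]
      gcongr
      linarith [hs.1]
    have h5 : Real.exp (-s / 2) * locEnergy ε x₀ (u 0) ≤ Real.exp (-s / 2) * (A * m ^ 2) := by
      gcongr; exact hY0 x₀
    linarith

/-! ### Truncation of the force and global existence. -/

lemma half_le_one_add_pow_five {y : ℝ} (hy : 0 ≤ y) : y / 2 ≤ 1 + y ^ 5 := by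
  rcases le_total y 1 with h | h
  · have : 0 ≤ y ^ 5 := by positivity
    linarith
  · have : y ≤ y ^ 5 := le_self_pow₀ h (by norm_num)
    linarith

/-- The nonlinearity `F`, replaced by a linear damping outside of a ball. -/
noncomputable def truncForce (χ : ContDiffBump (0 : ℂ)) (F : ℂ → ℂ) (w : ℂ) : ℂ :=
  (-(1 / 2) : ℝ) • w + χ w • (F w + (1 / 2 : ℝ) • w)

lemma truncForce_eq (χ : ContDiffBump (0 : ℂ)) (F : ℂ → ℂ) {w : ℂ} (hw : ‖w‖ ≤ χ.rIn) :
    truncForce χ F w = F w := by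
  rw [truncForce, χ.one_of_mem_closedBall (by simpa using hw), one_smul, neg_smul]
  ring

lemma contDiff_truncForce (χ : ContDiffBump (0 : ℂ)) {F : ℂ → ℂ} (hF : ContDiff ℝ 1 F) :
    ContDiff ℝ 1 (truncForce χ F) :=
  (contDiff_id.const_smul _).add (χ.contDiff.smul (hF.add (contDiff_id.const_smul _)))

lemma exists_lipschitz_truncForce (χ : ContDiffBump (0 : ℂ)) {F : ℂ → ℂ} (hF : ContDiff ℝ 1 F) :
    ∃ L, LipschitzWith L (truncForce χ F) := by
  have h1 : ContDiff ℝ 1 fun w => χ w • (F w + (1 / 2 : ℝ) • w) :=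
    χ.contDiff.smul (hF.add (contDiff_id.const_smul _))
  obtain ⟨L, hL⟩ := ContDiff.lipschitzWith_of_hasCompactSupport
    (χ.hasCompactSupport.smul_right (f' := fun w => F w + (1 / 2 : ℝ) • w)) h1 one_ne_zero
  exact ⟨_, (lipschitzWith_smul (-(1 / 2) : ℝ)).add hL⟩

/-- The truncated force is the convex combination of F and -w/2 with weights χ and 1 - χ, and both
satisfy the dissipativity bound. The new constant does not depend on the radius of χ. -/
lemma DissipativeForce.truncForce {C : ℝ} {F : ℂ → ℂ} (hF : DissipativeForce C F)
    (χ : ContDiffBump (0 : ℂ)) (hF1 : ContDiff ℝ 1 F) :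
    DissipativeForce (C + 1) (truncForce χ F) := by
  have hC := hF.const_nonneg
  refine ⟨(contDiff_truncForce χ hF1).continuous, fun w => ?_, fun w => ?_⟩
  · have h0 : 0 ≤ χ w := χ.nonneg
    have h1 : χ w ≤ 1 := χ.le_one
    have h2 := hF.re_le w
    rw [GinzburgLandau.truncForce, inner_add_right, inner_smul_right, inner_smul_right,
      inner_add_right, inner_smul_right, real_inner_self_eq_norm_sq]
    nlinarith
  · have h0 : 0 ≤ χ w := χ.nonneg
    have h1 : χ w ≤ 1 := χ.le_one
    have h2 := hF.growth w
    have h3 := half_le_one_add_pow_five (norm_nonneg w)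
    have e : GinzburgLandau.truncForce χ F w = (-(1 / 2) * (1 - χ w) : ℝ) • w + χ w • F w := by
      rw [GinzburgLandau.truncForce, smul_add, smul_smul]
      module
    rw [e]
    refine (norm_add_le _ _).trans ?_
    rw [norm_smul, norm_smul, Real.norm_of_nonneg h0, norm_mul, norm_neg,
      Real.norm_of_nonneg (by linarith : 0 ≤ 1 - χ w), Real.norm_of_nonneg (by norm_num)]
    have h4 : 0 ≤ 1 + ‖w‖ ^ 5 := by positivity
    have h5 : χ w * ‖F w‖ ≤ 1 * (C * (1 + ‖w‖ ^ 5)) := by gcongr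
    have h6 : 1 / 2 * (1 - χ w) * ‖w‖ ≤ ‖w‖ / 2 := by
      nlinarith [mul_nonneg h0 (norm_nonneg w)]
    linarith

/-- Global existence for a dissipative nonlinearity of critical growth. -/
theorem exists_isRegular {a : ℂ} (ha : a.re = 1) {C : ℝ} {F : ℂ → ℂ}
    (hF : DissipativeForce C F) (hF1 : ContDiff ℝ 1 F) (u₀ : ℝ →ᵇ ℂ) :
    ∃ u ux uxx, IsRegular a F u ux uxx ∧ ∀ x, u 0 x = u₀ x := by
  have hare : 0 < a.re := by rw [ha]; exact one_pos
  -- The bound for the constant C + 1 comes before the cut-off, so χ can be equal to 1 on the whole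
  -- ball that the truncated solution visits.
  obtain ⟨Φ, R₀, T₀, -, hΦ⟩ := exists_global_bounds a ha (C + 1)
  let χ : ContDiffBump (0 : ℂ) := ⟨|Φ ‖u₀‖| + 1, |Φ ‖u₀‖| + 2, by positivity, by linarith⟩
  obtain ⟨L, hL⟩ := exists_lipschitz_truncForce χ hF1
  obtain ⟨u, hu⟩ := exists_isMild hare hL u₀
  obtain ⟨ux, uxx, h⟩ := hu.exists_isRegular hare hL (contDiff_truncForce χ hF1)
  have hu0 : ∀ x, u 0 x = u₀ x := fun x => by
    rw [hu.eq 0 le_rfl, gconv_heatK_zero hare, intervalIntegral.integral_same, add_zero]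
  have hb := (hΦ _ u ux uxx (hF.truncForce χ hF1) h ‖u₀‖
    fun x => by rw [hu0]; exact u₀.norm_coe_le_norm x).1
  refine ⟨u, ux, uxx, ⟨h.cont, h.bdd, h.dx, h.dxx, fun t ht x => ?_, h.cont_ux, h.cont_uxx,
    h.bdd_ux, h.bdd_uxx⟩, hu0⟩
  have h1 := h.dt t ht x
  rwa [truncForce_eq] at h1
  have h2 := hb t ht.le x
  have h3 := le_abs_self (Φ ‖u₀‖)
  change _ ≤ |Φ ‖u₀‖| + 1
  linarith

/-! ### Weighted stability and smoothing in space. -/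

lemma SolvesOn.mono {a : ℂ} {t₀ t₁ : ℝ} {f u ux uxx : ℝ → ℝ → ℂ}
    (h : SolvesOn a t₀ t₁ f u ux uxx) {s₀ s₁ : ℝ} (h0 : t₀ ≤ s₀) (h1 : s₁ ≤ t₁) :
    SolvesOn a s₀ s₁ f u ux uxx where
  cont := h.cont
  cont_force := h.cont_force
  dx t ht := h.dx t ⟨h0.trans_lt ht.1, ht.2.trans_le h1⟩
  dxx t ht := h.dxx t ⟨h0.trans_lt ht.1, ht.2.trans_le h1⟩
  dt t ht := h.dt t ⟨h0.trans_lt ht.1, ht.2.trans_le h1⟩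
  cont_uxx := h.cont_uxx.mono (prod_mono (Ioo_subset_Ioo h0 h1) subset_rfl)

/-- A truncation that is globally Lipschitz and agrees with F on the ball has the required constant.
-/
lemma exists_lipschitzOn_ball {F : ℂ → ℂ} (hF : ContDiff ℝ 1 F) (M : ℝ) :
    ∃ L : ℝ, 0 ≤ L ∧ ∀ w z, ‖w‖ ≤ M → ‖z‖ ≤ M → ‖F w - F z‖ ≤ L * ‖w - z‖ := by
  obtain ⟨L, hL⟩ := exists_lipschitz_truncForce
    (⟨|M| + 1, |M| + 2, by positivity, by linarith⟩ : ContDiffBump (0 : ℂ)) hF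
  refine ⟨L, L.2, fun w z hw hz => ?_⟩
  have h1 := hL.norm_sub_le w z
  have h2 := le_abs_self M
  rwa [truncForce_eq _ _ (by change _ ≤ |M| + 1; linarith),
    truncForce_eq _ _ (by change _ ≤ |M| + 1; linarith)] at h1

lemma intervalIntegrable_mild_integrand {a : ℂ} (ha : 0 < a.re) {t₀ t₁ N : ℝ} (h01 : t₀ ≤ t₁)
    {f : ℝ → ℝ → ℂ} (hf : Continuous (Function.uncurry f))
    (hN : ∀ s ∈ Icc t₀ t₁, ∀ z, ‖f s z‖ ≤ N) (x : ℝ) :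
    IntervalIntegrable (fun s => gconv (heatK a) (t₁ - s) (f s) x) volume t₀ t₁ := by
  refine intervalIntegrable_of_norm_le h01 (g := fun _ => mass (heatK a) * N)
    (fun s hs => ContinuousAt.continuousWithinAt ?_) intervalIntegrable_const fun s hs =>
    norm_gconv_le (decays_heatK ha) _ (hN s (Ioo_subset_Icc_self hs)) x
  refine continuousAt_gconv (decays_heatK ha) (τ := fun s => t₁ - s) (ξ := fun _ => x)
    (g := f) (M := N) (by fun_prop) (by fun_prop)
    (Eventually.of_forall fun r => hf.comp (Continuous.prodMk_right r))
    (fun z => hf.continuousAt) ?_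
  filter_upwards [Ioo_mem_nhds hs.1 hs.2] with r hr z
  exact hN r (Ioo_subset_Icc_self hr) z

/-- Stability of bounded solutions in a weighted supremum norm. -/
theorem norm_sub_le_of_solvesOn {a : ℂ} (ha : 0 < a.re) {F : ℂ → ℂ} (hF : Continuous F)
    {T M L κ δ : ℝ} (hL0 : 0 ≤ L) (hκ0 : 0 ≤ κ) (hδ0 : 0 ≤ δ)
    (hL : ∀ w z, ‖w‖ ≤ M → ‖z‖ ≤ M → ‖F w - F z‖ ≤ L * ‖w - z‖) {W : ℝ → ℝ}
    (hW1 : ∀ x, 1 ≤ W x) (hW : ∀ τ ∈ Icc 0 T, ∀ (g : ℝ → ℂ) (N : ℝ), (∀ z, ‖g z‖ ≤ N * W z) →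
      ∀ x, ‖gconv (heatK a) τ g x‖ ≤ κ * (N * W x))
    {u ux uxx v vx vxx : ℝ → ℝ → ℂ} (hu : SolvesOn a 0 T (fun t x => F (u t x)) u ux uxx)
    (hv : SolvesOn a 0 T (fun t x => F (v t x)) v vx vxx)
    (hub : ∀ t ∈ Icc 0 T, ∀ x, ‖u t x‖ ≤ M) (hvb : ∀ t ∈ Icc 0 T, ∀ x, ‖v t x‖ ≤ M)
    (h0 : ∀ x, ‖u 0 x - v 0 x‖ ≤ δ * W x) : ∀ t ∈ Icc 0 T, ∀ x,
      ‖u t x - v t x‖ ≤ 2 * (κ * δ) * Real.exp (2 * (κ * L * t)) * W x := by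
  rcases lt_or_ge T 0 with hT | hT
  · intro t ht
    exact absurd (ht.1.trans ht.2) (not_le.2 hT)
  have hM0 : 0 ≤ M := (norm_nonneg _).trans (hub 0 ⟨le_rfl, hT⟩ 0)
  obtain ⟨N, hN⟩ := (isCompact_closedBall (0 : ℂ) M).exists_bound_of_continuousOn hF.continuousOn
  have hN' : ∀ w, ‖w‖ ≤ M → ‖F w‖ ≤ N := fun w hw => hN w (by simpa using hw)
  have hθ : ∀ t, gronwallFactor (fun _ => κ * L) 0 t = Real.exp (2 * (κ * L * t)) := fun t => by
    rw [gronwallFactor, intervalIntegral.integral_const, smul_eq_mul, sub_zero, mul_comm t]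
  have cu : ∀ s, Continuous (u s) := fun s => hu.cont.comp (Continuous.prodMk_right s)
  have cv : ∀ s, Continuous (v s) := fun s => hv.cont.comp (Continuous.prodMk_right s)
  -- Both solutions are mild, and the heat semigroup is bounded by κ in the W-norm, so Gronwall
  -- applies to |u - v|/W. Its crude initial bound 2M uses W ≥ 1.
  have main := gronwall_family (q := fun t x => ‖u t x - v t x‖ / W x) (t₀ := 0) (t₁ := T)
    (A := κ * δ) (M := 2 * M) (g := fun _ => κ * L) (by positivity) continuousOn_const
    (fun _ _ => by positivity) (by positivity) (fun t ht x => by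
      have h1 : ‖u t x - v t x‖ ≤ 2 * M :=
        (norm_sub_le _ _).trans (by linarith [hub t ht x, hvb t ht x])
      exact (div_le_self (norm_nonneg _) (hW1 x)).trans h1) ?_
  · intro t ht x
    have := main t ht x
    rwa [hθ, div_le_iff₀ (by linarith [hW1 x])] at this
  · intro P hP t ht hq x
    have hWx : 0 < W x := by linarith [hW1 x]
    rw [div_le_iff₀ hWx]
    have hs : ∀ s ∈ Icc 0 t, s ∈ Icc 0 T := fun s hs => ⟨hs.1, hs.2.trans ht.2⟩
    have eu := (hu.mono le_rfl ht.2).mild_formula ha ht.1 (fun s h => hub s (hs s h))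
      (fun s h z => hN' _ (hub s (hs s h) z)) x
    have ev := (hv.mono le_rfl ht.2).mild_formula ha ht.1 (fun s h => hvb s (hs s h))
      (fun s h z => hN' _ (hvb s (hs s h) z)) x
    have hint : ∀ {w wx wxx : ℝ → ℝ → ℂ}, SolvesOn a 0 T (fun t x => F (w t x)) w wx wxx →
        (∀ t ∈ Icc 0 T, ∀ x, ‖w t x‖ ≤ M) → IntervalIntegrable
        (fun s => gconv (heatK a) (t - s) (fun z => F (w s z)) x) volume 0 t := by
      intro w wx wxx hw hwb
      exact intervalIntegrable_mild_integrand ha ht.1 hw.cont_force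
        (fun s h z => hN' _ (hwb s (hs s h) z)) x
    have e : u t x - v t x = gconv (heatK a) (t - 0) (fun z => u 0 z - v 0 z) x +
        ∫ s in 0..t, gconv (heatK a) (t - s) (fun z => F (u s z) - F (v s z)) x := by
      rw [eu, ev, gconv_sub (decays_heatK ha) _ (cu 0) (cv 0) (hub 0 ⟨le_rfl, hT⟩)
        (hvb 0 ⟨le_rfl, hT⟩), add_sub_add_comm, ← intervalIntegral.integral_sub (hint hu hub)
        (hint hv hvb)]
      congr 1
      refine intervalIntegral.integral_congr fun s hs' => ?_
      rw [uIcc_of_le ht.1] at hs'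
      exact (gconv_sub (decays_heatK ha) _ (hF.comp (cu s)) (hF.comp (cv s))
        (fun z => hN' _ (hub s (hs s hs') z)) (fun z => hN' _ (hvb s (hs s hs') z)) x).symm
    rw [e, add_mul]
    refine (norm_add_le _ _).trans (add_le_add ?_ ?_)
    · rw [mul_assoc, sub_zero]
      exact hW t ht _ δ h0 x
    · have hθc : Continuous (gronwallFactor (fun _ => κ * L) 0) := by
        rw [show gronwallFactor (fun _ => κ * L) 0 = _ from funext hθ]; fun_prop
      refine (norm_intervalIntegral_le ht.1 (g := fun s => κ * L *
        (P * gronwallFactor (fun _ => κ * L) 0 s) * W x)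
        (Continuous.intervalIntegrable (by fun_prop) _ _) fun s hs' => ?_).trans
        (le_of_eq (intervalIntegral.integral_mul_const _ _))
      have hs'' := Ioo_subset_Icc_self hs'
      refine (hW (t - s) ⟨by linarith [hs'.2], by linarith [hs'.1, ht.2]⟩ _
        (L * (P * gronwallFactor (fun _ => κ * L) 0 s)) (fun z => ?_) x).trans (le_of_eq (by ring))
      have h1 := hq s hs'' z
      rw [div_le_iff₀ (by linarith [hW1 z])] at h1
      refine (hL _ _ (hub s (hs s hs'') z) (hvb s (hs s hs'') z)).trans ?_
      rw [mul_assoc]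
      gcongr

lemma norm_gconv_sub_le {a : ℂ} (ha : 0 < a.re) {τ : ℝ} (hτ : 0 < τ) {g : ℝ → ℂ}
    (hg : Continuous g) {M : ℝ} (hM : ∀ z, ‖g z‖ ≤ M) (x y : ℝ) :
    ‖gconv (heatK a) τ g x - gconv (heatK a) τ g y‖ ≤
      (√τ)⁻¹ * (mass (heatK₁ a) * M) * |x - y| := by
  have h := convex_univ.norm_image_sub_le_of_norm_hasDerivWithin_le (f := gconv (heatK a) τ g)
    (C := (√τ)⁻¹ * (mass (heatK₁ a) * M)) (x := y) (y := x)
    (fun z _ => (hasDerivAt_gconv_kernel (decays_heatK ha) (decays_heatK₁ ha)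
      (hasDerivAt_heatK a) hτ hg hM z).hasDerivWithinAt) (fun z _ => by
      rw [norm_mul, Complex.norm_real, Real.norm_of_nonneg (by positivity)]
      gcongr
      exact norm_gconv_le (decays_heatK₁ ha) _ hM z) (mem_univ _) (mem_univ _)
  simpa [Real.norm_eq_abs] using h

/-- Bounded solutions are Lipschitz in space, with a constant that depends on the bounds only. -/
theorem SolvesOn.norm_sub_space_le {a : ℂ} (ha : 0 < a.re) {t₀ t₁ : ℝ} (h01 : t₀ < t₁)
    {f u ux uxx : ℝ → ℝ → ℂ} (h : SolvesOn a t₀ t₁ f u ux uxx) {M N : ℝ}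
    (hM : ∀ s ∈ Icc t₀ t₁, ∀ z, ‖u s z‖ ≤ M) (hN : ∀ s ∈ Icc t₀ t₁, ∀ z, ‖f s z‖ ≤ N) (x y : ℝ) :
    ‖u t₁ x - u t₁ y‖ ≤ ((√(t₁ - t₀))⁻¹ * (mass (heatK₁ a) * M) +
      2 * √(t₁ - t₀) * (mass (heatK₁ a) * N)) * |x - y| := by
  have hi := fun x => intervalIntegrable_mild_integrand ha h01.le h.cont_force hN x
  rw [h.mild_formula ha h01.le hM hN x, h.mild_formula ha h01.le hM hN y, add_sub_add_comm,
    ← intervalIntegral.integral_sub (hi x) (hi y), add_mul]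
  refine (norm_add_le _ _).trans (add_le_add ?_ ?_)
  · exact norm_gconv_sub_le ha (by linarith) (h.cont.comp (Continuous.prodMk_right t₀))
      (hM t₀ ⟨le_rfl, h01.le⟩) x y
  · refine (norm_intervalIntegral_le h01.le (g := fun s => (√(t₁ - s))⁻¹ *
      (mass (heatK₁ a) * N * |x - y|)) ((intervalIntegrable_inv_sqrt_sub _ _ _).mul_const _)
      fun s hs => ?_).trans (le_of_eq ?_)
    · rw [← mul_assoc]
      exact norm_gconv_sub_le ha (by linarith [hs.2])
        (h.cont_force.comp (Continuous.prodMk_right s)) (hN s (Ioo_subset_Icc_self hs)) x y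
    · rw [intervalIntegral.integral_mul_const,
        intervalIntegral.integral_comp_sub_left (fun q => (√q)⁻¹), sub_self,
        integral_inv_sqrt (by linarith)]
      ring

/-- Bounds are known for t ≥ 0 only; freezing the solution at negative times makes every time
section bounded, as S t must have values in C_b for all real t. -/
lemma IsRegular.clamp {a : ℂ} {F : ℂ → ℂ} {u ux uxx : ℝ → ℝ → ℂ} (h : IsRegular a F u ux uxx) :
    IsRegular a F (fun t => u (max t 0)) ux uxx where
  cont := h.cont.comp (f := fun p : ℝ × ℝ => (max p.1 0, p.2)) (by fun_prop)
  bdd T := by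
    obtain ⟨M, hM⟩ := h.bdd T
    exact ⟨M, fun t ht x => by simpa only [max_eq_left ht.1] using hM t ht x⟩
  dx t ht x := by simpa only [max_eq_left ht.le] using h.dx t ht x
  dxx := h.dxx
  dt t ht x := by
    rw [max_eq_left ht.le]
    refine (h.dt t ht x).congr_of_eventuallyEq ?_
    filter_upwards [Ioi_mem_nhds ht] with s hs
    rw [max_eq_left (mem_Ioi.1 hs).le]
  cont_ux := h.cont_ux
  cont_uxx := h.cont_uxx
  bdd_ux := h.bdd_ux
  bdd_uxx := h.bdd_uxx

lemma IsRegular.shift {a : ℂ} {F : ℂ → ℂ} {u ux uxx : ℝ → ℝ → ℂ} (h : IsRegular a F u ux uxx)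
    {r : ℝ} (hr : 0 ≤ r) :
    IsRegular a F (fun t => u (t + r)) (fun t => ux (t + r)) (fun t => uxx (t + r)) where
  cont := h.cont.comp (f := fun p : ℝ × ℝ => (p.1 + r, p.2)) (by fun_prop)
  bdd T := by
    obtain ⟨M, hM⟩ := h.bdd (T + r)
    exact ⟨M, fun t ht x => hM _ ⟨by linarith [ht.1], by linarith [ht.2]⟩ x⟩
  dx t ht x := h.dx _ (by linarith) x
  dxx t ht x := h.dxx _ (by linarith) x
  dt t ht x := (h.dt (t + r) (by linarith) x).comp_add_const t r
  cont_ux := h.cont_ux.comp (f := fun p : ℝ × ℝ => (p.1 + r, p.2)) (by fun_prop)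
    fun p hp => ⟨add_pos_of_pos_of_nonneg hp.1 hr, trivial⟩
  cont_uxx := h.cont_uxx.comp (f := fun p : ℝ × ℝ => (p.1 + r, p.2)) (by fun_prop)
    fun p hp => ⟨add_pos_of_pos_of_nonneg hp.1 hr, trivial⟩
  bdd_ux t₀ T ht₀ := by
    obtain ⟨M, hM⟩ := h.bdd_ux (t₀ + r) (T + r) (by linarith)
    exact ⟨M, fun t ht x => hM _ ⟨by linarith [ht.1], by linarith [ht.2]⟩ x⟩
  bdd_uxx t₀ T ht₀ := by
    obtain ⟨M, hM⟩ := h.bdd_uxx (t₀ + r) (T + r) (by linarith)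
    exact ⟨M, fun t ht x => hM _ ⟨by linarith [ht.1], by linarith [ht.2]⟩ x⟩

/-! ### The solution map and its continuity. -/

/-- `S` is the solution map of `∂ₜ u = a ∂ₓ² u + F(u)` on the bounded continuous functions. -/
structure IsSolutionMap (a : ℂ) (F : ℂ → ℂ) (S : ℝ → (ℝ →ᵇ ℂ) → (ℝ →ᵇ ℂ)) : Prop where
  regular : ∀ u₀, ∃ ux uxx, IsRegular a F (fun t x => S t u₀ x) ux uxx
  zero : ∀ u₀, S 0 u₀ = u₀

theorem exists_isSolutionMap {a : ℂ} (ha : a.re = 1) {C : ℝ} {F : ℂ → ℂ}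
    (hF : DissipativeForce C F) (hF1 : ContDiff ℝ 1 F) : ∃ S, IsSolutionMap a F S := by
  choose u ux uxx h h0 using exists_isRegular ha hF hF1
  have hb : ∀ u₀ t, ∃ M, ∀ x, ‖u u₀ (max t 0) x‖ ≤ M := fun u₀ t => by
    obtain ⟨M, hM⟩ := (h u₀).bdd (max t 0)
    exact ⟨M, hM _ ⟨le_max_right _ _, le_rfl⟩⟩
  choose M hM using hb
  exact ⟨fun t u₀ => BoundedContinuousFunction.ofNormedAddCommGroup (u u₀ (max t 0))
    ((h u₀).cont.comp (Continuous.prodMk_right _)) (M u₀ t) (hM u₀ t),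
    fun u₀ => ⟨ux u₀, uxx u₀, (h u₀).clamp⟩, fun u₀ => by ext x; simpa using h0 u₀ x⟩

section SolutionMap

variable {a : ℂ} {C : ℝ} {F : ℂ → ℂ} {S : ℝ → (ℝ →ᵇ ℂ) → (ℝ →ᵇ ℂ)}

/-- Bounded solutions are unique. -/
theorem IsSolutionMap.eq_of_solvesOn (ha : 0 < a.re) (hF1 : ContDiff ℝ 1 F)
    (hS : IsSolutionMap a F S) {T M : ℝ} {v vx vxx : ℝ → ℝ → ℂ}
    (hv : SolvesOn a 0 T (fun t x => F (v t x)) v vx vxx)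
    (hvb : ∀ t ∈ Icc 0 T, ∀ x, ‖v t x‖ ≤ M) {u₀ : ℝ →ᵇ ℂ} (h0 : ∀ x, v 0 x = u₀ x) :
    ∀ t ∈ Icc 0 T, ∀ x, v t x = S t u₀ x := by
  intro t ht x
  obtain ⟨ux, uxx, h⟩ := hS.regular u₀
  obtain ⟨M', hM'⟩ := h.bdd T
  obtain ⟨L, hL0, hL⟩ := exists_lipschitzOn_ball hF1 (max M M')
  have := norm_sub_le_of_solvesOn ha hF1.continuous hL0 (mass_nonneg (heatK a)) le_rfl hL
    (W := fun _ => 1) (fun _ => le_rfl) (fun τ _ g N hg x => by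
      simp only [mul_one] at hg ⊢
      exact norm_gconv_le (decays_heatK ha) τ hg x)
    hv (h.solvesOn hF1.continuous le_rfl T) (fun t ht x => (hvb t ht x).trans (le_max_left _ _))
    (fun t ht x => (hM' t ht x).trans (le_max_right _ _))
    (fun x => by rw [h0, hS.zero]; simp) t ht x
  simpa [sub_eq_zero] using this

/-- The equation is autonomous, so the time translate is the solution that starts from S t u₀, by
uniqueness. -/
theorem IsSolutionMap.map_add (ha : 0 < a.re) (hF1 : ContDiff ℝ 1 F)
    (hS : IsSolutionMap a F S) {s t : ℝ} (hs : 0 ≤ s) (ht : 0 ≤ t) (u₀ : ℝ →ᵇ ℂ) :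
    S (s + t) u₀ = S s (S t u₀) := by
  obtain ⟨ux, uxx, h⟩ := hS.regular u₀
  obtain ⟨M, hM⟩ := (h.shift ht).bdd s
  ext x
  exact hS.eq_of_solvesOn ha hF1 ((h.shift ht).solvesOn hF1.continuous le_rfl s) hM
    (fun x => by rw [zero_add]) s ⟨hs, le_rfl⟩ x

/-- Uniform bounds on the solution map, and a radius of an absorbing ball. -/
theorem IsSolutionMap.exists_bounds (ha : a.re = 1) (hF : DissipativeForce C F)
    (hS : IsSolutionMap a F S) : ∃ (Φ : ℝ → ℝ) (R₀ : ℝ) (T₀ : ℝ → ℝ), (∀ m, 0 ≤ T₀ m) ∧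
      ∀ (u₀ : ℝ →ᵇ ℂ) (m : ℝ), ‖u₀‖ ≤ m →
        (∀ t, 0 ≤ t → ‖S t u₀‖ ≤ Φ m) ∧ (∀ t, T₀ m ≤ t → ‖S t u₀‖ ≤ R₀) := by
  obtain ⟨Φ, R₀, T₀, hT₀, h⟩ := exists_global_bounds a ha C
  refine ⟨Φ, R₀, T₀, hT₀, fun u₀ m hm => ?_⟩
  obtain ⟨ux, uxx, hu⟩ := hS.regular u₀
  obtain ⟨h1, h2⟩ := h F _ ux uxx hF hu m fun x => by
    rw [hS.zero]; exact (u₀.norm_coe_le_norm x).trans hm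
  exact ⟨fun t ht => BoundedContinuousFunction.norm_le_of_nonempty.2 (h1 t ht),
    fun t ht => BoundedContinuousFunction.norm_le_of_nonempty.2 (h2 t ht)⟩

/-- Dependence on the initial data in a weighted supremum norm, uniformly on bounded sets. -/
theorem IsSolutionMap.exists_norm_sub_le (ha : a.re = 1) (hF : DissipativeForce C F)
    (hF1 : ContDiff ℝ 1 F) (hS : IsSolutionMap a F S) {T κ : ℝ} (hκ0 : 0 ≤ κ) {W : ℝ → ℝ}
    (hW1 : ∀ x, 1 ≤ W x) (hW : ∀ τ ∈ Icc 0 T, ∀ (g : ℝ → ℂ) (N : ℝ), (∀ z, ‖g z‖ ≤ N * W z) →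
      ∀ x, ‖gconv (heatK a) τ g x‖ ≤ κ * (N * W x)) (m : ℝ) :
    ∃ B, 0 ≤ B ∧ ∀ u₀ v₀ : ℝ →ᵇ ℂ, ‖u₀‖ ≤ m → ‖v₀‖ ≤ m → ∀ η, 0 ≤ η →
      (∀ x, ‖u₀ x - v₀ x‖ ≤ η * W x) → ∀ t ∈ Icc 0 T, ∀ x, ‖S t u₀ x - S t v₀ x‖ ≤ B * η * W x := by
  have hare : 0 < a.re := by rw [ha]; exact one_pos
  obtain ⟨Φ, R₀, T₀, -, hb⟩ := hS.exists_bounds ha hF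
  obtain ⟨L, hL0, hL⟩ := exists_lipschitzOn_ball hF1 (Φ m)
  refine ⟨2 * κ * Real.exp (2 * (κ * L * T)), by positivity,
    fun u₀ v₀ hu₀ hv₀ η hη h0 t ht x => ?_⟩
  obtain ⟨ux, uxx, hu⟩ := hS.regular u₀
  obtain ⟨vx, vxx, hv⟩ := hS.regular v₀
  refine (norm_sub_le_of_solvesOn hare hF1.continuous hL0 hκ0 hη hL hW1 hW
    (hu.solvesOn hF1.continuous le_rfl T) (hv.solvesOn hF1.continuous le_rfl T)
    (fun t ht x => ((S t u₀).norm_coe_le_norm x).trans ((hb u₀ m hu₀).1 t ht.1))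
    (fun t ht x => ((S t v₀).norm_coe_le_norm x).trans ((hb v₀ m hv₀).1 t ht.1))
    (fun x => by rw [hS.zero, hS.zero]; exact h0 x) t ht x).trans ?_
  have h1 : Real.exp (2 * (κ * L * t)) ≤ Real.exp (2 * (κ * L * T)) := by
    gcongr; exact ht.2
  have h2 := zero_le_one.trans (hW1 x)
  calc 2 * (κ * η) * Real.exp (2 * (κ * L * t)) * W x
      ≤ 2 * (κ * η) * Real.exp (2 * (κ * L * T)) * W x := by gcongr
    _ = _ := by ring

theorem IsSolutionMap.exists_forall_norm_sub_lt (ha : a.re = 1) (hF : DissipativeForce C F)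
    (hF1 : ContDiff ℝ 1 F) (hS : IsSolutionMap a F S) (u₀ : ℝ →ᵇ ℂ) (T : ℝ) {ε : ℝ} (hε : 0 < ε) :
    ∃ η > 0, ∀ v₀ : ℝ →ᵇ ℂ, ‖v₀ - u₀‖ < η → ∀ t ∈ Icc 0 T, ‖S t v₀ - S t u₀‖ < ε := by
  have hare : 0 < a.re := by rw [ha]; exact one_pos
  obtain ⟨B, hB0, hB⟩ := hS.exists_norm_sub_le ha hF hF1 (T := T) (mass_nonneg (heatK a))
    (W := fun _ => 1) (fun _ => le_rfl) (fun τ _ g N hg x => by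
      simp only [mul_one] at hg ⊢
      exact norm_gconv_le (decays_heatK hare) τ hg x) (‖u₀‖ + 1)
  have hpos : 0 < ε / (2 * (B + 1)) := by positivity
  -- The 1 keeps the data in the ball of radius ‖u₀‖ + 1, for which B was chosen.
  refine ⟨min 1 (ε / (2 * (B + 1))), lt_min one_pos hpos, fun v₀ hv t ht => ?_⟩
  have h1 := (hv.trans_le (min_le_left _ _)).le
  have h2 := (hv.trans_le (min_le_right _ _)).le
  have h3 : ‖v₀‖ ≤ ‖u₀‖ + 1 := by
    have := norm_le_norm_add_norm_sub' v₀ u₀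
    linarith
  refine lt_of_le_of_lt (BoundedContinuousFunction.norm_le_of_nonempty.2 fun x => ?_)
    (half_lt_self hε)
  refine (hB v₀ u₀ h3 (by linarith) _ hpos.le (fun x => ?_) t ht x).trans ?_
  · rw [mul_one]
    exact ((v₀ - u₀).norm_coe_le_norm x).trans h2
  · rw [mul_one, ← div_div, mul_div_assoc']
    rw [div_le_iff₀ (by positivity)]
    nlinarith

/-- The solutions are continuous in time for `t > 0`, in the supremum norm. -/
theorem IsSolutionMap.continuousOn (hF : Continuous F) (hS : IsSolutionMap a F S)
    (u₀ : ℝ →ᵇ ℂ) : ContinuousOn (fun t => S t u₀) (Ioi 0) := by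
  intro t ht
  have ht' : 0 < t := ht
  refine ContinuousAt.continuousWithinAt ?_
  obtain ⟨ux, uxx, h⟩ := hS.regular u₀
  obtain ⟨M, hM⟩ := h.bdd (t + 1)
  obtain ⟨M₂, hM₂⟩ := h.bdd_uxx (t / 2) (t + 1) (by positivity)
  obtain ⟨N, hN⟩ := (isCompact_closedBall (0 : ℂ) M).exists_bound_of_continuousOn hF.continuousOn
  have hsub : Icc (t / 2) (t + 1) ⊆ Icc 0 (t + 1) := Icc_subset_Icc_left (by positivity)
  -- Away from t = 0, u_xx is bounded uniformly in x, hence so is ∂ₜu by the equation, and the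
  -- solution is Lipschitz in time in the supremum norm.
  have key : ∀ s ∈ Icc (t / 2) (t + 1), ‖S s u₀ - S t u₀‖ ≤ (‖a‖ * M₂ + N) * ‖s - t‖ := by
    intro s hs
    refine BoundedContinuousFunction.norm_le_of_nonempty.2 fun x => ?_
    refine (convex_Icc (t / 2) (t + 1)).norm_image_sub_le_of_norm_hasDerivWithin_le
      (f := fun s => S s u₀ x) (fun r hr => (h.dt r (by linarith [hr.1]) x).hasDerivWithinAt)
      (fun r hr => ?_) ⟨by linarith, by linarith⟩ hs
    refine (norm_add_le _ _).trans (add_le_add ?_ (hN _ (by simpa using hM r (hsub hr) x)))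
    rw [norm_mul]
    gcongr
    exact hM₂ r hr x
  rw [ContinuousAt, tendsto_iff_norm_sub_tendsto_zero]
  have hlim : Tendsto (fun s => (‖a‖ * M₂ + N) * ‖s - t‖) (𝓝 t) (𝓝 0) := by
    have : Continuous fun s => (‖a‖ * M₂ + N) * ‖s - t‖ := by fun_prop
    simpa using this.tendsto t
  refine squeeze_zero' (Eventually.of_forall fun _ => norm_nonneg _) ?_ hlim
  filter_upwards [Icc_mem_nhds (by linarith : t / 2 < t) (by linarith : t < t + 1)] with s hs
  exact key s hs

/-- After a unit time, solutions with values in a ball are Lipschitz with a uniform constant. -/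
theorem IsSolutionMap.exists_lipschitz (ha : 0 < a.re) (hF : Continuous F)
    (hS : IsSolutionMap a F S) (M : ℝ) : ∃ Λ : ℝ, ∀ (u₀ : ℝ →ᵇ ℂ) (t : ℝ), 1 ≤ t →
      (∀ s ∈ Icc (t - 1) t, ‖S s u₀‖ ≤ M) → ∀ x y, ‖S t u₀ x - S t u₀ y‖ ≤ Λ * |x - y| := by
  obtain ⟨N, hN⟩ := (isCompact_closedBall (0 : ℂ) M).exists_bound_of_continuousOn hF.continuousOn
  refine ⟨mass (heatK₁ a) * M + 2 * (mass (heatK₁ a) * N), fun u₀ t ht hM x y => ?_⟩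
  obtain ⟨ux, uxx, h⟩ := hS.regular u₀
  have hM' : ∀ s ∈ Icc (t - 1) t, ∀ x, ‖S s u₀ x‖ ≤ M := fun s hs x =>
    ((S s u₀).norm_coe_le_norm x).trans (hM s hs)
  have := (h.solvesOn hF (by linarith : 0 ≤ t - 1) t).norm_sub_space_le ha (by linarith) hM'
    (fun s hs z => hN _ (by simpa using hM' s hs z)) x y
  simpa using this

end SolutionMap

/-! ### The Ginzburg-Landau nonlinearity. -/

/-- The reaction term of the Ginzburg-Landau equation. -/
noncomputable def glForce (δ μ : ℝ) (H : ℝ → ℂ) (G : ℂ → ℂ) (w : ℂ) : ℂ :=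
  -((1 + Complex.I * δ) * w) - w * H (‖w‖ ^ 2) + μ * G w

lemma contDiff_glForce (δ μ : ℝ) {H : ℝ → ℂ} {G : ℂ → ℂ} (hH : ContDiff ℝ ∞ H)
    (hG : ContDiff ℝ ∞ G) : ContDiff ℝ 1 (glForce δ μ H G) := by
  have h1 : ContDiff ℝ 1 H := hH.of_le (by exact_mod_cast le_top)
  have h2 : ContDiff ℝ 1 G := hG.of_le (by exact_mod_cast le_top)
  have h3 : ContDiff ℝ 1 fun w : ℂ => H (‖w‖ ^ 2) := h1.comp (contDiff_norm_sq ℝ)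
  exact ((contDiff_const.mul contDiff_id).neg.sub (contDiff_id.mul h3)).add
    (contDiff_const.mul h2)

/-- The rotation iδ drops out of Re(F w̄), which equals -|w|² - h + μ Re(G w̄) with h = Re
H(|w|²)|w|². When |μ| K ≤ 1/2 the perturbation is at most (1 + |w|² + |h|)/2, and half of the
damping remains. -/
lemma dissipativeForce_glForce {δ μ C K : ℝ} {H : ℝ → ℂ} {G : ℂ → ℂ}
    (hH1 : ContDiff ℝ ∞ H) (hG1 : ContDiff ℝ ∞ G)
    (hH : ∀ z : ℝ, 0 ≤ z → -C ≤ (H z).re * z ∧ ‖H z‖ ≤ C * (1 + z ^ 2))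
    (hG : ∀ u : ℂ, ‖G u‖ ≤ K * (1 + ‖u‖ ^ 5) ∧
      |(G u * (starRingEnd ℂ) u).re| ≤ K * (1 + ‖u‖ ^ 2 + |(H (‖u‖ ^ 2)).re| * ‖u‖ ^ 2))
    (hμ : |μ| * K ≤ 1 / 2) :
    DissipativeForce (2 * (1 + |δ|) + 3 * C + 1) (glForce δ μ H G) := by
  have hC : 0 ≤ C := by simpa using (norm_nonneg _).trans (hH 0 le_rfl).2
  refine ⟨(contDiff_glForce δ μ hH1 hG1).continuous, fun w => ?_, fun w => ?_⟩
  · have e : inner ℝ w (glForce δ μ H G w) = -‖w‖ ^ 2 - (H (‖w‖ ^ 2)).re * ‖w‖ ^ 2 +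
        μ * (G w * (starRingEnd ℂ) w).re := by
      rw [show -‖w‖ ^ 2 - (H (‖w‖ ^ 2)).re * ‖w‖ ^ 2 + μ * (G w * (starRingEnd ℂ) w).re =
        -(w.re * w.re + w.im * w.im) * (1 + (H (‖w‖ ^ 2)).re) +
          μ * (G w * (starRingEnd ℂ) w).re by
            rw [← Complex.normSq_apply, Complex.normSq_eq_norm_sq]; ring, Complex.inner]
      simp only [glForce, Complex.mul_re, Complex.mul_im, Complex.add_re, Complex.add_im,
        Complex.sub_re, Complex.sub_im, Complex.neg_re, Complex.neg_im, Complex.conj_re,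
        Complex.conj_im, Complex.I_re, Complex.I_im, Complex.one_re, Complex.one_im,
        Complex.ofReal_re, Complex.ofReal_im]
      ring
    have h1 := (hH (‖w‖ ^ 2) (by positivity)).1
    have h2 := (hG w).2
    rw [show |(H (‖w‖ ^ 2)).re| * ‖w‖ ^ 2 = |(H (‖w‖ ^ 2)).re * ‖w‖ ^ 2| by
      rw [abs_mul, abs_of_nonneg (sq_nonneg ‖w‖)]] at h2
    -- From h ≥ -C: the absolute value exceeds h by at most 2C, so |h|/2 is absorbed by -h up to a
    -- constant.
    have h3 : |(H (‖w‖ ^ 2)).re * ‖w‖ ^ 2| ≤ (H (‖w‖ ^ 2)).re * ‖w‖ ^ 2 + 2 * C :=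
      abs_le.2 ⟨by linarith, by linarith⟩
    have h4 : μ * (G w * (starRingEnd ℂ) w).re ≤
        1 / 2 * (1 + ‖w‖ ^ 2 + |(H (‖w‖ ^ 2)).re * ‖w‖ ^ 2|) := by
      refine (le_abs_self _).trans ?_
      rw [abs_mul]
      calc |μ| * |(G w * (starRingEnd ℂ) w).re|
          ≤ |μ| * (K * (1 + ‖w‖ ^ 2 + |(H (‖w‖ ^ 2)).re * ‖w‖ ^ 2|)) := by gcongr
        _ = |μ| * K * (1 + ‖w‖ ^ 2 + |(H (‖w‖ ^ 2)).re * ‖w‖ ^ 2|) := by ring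
        _ ≤ _ := by gcongr
    have h5 := abs_nonneg δ
    rw [e]
    linarith
  · have h1 := (hH (‖w‖ ^ 2) (by positivity)).2
    have h2 := (hG w).1
    have h3 := half_le_one_add_pow_five (norm_nonneg w)
    have h4 : ‖(1 : ℂ) + Complex.I * δ‖ ≤ 1 + |δ| := by
      refine (norm_add_le _ _).trans ?_
      simp
    have h5 : 0 ≤ ‖w‖ ^ 5 := by positivity
    have h6 : ‖(1 + Complex.I * δ) * w‖ ≤ (1 + |δ|) * (2 * (1 + ‖w‖ ^ 5)) := by
      rw [norm_mul]
      gcongr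
      linarith
    have h7 : ‖w * H (‖w‖ ^ 2)‖ ≤ C * (3 * (1 + ‖w‖ ^ 5)) := by
      rw [norm_mul]
      calc ‖w‖ * ‖H (‖w‖ ^ 2)‖ ≤ ‖w‖ * (C * (1 + (‖w‖ ^ 2) ^ 2)) := by gcongr
        _ = C * (‖w‖ + ‖w‖ ^ 5) := by ring
        _ ≤ _ := by gcongr; linarith
    have h8 : ‖(μ : ℂ) * G w‖ ≤ 1 / 2 * (1 + ‖w‖ ^ 5) := by
      rw [norm_mul, Complex.norm_real, Real.norm_eq_abs]
      calc |μ| * ‖G w‖ ≤ |μ| * (K * (1 + ‖w‖ ^ 5)) := by gcongr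
        _ = |μ| * K * (1 + ‖w‖ ^ 5) := by ring
        _ ≤ _ := by gcongr
    refine (norm_add_le _ _).trans ((add_le_add_left (norm_sub_le _ _) _).trans ?_)
    rw [norm_neg]
    nlinarith [abs_nonneg δ]

lemma iteratedDeriv_two_eq {f : ℝ → ℂ} : iteratedDeriv 2 f = deriv (deriv f) := by
  rw [iteratedDeriv_succ, iteratedDeriv_one]

/-- Regular solutions are classical solutions of the Ginzburg-Landau equation. -/
theorem IsRegular.isGLSolution {β δ μ : ℝ} {H : ℝ → ℂ} {G : ℂ → ℂ} {u ux uxx : ℝ → ℝ → ℂ}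
    (hF : Continuous (glForce δ μ H G))
    (h : IsRegular (1 + Complex.I * β) (glForce δ μ H G) u ux uxx) (T : ℝ) :
    IsGLSolution β δ μ H G T u := by
  have e1 : ∀ t, 0 < t → deriv (u t) = ux t := fun t ht => funext fun x => (h.dx t ht x).deriv
  have e2 : ∀ t, 0 < t → iteratedDeriv 2 (u t) = uxx t := fun t ht => by
    rw [iteratedDeriv_two_eq, e1 t ht]
    exact funext fun x => (h.dxx t ht x).deriv
  have hsub : Ioo 0 T ×ˢ (univ : Set ℝ) ⊆ Ioi 0 ×ˢ univ :=
    prod_mono (fun t ht => ht.1) subset_rfl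
  refine ⟨h.cont.continuousOn, h.bdd T, fun t ht x => (h.dt t ht.1 x).differentiableAt,
    fun t ht => ?_, ?_, ?_, fun t ht x => ?_⟩
  · rw [show (2 : WithTop ℕ∞) = 1 + 1 by norm_num, contDiff_succ_iff_deriv]
    refine ⟨fun x => (h.dx t ht.1 x).differentiableAt, by simp, ?_⟩
    rw [e1 t ht.1, contDiff_one_iff_deriv]
    refine ⟨fun x => (h.dxx t ht.1 x).differentiableAt, ?_⟩
    rw [show deriv (ux t) = uxx t from funext fun x => (h.dxx t ht.1 x).deriv]
    exact h.continuous_uxx ht.1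
  · refine (((continuousOn_const (c := 1 + Complex.I * (β : ℂ))).mul (h.cont_uxx.mono hsub)).add
      (hF.comp h.cont).continuousOn).congr fun p hp => ?_
    exact (h.dt p.1 hp.1.1 p.2).deriv
  · refine (h.cont_uxx.mono hsub).congr fun p hp => ?_
    exact congrFun (e2 p.1 hp.1.1) p.2
  · rw [(h.dt t ht.1 x).deriv, e2 t ht.1, glForce]
    ring

/-- A classical solution on `[0, T]`, frozen outside of this interval. -/
theorem solvesOn_of_isGLSolution {β δ μ T : ℝ} {H : ℝ → ℂ} {G : ℂ → ℂ} {u : ℝ → ℝ → ℂ}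
    (hF : Continuous (glForce δ μ H G)) (h : IsGLSolution β δ μ H G T u) (hT : 0 ≤ T) :
    SolvesOn (1 + Complex.I * β) 0 T (fun t x => glForce δ μ H G (u (max 0 (min t T)) x))
      (fun t => u (max 0 (min t T))) (fun t => deriv (u t)) (fun t => iteratedDeriv 2 (u t)) := by
  have e : ∀ t ∈ Ioo 0 T, max 0 (min t T) = t := fun t ht => by
    rw [min_eq_left ht.2.le, max_eq_right ht.1.le]
  have hc : Continuous (Function.uncurry fun t => u (max 0 (min t T))) :=
    h.continuousOn.comp_continuous (f := fun p : ℝ × ℝ => (max 0 (min p.1 T), p.2)) (by fun_prop)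
      fun p => ⟨⟨le_max_left _ _, max_le hT (min_le_right _ _)⟩, trivial⟩
  refine ⟨hc, hF.comp hc, fun t ht x => ?_, fun t ht x => ?_, fun t ht x => ?_,
    h.continuousOn_deriv_space⟩
  · simp only [e t ht]
    exact ((h.contDiff_space t ht).differentiable two_ne_zero x).hasDerivAt
  · rw [iteratedDeriv_two_eq]
    have h1 := h.contDiff_space t ht
    rw [show (2 : WithTop ℕ∞) = 1 + 1 by norm_num, contDiff_succ_iff_deriv] at h1
    exact (h1.2.2.differentiable one_ne_zero x).hasDerivAt
  · simp only [e t ht]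
    have h1 := (h.differentiable_time t ht x).hasDerivAt
    rw [h.equation t ht x] at h1
    refine HasDerivAt.congr_of_eventuallyEq (h1.congr_deriv ?_) ?_
    · rw [glForce]
      ring
    · filter_upwards [Ioo_mem_nhds ht.1 ht.2] with s hs
      rw [e s hs]

section SolutionMap

variable {β δ μ C : ℝ} {H : ℝ → ℂ} {G : ℂ → ℂ} {S : ℝ → (ℝ →ᵇ ℂ) → (ℝ →ᵇ ℂ)}

theorem IsSolutionMap.isGLWellPosedWith (hF : DissipativeForce C (glForce δ μ H G))
    (hF1 : ContDiff ℝ 1 (glForce δ μ H G))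
    (hS : IsSolutionMap (1 + Complex.I * β) (glForce δ μ H G) S) :
    IsGLWellPosedWith β δ μ H G S := by
  have ha : (1 + Complex.I * β).re = 1 := by simp
  have hare : 0 < (1 + Complex.I * β).re := by rw [ha]; exact one_pos
  refine ⟨hS.zero, fun u₀ T _ => ?_, fun u₀ T u hu h0 t ht x => ?_, hS.continuousOn hF.cont,
    fun u₀ T ε hε => hS.exists_forall_norm_sub_lt ha hF hF1 u₀ T hε⟩
  · obtain ⟨ux, uxx, h⟩ := hS.regular u₀
    exact h.isGLSolution hF.cont T
  · have hT : 0 ≤ T := ht.1.trans ht.2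
    obtain ⟨M, hM⟩ := hu.bounded
    have := hS.eq_of_solvesOn hare hF1 (solvesOn_of_isGLSolution hF.cont hu hT) (M := M)
      (fun t _ x => hM _ ⟨le_max_left _ _, max_le hT (min_le_right _ _)⟩ x) (u₀ := u₀)
      (fun x => by rw [min_eq_left hT, max_self, h0]) t ht x
    rwa [min_eq_left ht.2, max_eq_right ht.1] at this

end SolutionMap

theorem IsSolutionMap.isSemigroupOnCb {a : ℂ} (ha : 0 < a.re) {F : ℂ → ℂ} (hF : ContDiff ℝ 1 F)
    {S : ℝ → (ℝ →ᵇ ℂ) → (ℝ →ᵇ ℂ)} (hS : IsSolutionMap a F S) : IsSemigroupOnCb S :=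
  ⟨hS.zero, fun _ _ hs ht u₀ => hS.map_add ha hF hs ht u₀⟩

theorem IsSolutionMap.isDissipativeOnCb {a : ℂ} (ha : a.re = 1) {C : ℝ} {F : ℂ → ℂ}
    (hF : DissipativeForce C F) {S : ℝ → (ℝ →ᵇ ℂ) → (ℝ →ᵇ ℂ)} (hS : IsSolutionMap a F S) :
    IsDissipativeOnCb S := by
  obtain ⟨Φ, R₀, T₀, hT₀, h⟩ := hS.exists_bounds ha hF
  refine ⟨R₀, fun B hB => ?_⟩
  obtain ⟨m, hm⟩ := hB.exists_norm_le
  exact ⟨T₀ m, hT₀ m, fun t ht u hu => (h u m (hm u hu)).2 t ht⟩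

/-! ### Abstract construction of the attractor. -/

section Attractor

variable {S : ℝ → (ℝ →ᵇ ℂ) → (ℝ →ᵇ ℂ)}

/-- The filter of the tails of the trajectories that start in `B`. -/
def tailFilter (S : ℝ → (ℝ →ᵇ ℂ) → (ℝ →ᵇ ℂ)) (B : Set (ℝ →ᵇ ℂ)) : Filter (ℝ →ᵇ ℂ) :=
  map (fun p : ℝ × (ℝ →ᵇ ℂ) => S p.1 p.2) (atTop ×ˢ 𝓟 B)

lemma mem_tailFilter {B s : Set (ℝ →ᵇ ℂ)} :
    s ∈ tailFilter S B ↔ ∃ T, ∀ t, T ≤ t → ∀ u ∈ B, S t u ∈ s := by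
  rw [tailFilter, mem_map, ← eventually_atTop]
  exact eventually_prod_principal_iff

/-- S t moves a tail by t, and tails do not notice a shift. Equality, not just one inequality, is
what yields both inclusions of strict invariance. -/
lemma map_tailFilter (hS : IsSemigroupOnCb S) {t : ℝ} (ht : 0 ≤ t) (B : Set (ℝ →ᵇ ℂ)) :
    map (S t) (tailFilter S B) = tailFilter S B := by
  ext s
  rw [mem_map, mem_tailFilter, mem_tailFilter]
  constructor
  · rintro ⟨T, hT⟩
    refine ⟨max T 0 + t, fun r hr u hu => ?_⟩
    have h1 := le_max_left T 0
    have h2 := le_max_right T 0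
    have := hT (r - t) (by linarith) u hu
    rwa [mem_preimage, ← hS.add t (r - t) ht (by linarith), add_sub_cancel] at this
  · rintro ⟨T, hT⟩
    refine ⟨max T 0, fun r hr u hu => ?_⟩
    have h1 := le_max_left T 0
    have h2 := le_max_right T 0
    rw [mem_preimage, ← hS.add t r ht (by linarith)]
    exact hT _ (by linarith) u hu

lemma tailFilter_le_of_absorbed (hS : IsSemigroupOnCb S) {B D : Set (ℝ →ᵇ ℂ)} {T : ℝ}
    (hT : 0 ≤ T) (h : ∀ u ∈ B, S T u ∈ D) : tailFilter S B ≤ tailFilter S D := by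
  intro s hs
  obtain ⟨T', hT'⟩ := mem_tailFilter.1 hs
  refine mem_tailFilter.2 ⟨max T' 0 + T, fun r hr u hu => ?_⟩
  have h1 := le_max_left T' 0
  have h2 := le_max_right T' 0
  have := hT' (r - T) (by linarith) _ (h u hu)
  rwa [← hS.add (r - T) T (by linarith) hT, sub_add_cancel] at this

lemma toContinuousMap_injective :
    Function.Injective fun u : ℝ →ᵇ ℂ => u.toContinuousMap := by
  intro u v h
  ext x
  exact DFunLike.congr_fun h x

/-- A semigroup with a locally compact absorbing set, continuous on the absorbing ball in the
topology of locally uniform convergence, has a global attractor: the set of the locally uniform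
limit points of the trajectories from the ball. -/
theorem exists_attractor (hS : IsSemigroupOnCb S) {R : ℝ} {K : Set C(ℝ, ℂ)} (hK : IsCompact K)
    (hKR : ∀ g ∈ K, ∃ u : ℝ →ᵇ ℂ, u.toContinuousMap = g ∧ ‖u‖ ≤ R)
    (habs : ∀ B : Set (ℝ →ᵇ ℂ), Bornology.IsBounded B →
      ∃ T : ℝ, 0 ≤ T ∧ ∀ t, T ≤ t → ∀ u ∈ B, (S t u).toContinuousMap ∈ K)
    (hcont : ∀ t, 0 ≤ t → ∀ u : ℝ →ᵇ ℂ, ‖u‖ ≤ R → ∀ l : Filter (ℝ →ᵇ ℂ),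
      (∀ᶠ v in l, ‖v‖ ≤ R) → Tendsto (fun v => v.toContinuousMap) l (𝓝 u.toContinuousMap) →
      Tendsto (fun v => (S t v).toContinuousMap) l (𝓝 (S t u).toContinuousMap)) :
    ∃ A, IsLocallyCompactGlobalAttractor S A := by
  set ι : (ℝ →ᵇ ℂ) → C(ℝ, ℂ) := fun u => u.toContinuousMap with hι
  set D : Set (ℝ →ᵇ ℂ) := Metric.closedBall 0 R with hD
  have hD' : ∀ u, u ∈ D ↔ ‖u‖ ≤ R := fun u => mem_closedBall_zero_iff
  have hιK : ι ⁻¹' K ⊆ D := fun u hu => by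
    obtain ⟨v, hv, hvR⟩ := hKR _ hu
    rw [hD', ← toContinuousMap_injective hv]
    exact hvR
  have htail : ∀ B, Bornology.IsBounded B → ι ⁻¹' K ∈ tailFilter S B := fun B hB => by
    obtain ⟨T, -, hT⟩ := habs B hB
    exact mem_tailFilter.2 ⟨T, hT⟩
  have hDb : Bornology.IsBounded D := Metric.isBounded_closedBall
  set 𝓕 := tailFilter S D with h𝓕
  have hle : ∀ B, Bornology.IsBounded B → tailFilter S B ≤ 𝓕 := fun B hB => by
    obtain ⟨T, hT0, hT⟩ := habs B hB
    exact tailFilter_le_of_absorbed hS hT0 fun u hu => hιK (hT T le_rfl u hu)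
  -- The ω-limit set of the ball in C_loc. It lies in K, and each member of K comes from a bounded
  -- function, so its preimage in C_b loses nothing.
  set E : Set C(ℝ, ℂ) := {g | ClusterPt g (map ι 𝓕)} with hE
  have hEc : IsClosed E := isClosed_setOfPred_clusterPt
  have hEK : E ⊆ K := fun g hg =>
    hK.isClosed.closure_subset (mem_closure_iff_clusterPt.2
      (hg.mono (le_principal_iff.2 (htail D hDb))))
  have hEA : toCloc (ι ⁻¹' E) = E := by
    refine image_preimage_eq_of_subset fun g hg => ?_
    obtain ⟨u, hu, -⟩ := hKR g (hEK hg)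
    exact ⟨u, hu⟩
  have hAD : ι ⁻¹' E ⊆ D := (preimage_mono hEK).trans hιK
  refine ⟨ι ⁻¹' E, hDb.subset hAD, ?_, fun t ht => Subset.antisymm ?_ fun w hw => ?_,
    fun O hO hAO B hB => ?_⟩
  · rw [hEA]
    exact hK.of_isClosed_subset hEc hEK
  · rintro _ ⟨u, hu, rfl⟩
    obtain ⟨U, hU, hUu⟩ := mapClusterPt_iff_ultrafilter.1 (show MapClusterPt (ι u) 𝓕 ι from hu)
    refine mapClusterPt_iff_ultrafilter.2 ⟨U.map (S t), ?_, ?_⟩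
    · rw [h𝓕, ← map_tailFilter hS ht D]
      exact map_mono hU
    · exact tendsto_map'_iff.2 (hcont t ht u ((hD' u).1 (hAD hu)) U
        (hU (mem_of_superset (htail D hDb) fun v hv => (hD' v).1 (hιK hv))) hUu)
  -- Backward invariance: since S t maps the tail filter onto itself, an ultrafilter U in it that
  -- converges to w has a lift V in the tail filter with S t V ≤ U. Compactness of K gives V a limit
  -- v, and continuity gives S t v = w.
  · obtain ⟨U, hU, hUw⟩ := mapClusterPt_iff_ultrafilter.1 (show MapClusterPt (ι w) 𝓕 ι from hw)
    have hne : (𝓕 ⊓ comap (S t) U).NeBot := by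
      rw [← map_neBot_iff (S t), Filter.push_pull, h𝓕, map_tailFilter hS ht D, ← h𝓕,
        inf_eq_right.2 hU]
      exact U.neBot
    set V := Ultrafilter.of (𝓕 ⊓ comap (S t) U) with hV
    have hV1 : (V : Filter (ℝ →ᵇ ℂ)) ≤ 𝓕 := (Ultrafilter.of_le _).trans inf_le_left
    have hV2 : map (S t) V ≤ U := map_le_iff_le_comap.2 ((Ultrafilter.of_le _).trans inf_le_right)
    obtain ⟨g, hg, hVg⟩ := hK.ultrafilter_le_nhds (V.map ι)
      (le_principal_iff.2 (hV1 (htail D hDb)))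
    obtain ⟨v, rfl, hvR⟩ := hKR g hg
    refine ⟨v, mapClusterPt_iff_ultrafilter.2 ⟨V, hV1, hVg⟩, toContinuousMap_injective ?_⟩
    refine tendsto_nhds_unique (hcont t ht v hvR V
        (hV1 (mem_of_superset (htail D hDb) fun v hv => (hD' v).1 (hιK hv))) hVg) ?_
    exact hUw.comp hV2
  · rw [hEA] at hAO
    -- A filter living in a compact set contains every open neighbourhood of its cluster points;
    -- this is attraction.
    have hO' : O ∈ map ι 𝓕 := hK.adherence_nhdset (le_principal_iff.2 (htail D hDb)) hO
      fun g _ hg => hAO hg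
    obtain ⟨T, hT⟩ := mem_tailFilter.1 (hle B hB hO')
    refine ⟨max T 0, le_max_right _ _, fun t ht => ?_⟩
    rintro _ ⟨_, ⟨u, hu, rfl⟩, rfl⟩
    exact hT t ((le_max_left _ _).trans ht) u hu

end Attractor

/-! ### Compactness and the attractor of the equation. -/

/-- Uniformly bounded and uniformly Lipschitz functions form a compact set in the topology of
locally uniform convergence. -/
lemma isCompact_setOf_bounded_lipschitz (R Λ : ℝ) :
    IsCompact {g : C(ℝ, ℂ) | (∀ x, ‖g x‖ ≤ R) ∧ ∀ x y, ‖g x - g y‖ ≤ Λ * |x - y|} := by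
  refine ArzelaAscoli.isCompact_of_equicontinuous _ ?_ ?_
  -- For pointwise convergence this is Tychonoff: the conditions are closed and already force
  -- continuity.
  · have h : IsCompact {f : ℝ → ℂ | (∀ x, ‖f x‖ ≤ R) ∧ ∀ x y, ‖f x - f y‖ ≤ Λ * |x - y|} := by
      refine (isCompact_univ_pi fun _ => isCompact_closedBall (0 : ℂ) R).of_isClosed_subset ?_
        fun f hf x _ => mem_closedBall_zero_iff.2 (hf.1 x)
      simp only [ofPred_and, ofPred_forall]
      exact (isClosed_iInter fun x => isClosed_le (by fun_prop) continuous_const).inter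
        (isClosed_iInter fun x => isClosed_iInter fun y =>
          isClosed_le (by fun_prop) continuous_const)
    convert h using 1
    ext f
    constructor
    · rintro ⟨g, hg, rfl⟩
      exact hg
    · intro hf
      have hc : Continuous f := by
        refine (LipschitzWith.of_dist_le_mul (K := Λ.toNNReal) fun x y => ?_).continuous
        rw [dist_eq_norm, Real.dist_eq]
        refine (hf.2 x y).trans ?_
        gcongr
        exact Real.le_coe_toNNReal Λ
      exact ⟨⟨f, hc⟩, hf, rfl⟩
  · refine Metric.equicontinuous_of_continuity_modulus (fun d => Λ * d) ?_ _ fun x y g => ?_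
    · have : Continuous fun d : ℝ => Λ * d := by fun_prop
      simpa using this.tendsto 0
    · rw [dist_eq_norm, Real.dist_eq]
      exact g.2.2 x y

/-- On bounded sets, the solution map is continuous for the locally uniform convergence. -/
theorem IsSolutionMap.tendsto_toContinuousMap {a : ℂ} (ha : a.re = 1) {C : ℝ} {F : ℂ → ℂ}
    (hF : DissipativeForce C F) (hF1 : ContDiff ℝ 1 F) {S : ℝ → (ℝ →ᵇ ℂ) → (ℝ →ᵇ ℂ)}
    (hS : IsSolutionMap a F S) {R t : ℝ} (ht : 0 ≤ t) {u : ℝ →ᵇ ℂ} (hu : ‖u‖ ≤ R)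
    {l : Filter (ℝ →ᵇ ℂ)} (hl : ∀ᶠ v in l, ‖v‖ ≤ R)
    (h : Tendsto (fun v => v.toContinuousMap) l (𝓝 u.toContinuousMap)) :
    Tendsto (fun v => (S t v).toContinuousMap) l (𝓝 (S t u).toContinuousMap) := by
  have hare : 0 < a.re := by rw [ha]; exact one_pos
  have hR : 0 ≤ R := (norm_nonneg u).trans hu
  have hm := mass_nonneg (heatK a)
  obtain ⟨B, hB0, hB⟩ := hS.exists_norm_sub_le ha hF hF1 (T := t)
    (κ := mass (heatK a) * (2 * (1 + t))) (by positivity) (W := fun x => 1 + x ^ 2)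
    (fun x => by nlinarith [sq_nonneg x]) (fun τ hτ g N hg x => by
      have hN : 0 ≤ N := by simpa using (norm_nonneg _).trans (hg 0)
      refine (norm_gconv_le_weight (decays_heatK hare) hτ.1 hg x).trans ?_
      gcongr
      exact hτ.2) R
  rw [ContinuousMap.tendsto_iff_forall_isCompact_tendstoUniformlyOn] at h ⊢
  intro Kc hKc
  rw [Metric.tendstoUniformlyOn_iff]
  intro ε hε
  obtain ⟨ρ, hρ⟩ := hKc.isBounded.exists_norm_le
  -- On the compact set |x| ≤ ρ, so a weighted difference of size η at time 0 becomes at most Bη(1 +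
  -- ρ²) < ε at time t.
  set η : ℝ := ε / ((B + 1) * (1 + ρ ^ 2)) with hη
  have hη0 : 0 < η := by positivity
  -- Outside [-r, r] the trivial bound 2R ≤ ηr ≤ η(1 + x²) is enough, so closeness on [-r, r]
  -- controls the weighted norm on the whole line.
  set r : ℝ := 1 + 2 * R / η with hr
  have hr1 : 1 ≤ r := by rw [hr]; have : 0 ≤ 2 * R / η := by positivity
                         linarith
  have hrR : 2 * R ≤ η * r := by
    rw [hr, mul_add, mul_div_cancel₀ _ hη0.ne']
    linarith
  filter_upwards [hl, Metric.tendstoUniformlyOn_iff.1 (h (Icc (-r) r) isCompact_Icc) η hη0]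
    with v hv hvu x hx
  rw [dist_eq_norm]
  have key : ∀ x, ‖u x - v x‖ ≤ η * (1 + x ^ 2) := fun x => by
    rcases le_or_gt |x| r with hxr | hxr
    · have h1 := (hvu x (abs_le.1 hxr)).le
      rw [dist_eq_norm] at h1
      refine h1.trans ?_
      nlinarith [sq_nonneg x]
    · have h1 : ‖u x - v x‖ ≤ 2 * R := by
        refine (norm_sub_le _ _).trans ?_
        have := u.norm_coe_le_norm x
        have := v.norm_coe_le_norm x
        linarith
      have h2 : r ≤ x ^ 2 := by
        rw [← sq_abs]
        nlinarith
      refine h1.trans (hrR.trans ?_)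
      gcongr
      linarith
  have h1 := hB u v hu hv η hη0.le key t ⟨ht, le_rfl⟩ x
  have h2 : x ^ 2 ≤ ρ ^ 2 := by
    rw [← sq_abs x]
    have := hρ x hx
    rw [Real.norm_eq_abs] at this
    gcongr
  refine h1.trans_lt ?_
  calc B * η * (1 + x ^ 2) ≤ B * η * (1 + ρ ^ 2) := by gcongr
    _ < (B + 1) * η * (1 + ρ ^ 2) := by gcongr; linarith
    _ = ε := by rw [hη]; field_simp

theorem IsSolutionMap.exists_attractor {a : ℂ} (ha : a.re = 1) {C : ℝ} {F : ℂ → ℂ}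
    (hF : DissipativeForce C F) (hF1 : ContDiff ℝ 1 F) {S : ℝ → (ℝ →ᵇ ℂ) → (ℝ →ᵇ ℂ)}
    (hS : IsSolutionMap a F S) : ∃ A, IsLocallyCompactGlobalAttractor S A := by
  have hare : 0 < a.re := by rw [ha]; exact one_pos
  obtain ⟨Φ, R₀, T₀, hT₀, hb⟩ := hS.exists_bounds ha hF
  obtain ⟨Λ, hΛ⟩ := hS.exists_lipschitz hare hF.cont R₀
  refine GinzburgLandau.exists_attractor (R := R₀) (hS.isSemigroupOnCb hare hF1)
    (isCompact_setOf_bounded_lipschitz R₀ Λ) (fun g hg => ?_) (fun B hB => ?_)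
    fun t ht u hu l hl h => hS.tendsto_toContinuousMap ha hF hF1 ht hu hl h
  · exact ⟨BoundedContinuousFunction.ofNormedAddCommGroup g g.continuous R₀ hg.1, rfl,
      BoundedContinuousFunction.norm_le_of_nonempty.2 hg.1⟩
  · obtain ⟨m, hm⟩ := hB.exists_norm_le
    have hT := hT₀ m
    -- The uniform Lipschitz bound needs the solution to have spent a unit of time in the absorbing
    -- ball.
    refine ⟨T₀ m + 1, by linarith, fun t ht u hu => ⟨fun x => ?_, ?_⟩⟩
    · exact ((S t u).norm_coe_le_norm x).trans ((hb u m (hm u hu)).2 t (by linarith))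
    · exact hΛ u t (by linarith) fun s hs => (hb u m (hm u hu)).2 s (by linarith [hs.1])

end GinzburgLandau

theorem proposition1 (β δ : ℝ) (H : ℝ → ℂ) (G : ℂ → ℂ)
    (hH_smooth : ContDiff ℝ ∞ H) (hH_zero : H 0 = 0) (hG_smooth : ContDiff ℝ ∞ G)
    (hH : ∃ C : ℝ, ∀ z : ℝ, 0 ≤ z → -C ≤ (H z).re * z ∧ ‖H z‖ ≤ C * (1 + z ^ 2))
    (hG : ∃ K : ℝ, ∀ u : ℂ, ‖G u‖ ≤ K * (1 + ‖u‖ ^ 5) ∧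
      |(G u * (starRingEnd ℂ) u).re| ≤ K * (1 + ‖u‖ ^ 2 + |(H (‖u‖ ^ 2)).re| * ‖u‖ ^ 2)) :
    ∃ μ₀ > 0, ∀ μ : ℝ, |μ| < μ₀ →
      ∃ S : ℝ → (ℝ →ᵇ ℂ) → (ℝ →ᵇ ℂ),
        IsGLWellPosedWith β δ μ H G S ∧ IsSemigroupOnCb S ∧ IsDissipativeOnCb S ∧
          ∃ A : Set (ℝ →ᵇ ℂ), IsLocallyCompactGlobalAttractor S A := by
  obtain ⟨C, hC⟩ := hH
  obtain ⟨K, hK⟩ := hG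
  have hK0 : 0 ≤ K := by simpa using (norm_nonneg _).trans (hK 0).1
  -- This ensures |μ| K ≤ 1/2; K + 1 keeps the threshold positive and finite when K = 0.
  refine ⟨1 / (2 * (K + 1)), by positivity, fun μ hμ => ?_⟩
  have hμK : |μ| * K ≤ 1 / 2 := by
    rw [lt_div_iff₀ (by positivity)] at hμ
    nlinarith [abs_nonneg μ]
  have ha : (1 + Complex.I * β).re = 1 := by simp
  have hare : 0 < (1 + Complex.I * β).re := by rw [ha]; exact one_pos
  have hF := GinzburgLandau.dissipativeForce_glForce (δ := δ) hH_smooth hG_smooth hC hK hμK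
  have hF1 := GinzburgLandau.contDiff_glForce δ μ hH_smooth hG_smooth
  obtain ⟨S, hS⟩ := GinzburgLandau.exists_isSolutionMap ha hF hF1
  exact ⟨S, hS.isGLWellPosedWith hF hF1, hS.isSemigroupOnCb hare hF1, hS.isDissipativeOnCb ha hF,
    hS.exists_attractor ha hF hF1⟩
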